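/- **Machines.** An *interactive randomized Turing machine* (ITM) has a finite control, finitely many private tapes over $\{0,1\}$, coin tosses, an output tape, and finitely many ports; linking two ports of two ITMs means that they share a communication tape. In a network exactly one ITM is active at a time; an active ITM passes the activation to the ITM linked to one of its ports, or just stops, in which case (and also if the addressed ITM ignores the activation) a distinguished *top* machine is activated. The top machine is activated first, and the execution ends when it stops. Every ITM receives $1^\kappa$, where $\kappa$ is the security parameter. An ITM is *PPT* if for some polynomial $p$ its total number of steps on input $1^\kappa$ is at most $p(\kappa)$, whatever its coins and the behavior of the machines it interacts with. **Secure realization.** An ideal functionality $\mathcal F$ is an ITM with one port for each of $n$ parties. A protocol $\Pi=(\pi_1,\dots,\pi_n)$ consists of PPT ITMs $\pi_i$, each with an input/output port and a port to a PPT ITM $C_\Pi$ that models the communication channels. A distinguisher $\mathcal D$ is a non-uniform PPT ITM (with advice strings of polynomial length) that is linked, as the top machine, to the input/output ports of all parties and finally outputs a bit. In the real world the parties are linked to $C_\Pi$; in the ideal world they are linked to $\mathcal F$, and an honest party is the dummy $\phi_j$, which forwards everything between $\mathcal D$ and $\mathcal F$. Two such systems are *indistinguishable* if for every $\mathcal D$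 the absolute difference of the probabilities that $\mathcal D$ outputs $1$ is negligible, i.e. for every $c$ it is less than $\kappa^{-c}$ for all large $\kappa$. The protocol $\Pi$ *securely realizes $\mathcal F$ against a single corruption* if * the system $(\pi_1,\dots,\pi_n)$ with $C_\Pi$ is indistinguishable from $(\phi_1,\dots,\phi_n)$ with $\mathcal F$, and * for every $i$ and every PPT ITM $\pi_i'$ there is a PPT ITM $Sim(\pi'_i)$ such that $(\pi_i',\pi_{-i})$ with $C_\Pi$ is indistinguishable from $(Sim(\pi_i'),\phi_{-i})$ with $\mathcal F$. **Games.** A *normal-form computational game $\mathcal G^{\mathcal F}$ with access to* a PPT functionality $\mathcal F$ has $n$ players whose strategies are the PPT ITMs with two ports, one linked to $\mathcal F$ and one linked to a fixed PPT ITM, the rules of the game, which is the top machine and outputs the outcome $\omega\in\{0,1\}^*$. The utility of player $i$ is $U_i^\kappa(\omega)\in\mathbb R$, where the relation $U_i^\kappa(\omega)\le U_i^\kappa(\omega')$ can be decided in polynomial time given $1^\kappa,\omega,\omega'$. $U^\kappa_i(s)$ denotes the random utility under the profile $s$. The *implementation* $\mathcal G^{\Pi}$ of $\mathcal G^{\mathcal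 F}$ with $\Pi$ is the game with the same rules and utilities in which the players are linked to $C_\Pi$ instead of $\mathcal F$. The profile *corresponding* to $\sigma$ is $s=(s_1,\dots,s_n)$, where $s_i$ follows $\sigma_i$ but executes $\pi_i$ whenever $\sigma_i$ interacts with $\mathcal F$. **Pseudo-equilibrium.** An ensemble $X=(X_\kappa)$ of real random variables *computationally mean dominates* $Y=(Y_\kappa)$, written $X\gtrsim Y$, if for every integer $c\ge1$ there are an integer $\hat c>c$ and $\kappa_0>0$ such that for all $\kappa\ge\kappa_0$, with $m=\kappa^{\hat c}$ and independent samples, $$\Pr\Big[\tfrac1m\sum_{j=1}^m Y_\kappa^{(j)}\ge\tfrac1m\sum_{j=1}^m X_\kappa^{(j)}\Big]-\Pr\Big[\tfrac1m\sum_{j=1}^m X_\kappa^{(j)}\ge\tfrac1m\sum_{j=1}^m Y_\kappa^{(j)}\Big]<\frac1{\kappa^c}.$$ A profile $s$ of strategies is a *computational pseudo-equilibrium* if $U_i(s)\gtrsim U_i(\hat s_i,s_{-i})$ for every player $i$ and every strategy $\hat s_i$. **Theorem.** Let $\Pi$ be a protocol that securely realizes the ideal functionality $\mathcal F$ against a single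 corruption, let $\mathcal G^{\mathcal F}$ be a normal-form computational game with access to $\mathcal F$, and let $\mathcal G^{\Pi}$ be its implementation with $\Pi$. If $\sigma$ is a computational pseudo-equilibrium of $\mathcal G^{\mathcal F}$, then the corresponding profile $s$ is a computational pseudo-equilibrium of $\mathcal G^{\Pi}$. -/

import Mathlib

namespace PseudoNash

/-! ## Interactive randomized Turing machines

A machine has a finite control and finitely many tapes over `{0,1}`. As in Mathlib's `Turing.TM2`
(the machine model of Mathlib's polynomial-time computability), tapes are accessed as stacks: a
two-way tape is a pair of stacks. Private tapes are indexed by `K`; there is one communication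
tape for every port `p : P`, shared with the machine linked to that port. Exactly one machine is
active at any time. -/

/-- One instruction of a machine with private tapes `K`, ports `P` and states `Q`. -/
inductive Instr (K P Q : Type) : Type
  /-- change the state -/
  | goto (q : Q)
  /-- write a bit on top of a private or communication tape -/
  | push (s : K ⊕ P) (b : Bool) (q : Q)
  /-- remove and read the top bit of a tape (`none` if the tape is empty) -/
  | pop (s : K ⊕ P) (next : Option Bool → Q)
  /-- toss a fair coin -/
  | flip (next : Bool → Q)
  /-- pass the activation to the machine linked to port `p` -/
  | send (p : P) (q : Q)
  /-- end the activation without naming a successor -/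
  | done (q : Q)

/-- Interactive randomized Turing machines with ports `P`. -/
structure ITM (P : Type) where
  /-- states -/
  Q : Type
  /-- private tapes -/
  K : Type
  finQ : Finite Q
  finK : Finite K
  decK : DecidableEq K
  start : Q
  /-- the private tapes on which the security parameter `1^κ` is written at the start -/
  input : K → Bool
  /-- the output tape -/
  out : K
  /-- the program -/
  code : Q → Instr K P Q
  /-- `recv (some p) q`: the state after an activation through port `p`; `recv none q`: the state
  after a default activation. The value `none` means that the machine ignores the activation, as
  a machine that has halted does. -/
  recv : Option P → Q → Option Q

attribute [instance] ITM.finQ ITM.finK ITM.decK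

/-- How a step ends: the machine stays active, passes the activation to a port, or just stops. -/
inductive Signal (P : Type) : Type
  | run
  | send (p : P)
  | done

namespace ITM

variable {P : Type}

/-- The internal configuration of a machine: its state and the content of its private tapes. -/
structure Local (M : ITM P) where
  state : M.Q
  mem : M.K → List Bool

/-- The initial content of the private tapes: `1^κ` on the input tapes, all others empty. -/
def initMem (M : ITM P) (κ : ℕ) : M.K → List Bool :=
  fun k => if M.input k then List.replicate κ true else []

/-- One step of an active machine, given the content `T` of its communication tapes. -/
noncomputable def step [DecidableEq P] (M : ITM P) (l : M.Local) (T : P → List Bool) :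
    PMF (M.Local × (P → List Bool) × Signal P) :=
  match M.code l.state with
  | .goto q => PMF.pure (⟨q, l.mem⟩, T, .run)
  | .push (.inl k) b q => PMF.pure (⟨q, Function.update l.mem k (b :: l.mem k)⟩, T, .run)
  | .push (.inr p) b q => PMF.pure (⟨q, l.mem⟩, Function.update T p (b :: T p), .run)
  | .pop (.inl k) next =>
      PMF.pure (⟨next (l.mem k).head?, Function.update l.mem k (l.mem k).tail⟩, T, .run)
  | .pop (.inr p) next => PMF.pure (⟨next (T p).head?, l.mem⟩, Function.update T p (T p).tail, .run)
  | .flip next => (PMF.uniformOfFintype Bool).map fun b => (⟨next b, l.mem⟩, T, .run)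
  | .send p q => PMF.pure (⟨q, l.mem⟩, T, .send p)
  | .done q => PMF.pure (⟨q, l.mem⟩, T, .done)

/-- `M.Trace mem t a l T`: in some interaction with some outside world, and for some coin tosses,
the machine `M`, started with private tapes `mem`, has made `t` steps in total and has internal
configuration `l` and communication tapes `T`; `a` tells whether it is active. Whenever `M` is not
active, the outside may rewrite the communication tapes and activate `M` again. -/
inductive Trace [DecidableEq P] (M : ITM P) (mem : M.K → List Bool) :
    ℕ → Bool → M.Local → (P → List Bool) → Prop
  | init (T : P → List Bool) : Trace M mem 0 false ⟨M.start, mem⟩ T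
  | activate {t : ℕ} {l : M.Local} {T : P → List Bool} (T' : P → List Bool) (p : Option P)
      (q : M.Q) : Trace M mem t false l T → M.recv p l.state = some q →
      Trace M mem t true ⟨q, l.mem⟩ T'
  | run {t : ℕ} {l l' : M.Local} {T T' : P → List Bool} : Trace M mem t true l T →
      (l', T', Signal.run) ∈ (M.step l T).support → Trace M mem (t + 1) true l' T'
  | send {t : ℕ} {l l' : M.Local} {T T' : P → List Bool} (p : P) : Trace M mem t true l T →
      (l', T', Signal.send p) ∈ (M.step l T).support → Trace M mem (t + 1) false l' T'
  | done {t : ℕ} {l l' : M.Local} {T T' : P → List Bool} : Trace M mem t true l T →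
      (l', T', Signal.done) ∈ (M.step l T).support → Trace M mem (t + 1) false l' T'

/-- Probabilistic polynomial time: on input `1^κ` the total number of steps is at most `p κ` for a
polynomial `p`, whatever the coin tosses and the behavior of the outside world. -/
def IsPPT [DecidableEq P] (M : ITM P) : Prop :=
  ∃ p : Polynomial ℕ, ∀ κ t a l T, M.Trace (M.initMem κ) t a l T → t ≤ p.eval κ

end ITM

/-- An output string that stands for the answer `1`. -/
def Accepts (w : List Bool) : Prop := w.head? = some true

/-- Polynomial-time decidability of a relation on strings (with parameter `1^κ`): a machine without
ports, with `x` and `y` written on two of its tapes, halts within polynomially many steps and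
always outputs the correct answer. -/
def PolyTimeDecidable (R : ℕ → List Bool → List Bool → Prop) : Prop :=
  ∃ (M : ITM Empty) (k₁ k₂ : M.K), k₁ ≠ k₂ ∧ (M.recv none M.start).isSome ∧
    (∃ p : Polynomial ℕ, ∀ κ x y t a l T,
      M.Trace (Function.update (Function.update (M.initMem κ) k₁ x) k₂ y) t a l T →
        t ≤ p.eval (κ + x.length + y.length)) ∧
    ∀ κ x y t l T,
      M.Trace (Function.update (Function.update (M.initMem κ) k₁ x) k₂ y) t false l T →
        0 < t → (Accepts (l.mem M.out) ↔ R κ x y)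

/-! ## Networks

`n` parties sit between a machine at the top (the rules of a game, or a distinguisher) and a
machine at the bottom (an ideal functionality, or the communication channels of a protocol). -/

/-- The two ports of a party: `up` to the top machine, `down` to the bottom machine. -/
inductive Side : Type
  | up
  | down
  deriving DecidableEq

/-- A party is either a machine or a dummy. A dummy forwards everything in both directions: it
identifies the communication tape at the top with the one at the bottom. -/
inductive Party : Type 1
  | dummy
  | machine (M : ITM Side)

namespace Party

def IsDummy : Party → Bool
  | dummy => true
  | machine _ => false

def State : Party → Type
  | dummy => Unit
  | machine M => M.Local

def init (κ : ℕ) : (p : Party) → p.State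
  | dummy => ()
  | machine M => ⟨M.start, M.initMem κ⟩

noncomputable def step : (p : Party) → p.State → (Side → List Bool) →
    PMF (p.State × (Side → List Bool) × Signal Side)
  | dummy, s, T => PMF.pure (s, T, .done)
  | machine M, s, T => M.step s T

def recv : (p : Party) → Side → p.State → Option p.State
  | dummy, _, _ => none
  | machine M, d, s => (M.recv (some d) s.state).map fun q => ⟨q, s.mem⟩

end Party

/-- The machines of a network. -/
inductive Node (n : ℕ) : Type
  | top
  | party (i : Fin n)
  | bot

/-- The global configuration of a network. -/
structure Net {n : ℕ} (top : ITM (Fin n)) (parties : Fin n → Party) (bot : ITM (Fin n)) where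
  /-- the active machine; `none` when the execution is over -/
  active : Option (Node n)
  topS : top.Local
  partyS : ∀ i, (parties i).State
  botS : bot.Local
  /-- communication tape between the top machine and party `i` -/
  upT : Fin n → List Bool
  /-- communication tape between party `i` and the bottom machine (unused if `i` is a dummy,
  whose single tape is `upT i`) -/
  downT : Fin n → List Bool

namespace Net

variable {n : ℕ} {top : ITM (Fin n)} {parties : Fin n → Party} {bot : ITM (Fin n)}

/-- Default activation of the top machine; the execution is over if it ignores it. -/
def wakeTop (c : Net top parties bot) : Net top parties bot :=
  match top.recv none c.topS.state with
  | some q => { c with active := some .top, topS := ⟨q, c.topS.mem⟩ }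
  | none => { c with active := none }

/-- Activate the top machine through its port `i`. If a machine ignores an activation, the top
machine is activated by default; likewise in the next two definitions. -/
def toTop (i : Fin n) (c : Net top parties bot) : Net top parties bot :=
  match top.recv (some i) c.topS.state with
  | some q => { c with active := some .top, topS := ⟨q, c.topS.mem⟩ }
  | none => c.wakeTop

def toBot (i : Fin n) (c : Net top parties bot) : Net top parties bot :=
  match bot.recv (some i) c.botS.state with
  | some q => { c with active := some .bot, botS := ⟨q, c.botS.mem⟩ }
  | none => c.wakeTop

def toParty (i : Fin n) (d : Side) (c : Net top parties bot) : Net top parties bot :=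
  match (parties i).recv d (c.partyS i) with
  | some s => { c with active := some (.party i), partyS := Function.update c.partyS i s }
  | none => c.wakeTop

/-- The communication tapes as seen by party `i`. -/
def partyTapes (c : Net top parties bot) (i : Fin n) : Side → List Bool
  | .up => c.upT i
  | .down => c.downT i

/-- The communication tapes as seen by the bottom machine. -/
def botTapes (c : Net top parties bot) : Fin n → List Bool :=
  fun i => if (parties i).IsDummy then c.upT i else c.downT i

def afterTop (c : Net top parties bot) :
    top.Local × (Fin n → List Bool) × Signal (Fin n) → Net top parties bot
  | (l, T, sig) =>
    let c' : Net top parties bot := { c with topS := l, upT := T }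
    match sig with
    | .run => c'
    | .send i => if (parties i).IsDummy then c'.toBot i else c'.toParty i .up
    | .done => { c' with active := none }

def afterParty (c : Net top parties bot) (i : Fin n) :
    (parties i).State × (Side → List Bool) × Signal Side → Net top parties bot
  | (s, T, sig) =>
    let c' : Net top parties bot :=
      { c with
        partyS := Function.update c.partyS i s
        upT := Function.update c.upT i (T .up)
        downT := Function.update c.downT i (T .down) }
    match sig with
    | .run => c'
    | .send .up => c'.toTop i
    | .send .down => c'.toBot i
    | .done => c'.wakeTop

def afterBot (c : Net top parties bot) :
    bot.Local × (Fin n → List Bool) × Signal (Fin n) → Net top parties bot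
  | (l, T, sig) =>
    let c' : Net top parties bot :=
      { c with
        botS := l
        upT := fun i => if (parties i).IsDummy then T i else c.upT i
        downT := fun i => if (parties i).IsDummy then c.downT i else T i }
    match sig with
    | .run => c'
    | .send i => if (parties i).IsDummy then c'.toTop i else c'.toParty i .down
    | .done => c'.wakeTop

/-- One step of the network: the active machine makes one step. The execution is over when the
top machine ends an activation by `done`. -/
noncomputable def step (c : Net top parties bot) : PMF (Net top parties bot) :=
  match c.active with
  | none => PMF.pure c
  | some .top => (top.step c.topS c.upT).map c.afterTop
  | some (.party i) => ((parties i).step (c.partyS i) (c.partyTapes i)).map (c.afterParty i)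
  | some .bot => (bot.step c.botS c.botTapes).map c.afterBot

end Net

section Execution

variable {n : ℕ} (top : ITM (Fin n)) (mem : top.K → List Bool) (parties : Fin n → Party)
  (bot : ITM (Fin n)) (κ : ℕ)

/-- Initial configuration: all communication tapes are empty, the private tapes of the top machine
contain `mem`, and the top machine is activated first. -/
def initNet : Net top parties bot :=
  Net.wakeTop
    { active := none
      topS := ⟨top.start, mem⟩
      partyS := fun i => (parties i).init κ
      botS := ⟨bot.start, bot.initMem κ⟩
      upT := fun _ => []
      downT := fun _ => [] }

/-- The distribution of the configuration after `t` steps. -/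
noncomputable def netAfter : ℕ → PMF (Net top parties bot)
  | 0 => PMF.pure (initNet top mem parties bot κ)
  | t + 1 => (netAfter t).bind Net.step

/-- The worst-case running time: the least `t` such that the execution is over after `t` steps,
whatever the coin tosses. -/
noncomputable def runtime : ℕ :=
  sInf {t | ∀ c ∈ (netAfter top mem parties bot κ t).support, c.active = none}

/-- The distribution of the string on the output tape of the top machine at the end. -/
noncomputable def outputLaw : PMF (List Bool) :=
  (netAfter top mem parties bot κ (runtime top mem parties bot κ)).map fun c => c.topS.mem top.out

end Execution

/-! ## Simulation-based security -/

def Negligible (δ : ℕ → ℝ) : Prop :=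
  ∀ c : ℕ, ∃ κ₀ : ℕ, ∀ κ ≥ κ₀, δ κ < 1 / (κ : ℝ) ^ c

/-- A distinguisher (environment): a non-uniform PPT machine, which besides `1^κ` receives an advice
string of polynomial length. -/
structure Distinguisher (n : ℕ) where
  machine : ITM (Fin n)
  adviceTape : machine.K
  advice : ℕ → List Bool
  ppt : ∃ p : Polynomial ℕ, ∀ κ, (advice κ).length ≤ p.eval κ ∧
    ∀ t a l T, machine.Trace (Function.update (machine.initMem κ) adviceTape (advice κ)) t a l T →
      t ≤ p.eval κ

/-- The probability that the distinguisher outputs `1` when it interacts with the given parties and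
the given bottom machine. -/
noncomputable def Distinguisher.prob {n : ℕ} (D : Distinguisher n) (parties : Fin n → Party)
    (bot : ITM (Fin n)) (κ : ℕ) : ℝ :=
  ((outputLaw D.machine (Function.update (D.machine.initMem κ) D.adviceTape (D.advice κ))
    parties bot κ).toOuterMeasure {w | Accepts w}).toReal

/-- Two systems of parties, each with its own bottom machine, are computationally indistinguishable
for every distinguisher that interacts with them. -/
def Indistinguishable {n : ℕ} (parties : Fin n → Party) (bot : ITM (Fin n))
    (parties' : Fin n → Party) (bot' : ITM (Fin n)) : Prop :=
  ∀ D : Distinguisher n, Negligible fun κ => |D.prob parties bot κ - D.prob parties' bot' κ|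

/-- An `n`-party protocol: a PPT machine for every party, and a PPT machine that models the
communication channels. The port `up` of a party is its input/output interface. -/
structure Protocol (n : ℕ) where
  party : Fin n → ITM Side
  channel : ITM (Fin n)
  party_ppt : ∀ i, (party i).IsPPT
  channel_ppt : channel.IsPPT

/-- The protocol securely realizes the functionality `F` against (at most) a single corruption: the
honest execution is indistinguishable from the ideal one with dummy parties; and for every party
`i` and every PPT machine `A` played by `i` in place of its prescribed machine there is a PPT
machine `S`, the simulated deviation, such that the execution of the protocol with `A` is
indistinguishable from the ideal one in which `i` plays `S` and all others are dummies. -/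
def Protocol.SecurelyRealizes {n : ℕ} (prot : Protocol n) (F : ITM (Fin n)) : Prop :=
  Indistinguishable (fun j => .machine (prot.party j)) prot.channel (fun _ => .dummy) F ∧
  ∀ (i : Fin n) (A : ITM Side), A.IsPPT → ∃ S : ITM Side, S.IsPPT ∧
    Indistinguishable
      (Function.update (fun j => .machine (prot.party j)) i (.machine A)) prot.channel
      (Function.update (fun _ => .dummy) i (.machine S)) F

/-- The machine that follows `σ` but runs `π` in place of the machine linked to the port `down` of
`σ`. The communication tape between `σ` and `π` becomes a private tape; the first component of the
state tells whether `σ` (`up`) or `π` (`down`) is running. -/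
def ITM.plug (σ π : ITM Side) : ITM Side where
  Q := Side × σ.Q × π.Q
  K := (σ.K ⊕ π.K) ⊕ Unit
  finQ :=
    haveI : Finite Side := Finite.of_surjective (fun b : Bool => if b then Side.up else Side.down)
      (by rintro (_ | _); exacts [⟨true, rfl⟩, ⟨false, rfl⟩])
    inferInstance
  finK := inferInstance
  decK := inferInstance
  start := (.up, σ.start, π.start)
  input := Sum.elim (Sum.elim σ.input π.input) fun _ => false
  out := .inl (.inl σ.out)
  code := fun
    | (.up, q, r) =>
      let tape : σ.K ⊕ Side → ((σ.K ⊕ π.K) ⊕ Unit) ⊕ Side := fun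
        | .inl k => .inl (.inl (.inl k))
        | .inr .up => .inr .up
        | .inr .down => .inl (.inr ())
      match σ.code q with
      | .goto q' => .goto (.up, q', r)
      | .push s b q' => .push (tape s) b (.up, q', r)
      | .pop s next => .pop (tape s) fun x => (.up, next x, r)
      | .flip next => .flip fun x => (.up, next x, r)
      | .send .up q' => .send .up (.up, q', r)
      | .send .down q' =>
        match π.recv (some .up) r with
        | some r' => .goto (.down, q', r')
        | none => .done (.up, q', r)
      | .done q' => .done (.up, q', r)
    | (.down, q, r) =>
      let tape : π.K ⊕ Side → ((σ.K ⊕ π.K) ⊕ Unit) ⊕ Side := fun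
        | .inl k => .inl (.inl (.inr k))
        | .inr .up => .inl (.inr ())
        | .inr .down => .inr .down
      match π.code r with
      | .goto r' => .goto (.down, q, r')
      | .push s b r' => .push (tape s) b (.down, q, r')
      | .pop s next => .pop (tape s) fun x => (.down, q, next x)
      | .flip next => .flip fun x => (.down, q, next x)
      | .send .down r' => .send .down (.down, q, r')
      | .send .up r' =>
        match σ.recv (some .down) q with
        | some q' => .goto (.up, q', r')
        | none => .done (.down, q, r')
      | .done r' => .done (.down, q, r')
  recv := fun
    | some .up, (_, q, r) => (σ.recv (some .up) q).map fun q' => (.up, q', r)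
    | some .down, (_, q, r) => (π.recv (some .down) r).map fun r' => (.down, q, r')
    | none, _ => none

/-! ## Computational games and pseudo-equilibria -/

/-- The probability that the empirical mean of `m` samples of `μ` is at least the empirical mean of
`m` samples of `ν`, all samples being independent. -/
noncomputable def probMeanGE (m : ℕ) (μ ν : MeasureTheory.Measure ℝ) : ℝ :=
  ((MeasureTheory.Measure.pi fun _ : Fin m => μ).prod
    (MeasureTheory.Measure.pi fun _ : Fin m => ν)).real
    {p | (∑ j, p.2 j) / (m : ℝ) ≤ (∑ j, p.1 j) / (m : ℝ)}

/-- Computational mean dominance of ensembles of real random variables, given by their laws. -/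
def MeanDominates (X Y : ℕ → MeasureTheory.Measure ℝ) : Prop :=
  ∀ c : ℕ, 1 ≤ c → ∃ c' : ℕ, c < c' ∧ ∃ κ₀ : ℕ, 0 < κ₀ ∧ ∀ κ ≥ κ₀,
    probMeanGE (κ ^ c') (Y κ) (X κ) - probMeanGE (κ ^ c') (X κ) (Y κ) < 1 / (κ : ℝ) ^ c

/-- A normal form computational game with `n` players, linked via two fixed PPT machines. The
machine `rules` conducts the game and writes the outcome, a string, on its output tape; the machine
`link` is an ideal functionality, or the communication channels of a protocol. The utilities may
depend on the security parameter, and the utilities of two outcomes can be compared in polynomial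
time. -/
structure Game (n : ℕ) where
  rules : ITM (Fin n)
  link : ITM (Fin n)
  utility : Fin n → ℕ → List Bool → ℝ
  rules_ppt : rules.IsPPT
  link_ppt : link.IsPPT
  utility_ppt : ∀ i, PolyTimeDecidable fun κ x y => utility i κ x ≤ utility i κ y

namespace Game

variable {n : ℕ}

/-- The law of the utility of player `i` under the profile `s` with security parameter `κ`. The port
`up` of a strategy is linked to the rules, the port `down` to the machine `link`. -/
noncomputable def utilityLaw (G : Game n) (s : Fin n → ITM Side) (i : Fin n) (κ : ℕ) :
    MeasureTheory.Measure ℝ :=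
  ((outputLaw G.rules (G.rules.initMem κ) (fun j => .machine (s j)) G.link κ).map
    (G.utility i κ)).toMeasure

/-- Computational pseudo-equilibrium; the strategies of the players are the PPT machines. -/
def IsPseudoEquilibrium (G : Game n) (s : Fin n → ITM Side) : Prop :=
  (∀ i, (s i).IsPPT) ∧ ∀ (i : Fin n) (s' : ITM Side), s'.IsPPT →
    MeanDominates (G.utilityLaw s i) (G.utilityLaw (Function.update s i s') i)

/-- The players of `G` have access to the functionality `F`. -/
def HasAccess (G : Game n) (F : ITM (Fin n)) : Prop := G.link = F

/-- The implementation of a game with a protocol: the players are no longer linked to the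
functionality but to the communication channels of the protocol. -/
def implement (G : Game n) (prot : Protocol n) : Game n :=
  { G with link := prot.channel, link_ppt := prot.channel_ppt }

end Game

/-- The corresponding profile: every player follows her strategy but executes her machine of the
protocol whenever the strategy interacts with the functionality. -/
def Protocol.correspond {n : ℕ} (prot : Protocol n) (σ : Fin n → ITM Side) : Fin n → ITM Side :=
  fun i => (σ i).plug (prot.party i)

end PseudoNash

/-! Fix a player `i` and a deviation in the game with the protocol. Security turns the deviating
machine into a simulated one, which is a legal deviation in the game with the functionality, where
`σ` is a pseudo-equilibrium. So mean dominance only has to survive two replacements: all protocol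
machines by dummies, and the deviator among protocol machines by the simulated deviator among
dummies.

The rules, any set of strategies and a comparison of utilities run in polynomial time, so together
they form a distinguisher. Absorbing all strategies handles the honest replacement, absorbing all
but that of player `i` the deviating one. Utilities are accessible only through comparisons;
therefore the distinguisher carries an outcome `x` as advice and accepts an outcome `w` if `u x ≤ u
w`. A step writes at most one bit, so outcomes have polynomial length and for each `κ` there are
finitely many. The `x` with the largest gap can thus serve as advice, and this gap is negligible. On
finitely many outcomes every upper set of utilities is cut out by one such comparison or is missed
altogether, so the two laws of the utility are negligibly close on all upper sets
(`Game.exists_negligible_upperClose`).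

Closeness on upper sets adds up under convolution, because translates of upper sets are upper sets.
Sums of `m` samples are close up to `m` times the gap, and the probabilities in the definition of
mean dominance change by at most `m * (δ + ε)`. This remains negligible for `m = κ ^ c'`
(`MeanDominates.of_upperClose`).

Most of the work shows that the distinguisher really plays the game. It is arranged so that one step
of its network is one step of the game on the same coin (`Tester.stepWith_view`). The executions are
therefore coupled (`Tester.exists_coupling`), and when the game ends the judge takes over; hence
acceptance has the probability of the comparison (`Tester.outputLaw_accepts`). Each step belongs to
exactly one component, so running times add: this gives the polynomial bounds (`ITM.plug_at`,
`Tester.inv_of_trace`) and the termination of networks. -/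

namespace PseudoNash

/-! ## Steps as deterministic functions of one coin -/

namespace Signal

/-- The machine stays active. -/
def isRun {P : Type} : Signal P → Bool
  | run => true
  | _ => false

end Signal

namespace Instr

variable {K P Q K' P' Q' : Type}

/-- Executing an instruction with coin `b` on tapes with contents `C`. -/
def exec [DecidableEq K] [DecidableEq P] (b : Bool) (C : K ⊕ P → List Bool) :
    Instr K P Q → Q × (K ⊕ P → List Bool) × Signal P
  | goto q => (q, C, .run)
  | push s x q => (q, Function.update C s (x :: C s), .run)
  | pop s next => (next (C s).head?, Function.update C s (C s).tail, .run)
  | flip next => (next b, C, .run)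
  | send p q => (q, C, .send p)
  | done q => (q, C, .done)

/-- Transport of an instruction along a renaming of tapes and states, with prescribed treatment of
the instructions that end an activation. -/
def lift (τ : K ⊕ P → K' ⊕ P') (g : Q → Q') (onSend : P → Q → Instr K' P' Q')
    (onDone : Q → Instr K' P' Q') : Instr K P Q → Instr K' P' Q'
  | goto q => goto (g q)
  | push s x q => push (τ s) x (g q)
  | pop s next => pop (τ s) fun x => g (next x)
  | flip next => flip fun x => g (next x)
  | send p q => onSend p q
  | done q => onDone q

variable [DecidableEq K] [DecidableEq P]

/-- Only a `send` instruction emits this signal, so the result of a step determines the instruction,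
and with it the code of the machine that hosts the lifted one. -/
theorem lift_of_exec_send {τ : K ⊕ P → K' ⊕ P'} {g : Q → Q'}
    {onSend : P → Q → Instr K' P' Q'} {onDone : Q → Instr K' P' Q'} {b : Bool}
    {C C' : K ⊕ P → List Bool} {i : Instr K P Q} {q : Q} {p : P}
    (h : i.exec b C = (q, C', .send p)) : i.lift τ g onSend onDone = onSend p q := by
  cases i <;> simp only [exec, Prod.mk.injEq, reduceCtorEq, and_false] at h
  obtain ⟨rfl, -, h⟩ := h
  cases h
  rfl

theorem lift_of_exec_done {τ : K ⊕ P → K' ⊕ P'} {g : Q → Q'}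
    {onSend : P → Q → Instr K' P' Q'} {onDone : Q → Instr K' P' Q'} {b : Bool}
    {C C' : K ⊕ P → List Bool} {i : Instr K P Q} {q : Q}
    (h : i.exec b C = (q, C', .done)) : i.lift τ g onSend onDone = onDone q := by
  cases i <;> simp only [exec, Prod.mk.injEq, reduceCtorEq, and_false] at h
  obtain ⟨rfl, -, h⟩ := h
  rfl

/-- A step pushes at most one bit. Ultimately this bounds the length of an outcome by the running
time of the rules. -/
theorem exec_length_le {b : Bool} {C C' : K ⊕ P → List Bool} {i : Instr K P Q} {q : Q}
    {sig : Signal P} (h : i.exec b C = (q, C', sig)) (s : K ⊕ P) :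
    (C' s).length ≤ (C s).length + 1 := by
  cases i <;> simp only [exec, Prod.mk.injEq] at h <;> obtain ⟨-, rfl, -⟩ := h <;>
    first
    | exact Nat.le_succ _
    | (rename_i s' _ ; by_cases hs : s = s' <;> [(subst hs; simp; try omega); simp [hs]])
    | (rename_i s' _ _ ; by_cases hs : s = s' <;> [(subst hs; simp; try omega); simp [hs]])

variable [DecidableEq K'] [DecidableEq P']

theorem exec_tapes_of_not_run {b : Bool} {C C' : K ⊕ P → List Bool} {i : Instr K P Q} {q : Q}
    {sig : Signal P} (h : i.exec b C = (q, C', sig)) (hs : sig.isRun = false) : C' = C := by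
  cases i <;> simp only [exec, Prod.mk.injEq] at h <;> obtain ⟨-, rfl, rfl⟩ := h <;>
    first | rfl | simp [Signal.isRun] at hs

theorem _root_.Function.extend_update_comp {α β γ : Type*} [DecidableEq α] [DecidableEq β]
    {τ : α → β} (hτ : τ.Injective) (C : β → γ) (s : α) (x : γ) :
    Function.extend τ (Function.update (C ∘ τ) s x) C = Function.update C (τ s) x := by
  funext y
  by_cases hy : ∃ a, τ a = y
  · obtain ⟨a, rfl⟩ := hy
    rw [hτ.extend_apply]
    by_cases h : a = s
    · subst h; simp
    · rw [Function.update_of_ne h, Function.update_of_ne (fun e => h (hτ e))]; rfl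
  · rw [Function.extend_apply' _ _ _ hy, Function.update_of_ne]
    rintro rfl
    exact hy ⟨s, rfl⟩

theorem _root_.Function.extend_comp_self {α β γ : Type*} {τ : α → β} (hτ : τ.Injective)
    (C : β → γ) : Function.extend τ (C ∘ τ) C = C := by
  funext y
  by_cases hy : ∃ a, τ a = y
  · obtain ⟨a, rfl⟩ := hy
    rw [hτ.extend_apply]; rfl
  · rw [Function.extend_apply' _ _ _ hy]

/-- A guest machine sees the tapes `D` of its host through `τ`. Injectivity keeps a write to one of
its tapes from showing up on another, and `Function.extend` leaves the tapes outside the range of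
`τ` alone. -/
theorem exec_lift_run {τ : K ⊕ P → K' ⊕ P'} (hτ : τ.Injective) {g : Q → Q'}
    {onSend : P → Q → Instr K' P' Q'} {onDone : Q → Instr K' P' Q'} {b : Bool}
    {D : K' ⊕ P' → List Bool} {C C' : K ⊕ P → List Bool} {i : Instr K P Q} {q : Q}
    (hC : D ∘ τ = C) (h : i.exec b C = (q, C', .run)) :
    (i.lift τ g onSend onDone).exec b D = (g q, Function.extend τ C' D, .run) := by
  subst hC
  cases i <;> simp only [exec, Prod.mk.injEq, reduceCtorEq, and_false] at h <;>
    obtain ⟨rfl, rfl, -⟩ := h <;>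
    simp [lift, exec, Function.extend_update_comp hτ, Function.extend_comp_self hτ]

end Instr

/-! ### Steps and traces of a single machine. -/

namespace ITM

theorem length_initMem_le {P : Type} {M : ITM P} (κ : ℕ) (k : M.K) : (M.initMem κ k).length ≤ κ := by
  unfold initMem
  split <;> simp

variable {P : Type} [DecidableEq P] (M : ITM P)

/-- The result of one step with coin `b`. -/
def stepWith (b : Bool) (l : M.Local) (T : P → List Bool) :
    M.Local × (P → List Bool) × Signal P :=
  let r := (M.code l.state).exec b (Sum.elim l.mem T)
  (⟨r.1, r.2.1 ∘ Sum.inl⟩, r.2.1 ∘ Sum.inr, r.2.2)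

theorem _root_.PMF.map_const_uniform {α : Type*} (x : α) :
    (PMF.uniformOfFintype Bool).map (fun _ => x) = PMF.pure x :=
  PMF.map_const _ _

/-- Every step may be thought to toss one coin, which all instructions but `flip` ignore. With one
source of randomness for all machines, two different networks can be run on the same coins. -/
theorem step_eq_map (l : M.Local) (T : P → List Bool) :
    M.step l T = (PMF.uniformOfFintype Bool).map fun b => M.stepWith b l T := by
  unfold step stepWith
  rcases h : M.code l.state with q | ⟨s | s, x, q⟩ | ⟨s | s, next⟩ | next | ⟨p, q⟩ | q <;>
    simp only [Instr.exec, Sum.elim_comp_inl, Sum.elim_comp_inr, Sum.update_elim_inl,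
      Sum.update_elim_inr, Sum.elim_inl, Sum.elim_inr, PMF.map_const_uniform]

theorem stepWith_mem_support (b : Bool) (l : M.Local) (T : P → List Bool) :
    M.stepWith b l T ∈ (M.step l T).support := by
  rw [step_eq_map, PMF.mem_support_map_iff]
  exact ⟨b, by simp, rfl⟩

theorem stepWith_of_exec {b : Bool} {l : M.Local} {T : P → List Bool} {q : M.Q}
    {C : M.K ⊕ P → List Bool} {sig : Signal P}
    (h : (M.code l.state).exec b (Sum.elim l.mem T) = (q, C, sig)) :
    M.stepWith b l T = (⟨q, C ∘ Sum.inl⟩, C ∘ Sum.inr, sig) := by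
  simp only [stepWith, h]

variable {M}

/-- Induction on traces, with one case for all steps. -/
theorem Trace.induction_on_coins {mem : M.K → List Bool}
    {motive : ℕ → Bool → M.Local → (P → List Bool) → Prop}
    (init : ∀ T, motive 0 false ⟨M.start, mem⟩ T)
    (activate : ∀ t l T T' p q, motive t false l T → M.recv p l.state = some q →
      motive t true ⟨q, l.mem⟩ T')
    (step : ∀ t q q' mem' T C sig b,
      (M.code q).exec b (Sum.elim mem' T) = (q', C, sig) → motive t true ⟨q, mem'⟩ T →
      motive (t + 1) sig.isRun ⟨q', C ∘ Sum.inl⟩ (C ∘ Sum.inr))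
    {t : ℕ} {a : Bool} {l : M.Local} {T : P → List Bool} (h : M.Trace mem t a l T) :
    motive t a l T := by
  have key : ∀ {t : ℕ} {l l' : M.Local} {T T' : P → List Bool} {sig : Signal P},
      motive t true l T → (l', T', sig) ∈ (M.step l T).support →
      motive (t + 1) sig.isRun l' T' := by
    intro t l l' T T' sig ih hs
    rw [step_eq_map, PMF.mem_support_map_iff] at hs
    obtain ⟨b, -, hb⟩ := hs
    simp only [stepWith, Prod.mk.injEq] at hb
    obtain ⟨rfl, rfl, rfl⟩ := hb
    exact step t _ _ _ T _ _ b rfl ih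
  induction h with
  | init T => exact init T
  | activate T' p q _ hr ih => exact activate _ _ _ T' p q ih hr
  | run _ hs ih => exact key ih hs
  | send p _ hs ih => exact key ih hs
  | done _ hs ih => exact key ih hs

theorem Trace.stepWith {mem : M.K → List Bool} {t : ℕ} {l : M.Local} {T : P → List Bool}
    (h : M.Trace mem t true l T) {b : Bool} {q : M.Q} {C : M.K ⊕ P → List Bool} {sig : Signal P}
    (he : (M.code l.state).exec b (Sum.elim l.mem T) = (q, C, sig)) :
    M.Trace mem (t + 1) sig.isRun ⟨q, C ∘ Sum.inl⟩ (C ∘ Sum.inr) := by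
  have hs := M.stepWith_mem_support b l T
  rw [M.stepWith_of_exec he] at hs
  cases sig with
  | run => exact h.run hs
  | send p => exact h.send p hs
  | done => exact h.done hs

variable (M)

/-- A trace in which the communication tapes matter only while the machine is active. -/
def At (mem : M.K → List Bool) (t : ℕ) (a : Bool) (l : M.Local) (T : P → List Bool) : Prop :=
  ∃ T', M.Trace mem t a l T' ∧ (a = true → T' = T)

variable {M} {mem : M.K → List Bool} {t : ℕ} {a : Bool} {l : M.Local} {T : P → List Bool}

theorem At.init (T : P → List Bool) : M.At mem 0 false ⟨M.start, mem⟩ T :=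
  ⟨T, .init T, fun _ => rfl⟩

theorem At.idle (h : M.At mem t false l T) (T' : P → List Bool) : M.At mem t false l T' :=
  let ⟨T₀, h₀, _⟩ := h
  ⟨T₀, h₀, nofun⟩

theorem At.activate (h : M.At mem t false l T) {p : Option P} {q : M.Q}
    (hr : M.recv p l.state = some q) (T' : P → List Bool) : M.At mem t true ⟨q, l.mem⟩ T' :=
  let ⟨_, h₀, _⟩ := h
  ⟨T', .activate T' p q h₀ hr, fun _ => rfl⟩

theorem At.step (h : M.At mem t true l T) {b : Bool} {q : M.Q} {C : M.K ⊕ P → List Bool}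
    {sig : Signal P} (he : (M.code l.state).exec b (Sum.elim l.mem T) = (q, C, sig)) :
    M.At mem (t + 1) sig.isRun ⟨q, C ∘ Sum.inl⟩ (C ∘ Sum.inr) := by
  obtain ⟨T', h₀, hT⟩ := h
  obtain rfl := hT rfl
  exact ⟨_, h₀.stepWith he, fun _ => rfl⟩

/-- A step that ends the activation leaves all tapes unchanged. -/
theorem At.halt (h : M.At mem t true l T) {b : Bool} {q : M.Q} {C : M.K ⊕ P → List Bool}
    {sig : Signal P} (he : (M.code l.state).exec b (Sum.elim l.mem T) = (q, C, sig))
    (hs : sig.isRun = false) (T' : P → List Bool) : M.At mem (t + 1) false ⟨q, l.mem⟩ T' := by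
  have h1 := h.step he
  rw [hs, Instr.exec_tapes_of_not_run he hs] at h1
  exact h1.idle T'

theorem At.length_le (h : M.At mem t a l T) (k : M.K) :
    (l.mem k).length ≤ (mem k).length + t := by
  obtain ⟨T', h, -⟩ := h
  refine Trace.induction_on_coins (motive := fun t _ l _ => (l.mem k).length ≤ (mem k).length + t)
    (fun T => by simp) (fun t l T T' p q ih _ => ih) (fun t q q' mem' T C sig b he ih => ?_) h
  have := Instr.exec_length_le he (Sum.inl k)
  simp only [Sum.elim_inl] at this ih
  simp only [Function.comp_apply]
  omega

end ITM

end PseudoNash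

namespace PseudoNash

/-- The pair of communication tapes of a party. -/
def Side.tapes (u d : List Bool) : Side → List Bool
  | .up => u
  | .down => d

theorem Side.tapes_eta (T : Side → List Bool) : Side.tapes (T .up) (T .down) = T := by
  funext s; cases s <;> rfl

/-- A PPT machine makes at most `p κ` steps on `1^κ`, also while it is idle in between. -/
theorem ITM.IsPPT.exists_bound {P : Type} [DecidableEq P] {M : ITM P} (h : M.IsPPT) :
    ∃ p : Polynomial ℕ, ∀ κ t a l T, M.At (M.initMem κ) t a l T → t ≤ p.eval κ := by
  obtain ⟨p, hp⟩ := h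
  exact ⟨p, fun κ t a l _ ⟨T', h, _⟩ => hp κ t a l T' h⟩

/-! ## A strategy that runs a protocol -/

namespace ITM

section Plug

variable (σ π : ITM Side)

/-- The tapes of the outer machine of `σ.plug π`. -/
def plugOuterTape : σ.K ⊕ Side → (σ.plug π).K ⊕ Side
  | .inl k => .inl (.inl (.inl k))
  | .inr .up => .inr .up
  | .inr .down => .inl (.inr ())

/-- The tapes of the inner machine of `σ.plug π`. -/
def plugInnerTape : π.K ⊕ Side → (σ.plug π).K ⊕ Side
  | .inl k => .inl (.inl (.inr k))
  | .inr .up => .inl (.inr ())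
  | .inr .down => .inr .down

variable {σ π}

/-- The configuration of the outer machine. -/
def plugOuter (l : (σ.plug π).Local) : σ.Local := ⟨l.state.2.1, fun k => l.mem (.inl (.inl k))⟩

/-- The configuration of the inner machine. -/
def plugInner (l : (σ.plug π).Local) : π.Local := ⟨l.state.2.2, fun k => l.mem (.inl (.inr k))⟩

/-- The machine that is running. -/
def plugSide (l : (σ.plug π).Local) : Side := l.state.1

/-- The tape between the outer and the inner machine. -/
def plugLink (l : (σ.plug π).Local) : List Bool := l.mem (.inr ())

theorem plugOuterTape_injective : (plugOuterTape σ π).Injective := by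
  rintro (k | _ | _) (k' | _ | _) h <;> cases h <;> rfl

theorem plugInnerTape_injective : (plugInnerTape σ π).Injective := by
  rintro (k | _ | _) (k' | _ | _) h <;> cases h <;> rfl

theorem elim_comp_plugOuterTape (l : (σ.plug π).Local) (T : Side → List Bool) :
    Sum.elim l.mem T ∘ plugOuterTape σ π =
      Sum.elim (plugOuter l).mem (Side.tapes (T .up) (plugLink l)) := by
  funext x; rcases x with k | _ | _ <;> rfl

theorem elim_comp_plugInnerTape (l : (σ.plug π).Local) (T : Side → List Bool) :
    Sum.elim l.mem T ∘ plugInnerTape σ π =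
      Sum.elim (plugInner l).mem (Side.tapes (plugLink l) (T .down)) := by
  funext x; rcases x with k | _ | _ <;> rfl

/-- As a lift, the program is accessible to the general lemmas on `Instr.lift`; only the handover
between the two parts needs separate treatment. -/
theorem plug_code_up (q : σ.Q) (r : π.Q) : (σ.plug π).code (.up, q, r) =
    (σ.code q).lift (plugOuterTape σ π) (fun q' => (.up, q', r))
      (fun
        | .up, q' => .send .up (.up, q', r)
        | .down, q' =>
          match π.recv (some .up) r with
          | some r' => .goto (.down, q', r')
          | none => .done (.up, q', r))
      (fun q' => .done (.up, q', r)) := by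
  simp only [plug]
  rcases h : σ.code q with _ | ⟨_ | _ | _, _, _⟩ | ⟨_ | _ | _, _⟩ | _ | ⟨_ | _, _⟩ | _ <;> rfl

theorem plug_code_down (q : σ.Q) (r : π.Q) : (σ.plug π).code (.down, q, r) =
    (π.code r).lift (plugInnerTape σ π) (fun r' => (.down, q, r'))
      (fun
        | .down, r' => .send .down (.down, q, r')
        | .up, r' =>
          match σ.recv (some .down) q with
          | some q' => .goto (.up, q', r')
          | none => .done (.down, q, r'))
      (fun r' => .done (.down, q, r')) := by
  simp only [plug]
  rcases h : π.code r with _ | ⟨_ | _ | _, _, _⟩ | ⟨_ | _ | _, _⟩ | _ | ⟨_ | _, _⟩ | _ <;> rfl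

theorem plug_exec_outer_run {q q' : σ.Q} {r : π.Q} {mem : (σ.plug π).K → List Bool}
    {T : Side → List Bool} {b : Bool} {C : σ.K ⊕ Side → List Bool}
    (h : (σ.code q).exec b (Sum.elim (plugOuter ⟨(.up, q, r), mem⟩).mem
      (Side.tapes (T .up) (plugLink ⟨(.up, q, r), mem⟩))) = (q', C, .run)) :
    ((σ.plug π).code (.up, q, r)).exec b (Sum.elim mem T) =
      ((.up, q', r), Function.extend (plugOuterTape σ π) C (Sum.elim mem T), .run) := by
  rw [plug_code_up]
  exact Instr.exec_lift_run plugOuterTape_injective 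
    (elim_comp_plugOuterTape (π := π) ⟨(.up, q, r), mem⟩ T) h

theorem plug_exec_inner_run {q : σ.Q} {r r' : π.Q} {mem : (σ.plug π).K → List Bool}
    {T : Side → List Bool} {b : Bool} {C : π.K ⊕ Side → List Bool}
    (h : (π.code r).exec b (Sum.elim (plugInner ⟨(.down, q, r), mem⟩).mem
      (Side.tapes (plugLink ⟨(.down, q, r), mem⟩) (T .down))) = (r', C, .run)) :
    ((σ.plug π).code (.down, q, r)).exec b (Sum.elim mem T) =
      ((.down, q, r'), Function.extend (plugInnerTape σ π) C (Sum.elim mem T), .run) := by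
  rw [plug_code_down]
  exact Instr.exec_lift_run plugInnerTape_injective 
    (elim_comp_plugInnerTape (σ := σ) ⟨(.down, q, r), mem⟩ T) h

theorem extend_plugOuterTape (C : σ.K ⊕ Side → List Bool) (D : (σ.plug π).K ⊕ Side → List Bool) :
    Function.extend (plugOuterTape σ π) C D = fun
      | .inl (.inl (.inl k)) => C (.inl k)
      | .inl (.inl (.inr k)) => D (.inl (.inl (.inr k)))
      | .inl (.inr ()) => C (.inr .down)
      | .inr .up => C (.inr .up)
      | .inr .down => D (.inr .down) := by
  have h := plugOuterTape_injective.extend_apply C D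
  funext x
  rcases x with ((k | k) | _) | _ | _
  · exact h (.inl k)
  · exact Function.extend_apply' _ _ _ (by rintro ⟨_ | _ | _, h⟩ <;> cases h)
  · exact h (.inr .down)
  · exact h (.inr .up)
  · exact Function.extend_apply' _ _ _ (by rintro ⟨_ | _ | _, h⟩ <;> cases h)

theorem extend_plugInnerTape (C : π.K ⊕ Side → List Bool) (D : (σ.plug π).K ⊕ Side → List Bool) :
    Function.extend (plugInnerTape σ π) C D = fun
      | .inl (.inl (.inr k)) => C (.inl k)
      | .inl (.inl (.inl k)) => D (.inl (.inl (.inl k)))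
      | .inl (.inr ()) => C (.inr .up)
      | .inr .down => C (.inr .down)
      | .inr .up => D (.inr .up) := by
  have h := plugInnerTape_injective.extend_apply C D
  funext x
  rcases x with ((k | k) | _) | _ | _
  · exact Function.extend_apply' _ _ _ (by rintro ⟨_ | _ | _, h⟩ <;> cases h)
  · exact h (.inl k)
  · exact h (.inr .up)
  · exact Function.extend_apply' _ _ _ (by rintro ⟨_ | _ | _, h⟩ <;> cases h)
  · exact h (.inr .down)

theorem tapes_comp_inr {K : Type} (C : K ⊕ Side → List Bool) :
    Side.tapes (C (.inr .up)) (C (.inr .down)) = C ∘ Sum.inr :=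
  Side.tapes_eta (C ∘ Sum.inr)

/-- Every trace of `σ.plug π` consists of a trace of `σ` and a trace of `π`. -/
theorem plug_at {mem : (σ.plug π).K → List Bool} {t : ℕ} {a : Bool} {l : (σ.plug π).Local}
    {T : Side → List Bool} (h : (σ.plug π).Trace mem t a l T) :
    ∃ t₁ t₂, t = t₁ + t₂ ∧
      σ.At (fun k => mem (.inl (.inl k))) t₁ (a && decide (plugSide l = .up)) (plugOuter l)
        (Side.tapes (T .up) (plugLink l)) ∧
      π.At (fun k => mem (.inl (.inr k))) t₂ (a && decide (plugSide l = .down)) (plugInner l)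
        (Side.tapes (plugLink l) (T .down)) := by
  refine Trace.induction_on_coins (motive := fun t a l T => ∃ t₁ t₂, t = t₁ + t₂ ∧
      σ.At (fun k => mem (.inl (.inl k))) t₁ (a && decide (plugSide l = .up)) (plugOuter l)
        (Side.tapes (T .up) (plugLink l)) ∧
      π.At (fun k => mem (.inl (.inr k))) t₂ (a && decide (plugSide l = .down)) (plugInner l)
        (Side.tapes (plugLink l) (T .down)))
    (fun T => ⟨0, 0, rfl, At.init _, At.init _⟩) ?_ ?_ h
  · rintro t ⟨⟨s, q, r⟩, mem'⟩ T T' p ⟨s', q', r'⟩ ⟨t₁, t₂, rfl, h₁, h₂⟩ hr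
    refine ⟨t₁, t₂, rfl, ?_⟩
    -- The composed machine ignores default activations, and each port belongs to one part, which
    -- becomes the active one.
    rcases p with _ | _ | _
    · cases hr
    · obtain ⟨q₁, hq, e⟩ := Option.map_eq_some_iff.1 hr
      cases e
      exact ⟨h₁.activate hq _, h₂.idle _⟩
    · obtain ⟨q₁, hq, e⟩ := Option.map_eq_some_iff.1 hr
      cases e
      exact ⟨h₁.idle _, h₂.activate hq _⟩
  · rintro t ⟨s, q, r⟩ x mem' T C sig b he ⟨t₁, t₂, rfl, h₁, h₂⟩
    cases s with
    | up =>
      refine ⟨t₁ + 1, t₂, by omega, ?_⟩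
      rcases hσ : (σ.code q).exec b (Sum.elim (plugOuter ⟨(.up, q, r), mem'⟩).mem
        (Side.tapes (T .up) (plugLink ⟨(.up, q, r), mem'⟩))) with ⟨q₁, C₁, _ | p | _⟩
      · rw [plug_exec_outer_run hσ] at he
        cases he
        have h₃ := At.step h₁ hσ
        rw [extend_plugOuterTape]
        rw [← tapes_comp_inr] at h₃
        exact ⟨h₃, h₂.idle _⟩
      · have hc := plug_code_up (π := π) q r
        rw [Instr.lift_of_exec_send hσ] at hc
        have h₃ := At.halt h₁ hσ rfl
        cases p with
        | up =>
          simp only [hc, Instr.exec] at he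
          cases he
          exact ⟨h₃ _, h₂.idle _⟩
        | down =>
          -- A handover is a single step: it is charged to `σ`, which sends, while activating `π` is
          -- free.
          rcases hr : π.recv (some .up) r with _ | r₁
          · simp only [hc, hr, Instr.exec] at he
            cases he
            exact ⟨h₃ _, h₂.idle _⟩
          · simp only [hc, hr, Instr.exec] at he
            cases he
            exact ⟨h₃ _, h₂.activate hr _⟩
      · have hc := plug_code_up (π := π) q r
        rw [Instr.lift_of_exec_done hσ] at hc
        simp only [hc, Instr.exec] at he
        cases he
        exact ⟨h₁.halt hσ rfl _, h₂.idle _⟩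
    | down =>
      refine ⟨t₁, t₂ + 1, by omega, ?_⟩
      rcases hπ : (π.code r).exec b (Sum.elim (plugInner ⟨(.down, q, r), mem'⟩).mem
        (Side.tapes (plugLink ⟨(.down, q, r), mem'⟩) (T .down))) with ⟨q₁, C₁, _ | p | _⟩
      · rw [plug_exec_inner_run hπ] at he
        cases he
        have h₃ := At.step h₂ hπ
        rw [extend_plugInnerTape]
        rw [← tapes_comp_inr] at h₃
        exact ⟨h₁.idle _, h₃⟩
      · have hc := plug_code_down (σ := σ) q r
        rw [Instr.lift_of_exec_send hπ] at hc
        have h₃ := At.halt h₂ hπ rfl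
        cases p with
        | down =>
          simp only [hc, Instr.exec] at he
          cases he
          exact ⟨h₁.idle _, h₃ _⟩
        | up =>
          rcases hr : σ.recv (some .down) q with _ | r₁
          · simp only [hc, hr, Instr.exec] at he
            cases he
            exact ⟨h₁.idle _, h₃ _⟩
          · simp only [hc, hr, Instr.exec] at he
            cases he
            exact ⟨h₁.activate hr _, h₃ _⟩
      · have hc := plug_code_down (σ := σ) q r
        rw [Instr.lift_of_exec_done hπ] at hc
        simp only [hc, Instr.exec] at he
        cases he
        exact ⟨h₁.idle _, h₂.halt hπ rfl _⟩

/-- There is no overhead: each step of the composed machine is a step of exactly one part. -/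
theorem IsPPT.plug (hσ : σ.IsPPT) (hπ : π.IsPPT) : (σ.plug π).IsPPT := by
  obtain ⟨p, hp⟩ := hσ.exists_bound
  obtain ⟨p', hp'⟩ := hπ.exists_bound
  refine ⟨p + p', fun κ t a l T h => ?_⟩
  obtain ⟨t₁, t₂, rfl, h₁, h₂⟩ := plug_at h
  rw [Polynomial.eval_add]
  exact add_le_add (hp _ _ _ _ _ h₁) (hp' _ _ _ _ _ h₂)

end Plug
end ITM

end PseudoNash

namespace PseudoNash

/-! ## The distinguisher of a game

A tester simulates the rules of a game and the strategies of the players that it absorbs; then it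
runs a machine without ports (the judge) on the outcome. The other players, and the machines of the
protocol for the absorbed ones, are linked to its ports. -/

structure Tester (n : ℕ) where
  rules : ITM (Fin n)
  absorbs : Fin n → Bool
  strat : Fin n → ITM Side
  judge : ITM Empty
  /-- the tape of the judge that contains the outcome of the game -/
  right : judge.K
  judgeStart : judge.Q

namespace Tester

variable {n : ℕ} (E : Tester n)

/-- The component of a tester that is running. -/
inductive Ctl : Type
  | rules
  | strat (j : Fin n)
  | judge (m : E.judge.Q)

/-- The private tapes of a tester. -/
inductive K : Type
  | rules (k : E.rules.K)
  | strat (j : Fin n) (k : (E.strat j).K)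
  | link (j : Fin n)
  | judge (k : E.judge.K) (h : k ≠ E.right)

instance : Finite E.Ctl :=
  Finite.of_injective (β := Option (Fin n ⊕ E.judge.Q))
    (fun | .rules => none | .strat j => some (.inl j) | .judge m => some (.inr m))
    (by rintro (_ | _ | _) (_ | _ | _) h <;> cases h <;> rfl)

instance : Finite E.K :=
  Finite.of_injective (β := (E.rules.K ⊕ Σ j, (E.strat j).K) ⊕ Fin n ⊕ E.judge.K)
    (fun
      | .rules k => .inl (.inl k)
      | .strat j k => .inl (.inr ⟨j, k⟩)
      | .link j => .inr (.inl j)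
      | .judge k _ => .inr (.inr k))
    (by rintro (_ | _ | _ | _) (_ | _ | _ | _) h <;> cases h <;> rfl)

noncomputable instance : DecidableEq E.K := Classical.decEq _

/-- States of a tester. -/
abbrev Q : Type := E.Ctl × E.rules.Q × ∀ j, (E.strat j).Q

/-- The tapes of the rules. -/
def rulesTape : E.rules.K ⊕ Fin n → E.K ⊕ Fin n
  | .inl k => .inl (.rules k)
  | .inr j => if E.absorbs j then .inl (.link j) else .inr j

/-- The tapes of an absorbed strategy. -/
def stratTape (j : Fin n) : (E.strat j).K ⊕ Side → E.K ⊕ Fin n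
  | .inl k => .inl (.strat j k)
  | .inr .up => .inl (.link j)
  | .inr .down => .inr j

/-- The private tapes of the judge. -/
def judgeK (k : E.judge.K) : E.K :=
  -- The output tape of the rules doubles as the second input tape of the judge. No outcome has to
  -- be copied, so the simulation needs no extra steps.
  if h : k = E.right then .rules E.rules.out else .judge k h

/-- The tapes of the judge. -/
def judgeTape : E.judge.K ⊕ Empty → E.K ⊕ Fin n
  | .inl k => .inl (E.judgeK k)
  | .inr e => e.elim

/-- Default activation of the rules; the judge starts if they ignore it. -/
def wake (q : E.rules.Q) (r : ∀ j, (E.strat j).Q) : E.Q :=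
  match E.rules.recv none q with
  | some q' => (.rules, q', r)
  | none => (.judge E.judgeStart, q, r)

/-- The tester as a machine. -/
noncomputable abbrev machine : ITM (Fin n) where
  Q := E.Q
  K := E.K
  finQ := inferInstance
  finK := inferInstance
  decK := inferInstance
  start := (.rules, E.rules.start, fun j => (E.strat j).start)
  input := fun
    | .rules k => E.rules.input k
    | .strat j k => (E.strat j).input k
    | .link _ => false
    | .judge k _ => E.judge.input k
  out := E.judgeK E.judge.out
  code := fun
    | (.rules, q, r) => (E.rules.code q).lift E.rulesTape (fun q' => (.rules, q', r))
        (fun j q' =>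
          if E.absorbs j then
            match (E.strat j).recv (some .up) (r j) with
            | some s => .goto (.strat j, q', Function.update r j s)
            | none => .goto (E.wake q' r)
          else .send j (.rules, q', r))
        (fun q' => .goto (.judge E.judgeStart, q', r))
    | (.strat j, q, r) => ((E.strat j).code (r j)).lift (E.stratTape j)
        (fun s => (.strat j, q, Function.update r j s))
        (fun
          | .up, s =>
            match E.rules.recv (some j) q with
            | some q' => .goto (.rules, q', Function.update r j s)
            | none => .goto (E.wake q (Function.update r j s))
          -- The control is reset to `.rules` before leaving. This is the normal form of a waiting
          -- tester; `recv` decides by the port alone which component wakes up.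
          | .down, s => .send j (.rules, q, Function.update r j s))
        (fun s => .goto (E.wake q (Function.update r j s)))
    | (.judge m, q, r) => (E.judge.code m).lift E.judgeTape (fun m' => (.judge m', q, r))
        (fun e => e.elim) (fun m' => .done (.judge m', q, r))
  recv := fun
    | _, (.judge _, _, _) => none
    | none, (_, q, r) => some (E.wake q r)
    | some j, (_, q, r) =>
      if E.absorbs j then
        ((E.strat j).recv (some .down) (r j)).map fun s => (.strat j, q, Function.update r j s)
      else (E.rules.recv (some j) q).map fun q' => (.rules, q', r)

/-! ### Tapes and instructions of the simulated machines inside the tester. -/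

variable {E}

theorem rulesTape_injective : E.rulesTape.Injective := by
  rintro (k | j) (k' | j') h <;> simp only [rulesTape] at h <;> (try split_ifs at h) <;>
    cases h <;> rfl

theorem stratTape_injective (j : Fin n) : (E.stratTape j).Injective := by
  rintro (k | _ | _) (k' | _ | _) h <;> cases h <;> rfl

theorem judgeK_injective : E.judgeK.Injective := by
  intro k k' h
  unfold judgeK at h
  split_ifs at h with h₁ h₂ h₂
  · rw [h₁, h₂]
  · cases h; rfl

theorem judgeTape_injective : E.judgeTape.Injective := by
  rintro (k | ⟨⟨⟩⟩) (k' | ⟨⟨⟩⟩) h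
  rw [judgeK_injective (Sum.inl_injective h)]

section Views

variable (mem : E.K → List Bool) (T : Fin n → List Bool)

/-- The communication tapes of the rules. -/
def rulesComm (j : Fin n) : List Bool := if E.absorbs j then mem (.link j) else T j

theorem elim_comp_rulesTape :
    Sum.elim mem T ∘ E.rulesTape = Sum.elim (fun k => mem (.rules k)) (rulesComm mem T) := by
  funext x
  rcases x with k | j
  · rfl
  · simp only [Function.comp_apply, rulesTape, rulesComm, Sum.elim_inr]
    split_ifs <;> rfl

theorem elim_comp_stratTape (j : Fin n) : Sum.elim mem T ∘ E.stratTape j =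
    Sum.elim (fun k => mem (.strat j k)) (Side.tapes (mem (.link j)) (T j)) := by
  funext x; rcases x with k | _ | _ <;> rfl

theorem elim_comp_judgeTape :
    Sum.elim mem T ∘ E.judgeTape = Sum.elim (fun k => mem (E.judgeK k)) Empty.elim := by
  funext x; rcases x with k | ⟨⟨⟩⟩; rfl

end Views

section Extend

variable (D : E.K ⊕ Fin n → List Bool)

theorem extend_rulesTape (C : E.rules.K ⊕ Fin n → List Bool) :
    Function.extend E.rulesTape C D = fun
      | .inl (.rules k) => C (.inl k)
      | .inl (.link j) => if E.absorbs j then C (.inr j) else D (.inl (.link j))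
      | .inr j => if E.absorbs j then D (.inr j) else C (.inr j)
      | x => D x := by
  have h := rulesTape_injective.extend_apply C D
  funext x
  rcases x with (k | ⟨j, k⟩ | j | ⟨k, hk⟩) | j
  · exact h (.inl k)
  · refine Function.extend_apply' _ _ _ ?_
    rintro ⟨_ | _, h⟩ <;> simp only [rulesTape] at h <;> (try split_ifs at h) <;> cases h
  · by_cases hj : E.absorbs j
    · have := h (.inr j)
      simp only [rulesTape, hj, if_true] at this
      simp only [hj, if_true, this]
    · simp only [hj]
      refine Function.extend_apply' _ _ _ ?_
      rintro ⟨_ | _, h⟩ <;> simp only [rulesTape] at h <;> (try split_ifs at h) <;> cases h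
      contradiction
  · refine Function.extend_apply' _ _ _ ?_
    rintro ⟨_ | _, h⟩ <;> simp only [rulesTape] at h <;> (try split_ifs at h) <;> cases h
  · by_cases hj : E.absorbs j
    · simp only [hj, if_true]
      refine Function.extend_apply' _ _ _ ?_
      rintro ⟨_ | _, h⟩ <;> simp only [rulesTape] at h <;> (try split_ifs at h) <;> cases h
      contradiction
    · have := h (.inr j)
      simp only [rulesTape, hj] at this
      simp only [hj]
      exact this

variable {j : Fin n} (C : (E.strat j).K ⊕ Side → List Bool)

theorem extend_stratTape_rules (k : E.rules.K) :
    Function.extend (E.stratTape j) C D (.inl (.rules k)) = D (.inl (.rules k)) :=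
  Function.extend_apply' _ _ _ (by rintro ⟨_ | _ | _, h⟩ <;> cases h)

theorem extend_stratTape_judge (k : E.judge.K) (hk : k ≠ E.right) :
    Function.extend (E.stratTape j) C D (.inl (.judge k hk)) = D (.inl (.judge k hk)) :=
  Function.extend_apply' _ _ _ (by rintro ⟨_ | _ | _, h⟩ <;> cases h)

theorem extend_stratTape_strat (k : (E.strat j).K) :
    Function.extend (E.stratTape j) C D (.inl (.strat j k)) = C (.inl k) :=
  (stratTape_injective j).extend_apply C D (.inl k)

theorem extend_stratTape_strat_of_ne {i : Fin n} (h : i ≠ j) (k : (E.strat i).K) :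
    Function.extend (E.stratTape j) C D (.inl (.strat i k)) = D (.inl (.strat i k)) :=
  Function.extend_apply' _ _ _ (by rintro ⟨_ | _ | _, h⟩ <;> cases h; contradiction)

theorem extend_stratTape_link :
    Function.extend (E.stratTape j) C D (.inl (.link j)) = C (.inr .up) :=
  (stratTape_injective j).extend_apply C D (.inr .up)

theorem extend_stratTape_link_of_ne {i : Fin n} (h : i ≠ j) :
    Function.extend (E.stratTape j) C D (.inl (.link i)) = D (.inl (.link i)) :=
  Function.extend_apply' _ _ _ (by rintro ⟨_ | _ | _, h⟩ <;> cases h; contradiction)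

theorem extend_stratTape_port :
    Function.extend (E.stratTape j) C D (.inr j) = C (.inr .down) :=
  (stratTape_injective j).extend_apply C D (.inr .down)

theorem extend_stratTape_port_of_ne {i : Fin n} (h : i ≠ j) :
    Function.extend (E.stratTape j) C D (.inr i) = D (.inr i) :=
  Function.extend_apply' _ _ _ (by rintro ⟨_ | _ | _, h⟩ <;> cases h; contradiction)

theorem extend_judgeTape (C : E.judge.K ⊕ Empty → List Bool) (k : E.judge.K) :
    Function.extend E.judgeTape C D (.inl (E.judgeK k)) = C (.inl k) :=
  judgeTape_injective.extend_apply C D (.inl k)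

end Extend

section Code

variable {q : E.rules.Q} {r : ∀ j, (E.strat j).Q} {m : E.judge.Q} {mem : E.machine.K → List Bool}
  {T : Fin n → List Bool} {b : Bool}

theorem exec_rules_run {q' : E.rules.Q} {C : E.rules.K ⊕ Fin n → List Bool}
    (h : (E.rules.code q).exec b (Sum.elim (fun k => mem (K.rules k)) (rulesComm mem T)) =
      (q', C, .run)) :
    (E.machine.code (.rules, q, r)).exec b (Sum.elim mem T) =
      ((.rules, q', r), Function.extend E.rulesTape C (Sum.elim mem T), .run) :=
  Instr.exec_lift_run rulesTape_injective (elim_comp_rulesTape mem T) h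

theorem code_rules_send {q' : E.rules.Q} {C C' : E.rules.K ⊕ Fin n → List Bool} {j : Fin n}
    (h : (E.rules.code q).exec b C = (q', C', .send j)) :
    E.machine.code (.rules, q, r) =
      if E.absorbs j then
        match (E.strat j).recv (some .up) (r j) with
        | some s => .goto (.strat j, q', Function.update r j s)
        | none => .goto (E.wake q' r)
      else .send j (.rules, q', r) :=
  Instr.lift_of_exec_send h

theorem code_rules_done {q' : E.rules.Q} {C C' : E.rules.K ⊕ Fin n → List Bool}
    (h : (E.rules.code q).exec b C = (q', C', .done)) :
    E.machine.code (.rules, q, r) = .goto (.judge E.judgeStart, q', r) :=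
  Instr.lift_of_exec_done h

variable {j : Fin n} {s : (E.strat j).Q} {C C' : (E.strat j).K ⊕ Side → List Bool}

theorem exec_strat_run
    (h : ((E.strat j).code (r j)).exec b (Sum.elim (fun k => mem (K.strat j k))
      (Side.tapes (mem (K.link j)) (T j))) = (s, C, .run)) :
    (E.machine.code (.strat j, q, r)).exec b (Sum.elim mem T) =
      ((.strat j, q, Function.update r j s), Function.extend (E.stratTape j) C (Sum.elim mem T),
        .run) :=
  Instr.exec_lift_run (stratTape_injective j) (elim_comp_stratTape mem T j) h

theorem code_strat_send_up (h : ((E.strat j).code (r j)).exec b C = (s, C', .send .up)) :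
    E.machine.code (.strat j, q, r) =
      match E.rules.recv (some j) q with
      | some q' => .goto (.rules, q', Function.update r j s)
      | none => .goto (E.wake q (Function.update r j s)) :=
  Instr.lift_of_exec_send h

theorem code_strat_send_down (h : ((E.strat j).code (r j)).exec b C = (s, C', .send .down)) :
    E.machine.code (.strat j, q, r) = .send j (.rules, q, Function.update r j s) :=
  Instr.lift_of_exec_send h

theorem code_strat_done (h : ((E.strat j).code (r j)).exec b C = (s, C', .done)) :
    E.machine.code (.strat j, q, r) = .goto (E.wake q (Function.update r j s)) :=
  Instr.lift_of_exec_done h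

theorem exec_judge_run {m' : E.judge.Q} {C : E.judge.K ⊕ Empty → List Bool}
    (h : (E.judge.code m).exec b (Sum.elim (fun k => mem (E.judgeK k)) Empty.elim) =
      (m', C, .run)) :
    (E.machine.code (.judge m, q, r)).exec b (Sum.elim mem T) =
      ((.judge m', q, r), Function.extend E.judgeTape C (Sum.elim mem T), .run) :=
  Instr.exec_lift_run judgeTape_injective (elim_comp_judgeTape mem T) h

theorem code_judge_done {m' : E.judge.Q} {C C' : E.judge.K ⊕ Empty → List Bool}
    (h : (E.judge.code m).exec b C = (m', C', .done)) :
    E.machine.code (.judge m, q, r) = .done (.judge m', q, r) :=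
  Instr.lift_of_exec_done h

end Code

/-! ### Running time of a tester -/

/-- The tapes of the judge at its start. -/
def judgeMem (mem : E.K → List Bool) (w : List Bool) (k : E.judge.K) : List Bool :=
  if h : k = E.right then w else mem (.judge k h)

theorem mem_judgeK (mem : E.K → List Bool) :
    (fun k => mem (E.judgeK k)) = judgeMem mem (mem (.rules E.rules.out)) := by
  funext k
  unfold judgeK judgeMem
  split_ifs <;> rfl

/-- The decomposition of a trace of a tester: what the components have done after `t` steps. -/
inductive Inv (mem₀ : E.K → List Bool) :
    ℕ → Bool → E.machine.Local → (Fin n → List Bool) → Prop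
  | sim {t₀ : ℕ} {t : Fin n → ℕ} {c : E.Ctl} {a : Bool} {q : E.rules.Q} {r : ∀ j, (E.strat j).Q}
      {mem : E.K → List Bool} {T : Fin n → List Bool} {b₀ : Bool} {b : Fin n → Bool}
      (hc : match c with
        | .rules => b₀ = a ∧ ∀ j, b j = false
        | .strat j => a = true ∧ b₀ = false ∧ ∀ i, b i = decide (i = j)
        | .judge _ => False)
      (rules : E.rules.At (fun k => mem₀ (.rules k)) t₀ b₀ ⟨q, fun k => mem (.rules k)⟩
        (rulesComm mem T))
      (strat : ∀ j, (E.strat j).At (fun k => mem₀ (.strat j k)) (t j) (b j)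
        ⟨r j, fun k => mem (.strat j k)⟩ (Side.tapes (mem (.link j)) (T j)))
      (judge : ∀ k hk, mem (.judge k hk) = mem₀ (.judge k hk)) :
      Inv mem₀ (t₀ + ∑ j, t j) a ⟨(c, q, r), mem⟩ T
  | judge {t₀ t' : ℕ} {t : Fin n → ℕ} {a : Bool} {m : E.judge.Q} {q : E.rules.Q}
      {r : ∀ j, (E.strat j).Q} {mem : E.K → List Bool} {T : Fin n → List Bool} {w : List Bool}
      (rules : ∃ a l T, E.rules.At (fun k => mem₀ (.rules k)) t₀ a l T)
      (strat : ∀ j, ∃ a l T, (E.strat j).At (fun k => mem₀ (.strat j k)) (t j) a l T)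
      -- The time of the judge is measured in the length of its input, so the length of the outcome
      -- has to be controlled by the time of the rules.
      (hw : w.length ≤ (mem₀ (.rules E.rules.out)).length + t₀)
      (judge : E.judge.At (judgeMem mem₀ w) t' a ⟨m, fun k => mem (E.judgeK k)⟩ Empty.elim) :
      Inv mem₀ (t₀ + ∑ j, t j + t') a ⟨(.judge m, q, r), mem⟩ T

/-- All simulated machines are idle after `t` steps. -/
def Idle (mem₀ : E.K → List Bool) (t : ℕ) (q : E.rules.Q) (r : ∀ j, (E.strat j).Q)
    (mem : E.K → List Bool) : Prop :=
  ∃ (t₀ : ℕ) (t' : Fin n → ℕ), t = t₀ + ∑ j, t' j ∧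
    E.rules.At (fun k => mem₀ (.rules k)) t₀ false ⟨q, fun k => mem (.rules k)⟩ (fun _ => []) ∧
    (∀ j, (E.strat j).At (fun k => mem₀ (.strat j k)) (t' j) false
      ⟨r j, fun k => mem (.strat j k)⟩ (fun _ => [])) ∧
    ∀ k hk, mem (.judge k hk) = mem₀ (.judge k hk)

variable {mem₀ mem : E.K → List Bool} {t : ℕ} {q : E.rules.Q} {r : ∀ j, (E.strat j).Q}

theorem Inv.of_idle (h : Idle mem₀ t q r mem) (T : Fin n → List Bool) :
    Inv mem₀ t false ⟨(.rules, q, r), mem⟩ T := by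
  obtain ⟨t₀, t', rfl, h₁, h₂, h₃⟩ := h
  exact .sim (b := fun _ => false) ⟨rfl, fun _ => rfl⟩ (h₁.idle _) (fun j => (h₂ j).idle _) h₃

theorem Inv.idle {T : Fin n → List Bool} (h : Inv mem₀ t false ⟨(.rules, q, r), mem⟩ T) :
    Idle mem₀ t q r mem := by
  cases h with
  | sim hc rules strat judge =>
    obtain ⟨rfl, hb⟩ := hc
    refine ⟨_, _, rfl, rules.idle _, fun j => ?_, judge⟩
    have := strat j
    rw [hb j] at this
    exact this.idle _

namespace Idle

variable (T : Fin n → List Bool)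

theorem rules (h : Idle mem₀ t q r mem) {p : Option (Fin n)} {q' : E.rules.Q}
    (hr : E.rules.recv p q = some q') :
    Inv mem₀ t true ⟨(.rules, q', r), mem⟩ T := by
  obtain ⟨t₀, t', rfl, h₁, h₂, h₃⟩ := h
  exact .sim (b := fun _ => false) ⟨rfl, fun _ => rfl⟩ (h₁.activate hr _)
    (fun j => (h₂ j).idle _) h₃

theorem strat (h : Idle mem₀ t q r mem) {p : Option Side} {j : Fin n} {s : (E.strat j).Q}
    (hr : (E.strat j).recv p (r j) = some s) :
    Inv mem₀ t true ⟨(.strat j, q, Function.update r j s), mem⟩ T := by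
  obtain ⟨t₀, t', rfl, h₁, h₂, h₃⟩ := h
  refine .sim (b := fun i => decide (i = j)) ⟨rfl, rfl, fun _ => rfl⟩ (h₁.idle _) (fun i => ?_) h₃
  by_cases hi : i = j
  · subst hi
    simpa using (h₂ i).activate hr _
  · simpa [hi] using (h₂ i).idle _

theorem judge (h : Idle mem₀ t q r mem)
    (hJ : E.judge.recv none E.judge.start = some E.judgeStart) :
    Inv mem₀ t true ⟨(.judge E.judgeStart, q, r), mem⟩ T := by
  obtain ⟨t₀, t', rfl, h₁, h₂, h₃⟩ := h
  refine .judge (t' := 0) (w := mem (.rules E.rules.out)) ⟨_, _, _, h₁⟩ (fun j => ⟨_, _, _, h₂ j⟩)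
    (h₁.length_le E.rules.out) ?_
  rw [mem_judgeK]
  have e : judgeMem mem (mem (.rules E.rules.out)) = judgeMem mem₀ (mem (.rules E.rules.out)) := by
    funext k
    unfold judgeMem
    split_ifs
    exacts [rfl, h₃ _ _]
  rw [e]
  exact (ITM.At.init Empty.elim).activate hJ _

theorem wake (h : Idle mem₀ t q r mem)
    (hJ : E.judge.recv none E.judge.start = some E.judgeStart) :
    Inv mem₀ t true ⟨E.wake q r, mem⟩ T := by
  unfold Tester.wake
  split
  · next h' => exact h.rules T h'
  · exact h.judge T hJ

end Idle

/-- Each step of the tester is one step of exactly one component, and a handover is part of the step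
that ends an activation. The total time is therefore the sum of the times of the components. -/
theorem inv_of_trace (hJ : E.judge.recv none E.judge.start = some E.judgeStart) {t : ℕ} {a : Bool}
    {l : E.machine.Local} {T : Fin n → List Bool} (h : E.machine.Trace mem₀ t a l T) :
    Inv mem₀ t a l T := by
  refine ITM.Trace.induction_on_coins (motive := Inv mem₀) (fun T => ?_) ?_ ?_ h
  · exact .of_idle ⟨0, fun _ => 0, by simp, .init _, fun _ => .init _, fun _ _ => rfl⟩ T
  · rintro t l T T' p ⟨c', q', r'⟩ ih hr
    cases ih with
    -- Once the judge has started, the tester ignores all activations.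
    | judge => cases p <;> cases hr
    | @sim t₀ t c _ q r mem _ b₀ b hc rules strat judge =>
      cases c with
      | strat => cases hc.1
      | judge => exact hc.elim
      | rules =>
        have hi := (Inv.sim (E := E) (c := .rules) hc rules strat judge).idle
        cases p with
        | none =>
          have e : E.wake q r = (c', q', r') := Option.some.inj hr
          exact e ▸ hi.wake T' hJ
        | some j =>
          by_cases hj : E.absorbs j
          · simp only [machine, hj, if_true] at hr
            obtain ⟨s, hs, e⟩ := Option.map_eq_some_iff.1 hr
            cases e
            exact hi.strat _ hs
          · simp only [machine, hj] at hr
            obtain ⟨s, hs, e⟩ := Option.map_eq_some_iff.1 hr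
            cases e
            exact hi.rules _ hs
  · rintro t ⟨c, q, r⟩ x mem T C sig b he ih
    cases ih with
    | @judge t₀ t' t _ m _ _ _ _ w rules strat hw judge =>
      rcases hm : (E.judge.code m).exec b (Sum.elim (fun k => mem (E.judgeK k)) Empty.elim)
        with ⟨m', C', _ | ⟨⟨⟩⟩ | _⟩
      · rw [exec_judge_run hm] at he
        cases he
        have hs := judge.step hm
        refine .judge (t' := t' + 1) rules strat hw ?_
        rw [show C' ∘ Sum.inr = Empty.elim from funext fun e => e.elim] at hs
        convert hs using 2
        · rfl
        · funext k
          exact extend_judgeTape _ C' k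
      · rw [code_judge_done hm] at he
        cases he
        exact .judge (t' := t' + 1) rules strat hw (judge.halt hm rfl _)
    | @sim t₀ t c a _ _ _ _ b₀ b' hc rules strat judge =>
      cases c with
      | judge => exact hc.elim
      | rules =>
        obtain ⟨rfl, hb⟩ := hc
        obtain rfl : b' = fun _ => false := funext hb
        rcases hm : (E.rules.code q).exec b (Sum.elim (fun k => mem (.rules k)) (rulesComm mem T))
          with ⟨q', C', _ | j | _⟩
        · rw [exec_rules_run hm, extend_rulesTape] at he
          cases he
          have hs := rules.step hm
          rw [Nat.add_right_comm]
          refine .sim (b := fun _ => false) ⟨rfl, fun _ => rfl⟩ ?_ (fun j => (strat j).idle _) judge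
          convert hs using 1
          · rfl
          · funext j
            by_cases hj : E.absorbs j <;> simp [rulesComm, hj]
        -- When the rules end their activation, every component is idle; the lemmas on `Idle` treat
        -- whichever component wakes up next.
        · have hi : Idle mem₀ (t₀ + ∑ j, t j + 1) q' r mem :=
            ⟨t₀ + 1, t, by omega, rules.halt hm rfl _, fun j => (strat j).idle _, judge⟩
          rw [code_rules_send hm] at he
          by_cases hj : E.absorbs j
          · rcases hr : (E.strat j).recv (some .up) (r j) with _ | s
            · simp only [hj, hr, if_true, Instr.exec] at he
              cases he
              exact hi.wake _ hJ
            · simp only [hj, hr, if_true, Instr.exec] at he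
              cases he
              exact hi.strat _ hr
          · simp only [hj, Instr.exec] at he
            cases he
            exact .of_idle hi _
        · have hi : Idle mem₀ (t₀ + ∑ j, t j + 1) q' r mem :=
            ⟨t₀ + 1, t, by omega, rules.halt hm rfl _, fun j => (strat j).idle _, judge⟩
          rw [code_rules_done hm] at he
          cases he
          exact hi.judge _ hJ
      | strat j =>
        obtain ⟨-, rfl, hb⟩ := hc
        have hsj := strat j
        rw [hb j, decide_eq_true rfl] at hsj
        have hidle : ∀ i ≠ j, ∀ T', (E.strat i).At (fun k => mem₀ (.strat i k)) (t i) false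
            ⟨r i, fun k => mem (.strat i k)⟩ T' := fun i hi T' => by
          have := strat i
          rw [hb i, decide_eq_false hi] at this
          exact this.idle _
        -- Only the clock of strategy `j` advances, so the sum of all clocks grows by one.
        have hsum : t₀ + ∑ i, t i + 1 = t₀ + ∑ i, Function.update t j (t j + 1) i := by
          rw [Finset.sum_update_of_mem (Finset.mem_univ j),
            ← Finset.add_sum_erase _ _ (Finset.mem_univ j), Finset.sdiff_singleton_eq_erase]
          omega
        have hdone : ∀ s, (∀ T', (E.strat j).At (fun k => mem₀ (.strat j k)) (t j + 1) false
            ⟨s, fun k => mem (.strat j k)⟩ T') →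
            Idle mem₀ (t₀ + ∑ i, t i + 1) q (Function.update r j s) mem := fun s hs => by
          refine ⟨t₀, Function.update t j (t j + 1), hsum, rules.idle _, fun i => ?_, judge⟩
          by_cases hi : i = j
          · subst hi; simpa using hs _
          · simpa [hi] using hidle i hi _
        rcases hm : ((E.strat j).code (r j)).exec b
          (Sum.elim (fun k => mem (.strat j k)) (Side.tapes (mem (.link j)) (T j)))
          with ⟨s, C', _ | d | _⟩
        · rw [exec_strat_run hm] at he
          cases he
          have hs := hsj.step hm
          rw [← ITM.tapes_comp_inr] at hs
          rw [hsum]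
          refine .sim (b := fun i => decide (i = j)) ⟨rfl, rfl, fun _ => rfl⟩ ?_ (fun i => ?_)
            fun k hk => ?_
          · simp only [Function.comp_apply, extend_stratTape_rules]
            exact rules.idle _
          · by_cases hi : i = j
            · subst hi
              simp only [Function.comp_apply, Function.update_self, decide_true,
                extend_stratTape_strat, extend_stratTape_link, extend_stratTape_port]
              exact hs
            · simpa only [Function.comp_apply, Function.update_of_ne hi, hi, decide_false,
                extend_stratTape_strat_of_ne _ _ hi, Sum.elim_inl] using hidle i hi _
          · simp only [Function.comp_apply, extend_stratTape_judge]
            exact judge k hk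
        · have hi := hdone s (hsj.halt hm rfl)
          cases d with
          | up =>
            rw [code_strat_send_up hm] at he
            rcases hr : E.rules.recv (some j) q with _ | q'
            · simp only [hr, Instr.exec] at he
              cases he
              exact hi.wake _ hJ
            · simp only [hr, Instr.exec] at he
              cases he
              exact hi.rules _ hr
          | down =>
            rw [code_strat_send_down hm] at he
            simp only [Instr.exec] at he
            cases he
            exact .of_idle hi _
        · have hi := hdone s (hsj.halt hm rfl)
          rw [code_strat_done hm] at he
          cases he
          exact hi.wake _ hJ

theorem _root_.Polynomial.eval_mono_nat (p : Polynomial ℕ) {a b : ℕ} (h : a ≤ b) :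
    p.eval a ≤ p.eval b := by
  simp only [Polynomial.eval_eq_sum_range]
  gcongr

/-- Brings the tapes on which the judge starts into the form in which `PolyTimeDecidable` makes its
promises. -/
theorem judgeMem_update_initMem {left : E.judge.K} (hl : left ≠ E.right) (κ : ℕ)
    (x w : List Bool) :
    judgeMem (Function.update (E.machine.initMem κ) (.judge left hl) x) w =
      Function.update (Function.update (E.judge.initMem κ) left x) E.right w := by
  funext k
  unfold judgeMem
  by_cases hk : k = E.right
  · subst hk; simp
  · rw [dif_neg hk, Function.update_of_ne hk]
    by_cases hk' : k = left
    · subst hk'; simp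
    · rw [Function.update_of_ne hk', Function.update_of_ne]
      · rfl
      · rintro ⟨⟩
        exact hk' rfl

variable (E) in
/-- The judge runs in polynomial time on its two tapes `left` and `right`. -/
def JudgePPT (left : E.judge.K) : Prop :=
  ∃ p : Polynomial ℕ, ∀ κ x y t a l T,
    E.judge.Trace (Function.update (Function.update (E.judge.initMem κ) left x) E.right y) t a l T →
      t ≤ p.eval (κ + x.length + y.length)

/-- This qualifies the tester, with advice on the tape `left` of the judge, as a distinguisher. -/
theorem exists_bound (hJ : E.judge.recv none E.judge.start = some E.judgeStart)
    (hrules : E.rules.IsPPT) (hstrat : ∀ j, (E.strat j).IsPPT) {left : E.judge.K}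
    (hl : left ≠ E.right) (hjudge : E.JudgePPT left)
    {adv : ℕ → List Bool} (hadv : ∃ p : Polynomial ℕ, ∀ κ, (adv κ).length ≤ p.eval κ) :
    ∃ p : Polynomial ℕ, ∀ κ, (adv κ).length ≤ p.eval κ ∧
      ∀ t a l T, E.machine.Trace
        (Function.update (E.machine.initMem κ) (.judge left hl) (adv κ)) t a l T →
          t ≤ p.eval κ := by
  obtain ⟨pa, hpa⟩ := hadv
  obtain ⟨pr, hpr⟩ := hrules.exists_bound
  obtain ⟨pj, hpj⟩ := hjudge
  choose ps hps using fun j => (hstrat j).exists_bound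
  -- The first `pa` covers the length of the advice. The argument of `pj` bounds the input of the
  -- judge: `1^κ`, the advice, and an outcome of length at most `κ + pr κ`, since the output tape
  -- may initially contain `1^κ`.
  refine ⟨pa + (pr + ∑ j, ps j + pj.comp (.X + pa + (.X + pr))), fun κ => ?_⟩
  simp only [Polynomial.eval_add, Polynomial.eval_comp, Polynomial.eval_X,
    Polynomial.eval_finsetSum]
  refine ⟨(hpa κ).trans (Nat.le_add_right _ _), fun t a l T h => le_add_left ?_⟩
  have memr : (fun k => Function.update (E.machine.initMem κ) (.judge left hl) (adv κ)
      (.rules k)) = E.rules.initMem κ := by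
    funext k
    rw [Function.update_of_ne (by rintro ⟨⟩)]
    rfl
  have mems : ∀ j, (fun k => Function.update (E.machine.initMem κ) (.judge left hl) (adv κ)
      (.strat j k)) = (E.strat j).initMem κ := by
    intro j
    funext k
    rw [Function.update_of_ne (by rintro ⟨⟩)]
    rfl
  cases inv_of_trace hJ h with
  | sim _ h₁ h₂ _ =>
    rw [memr] at h₁
    simp only [mems] at h₂
    exact le_add_right (add_le_add (hpr _ _ _ _ _ h₁)
      (Finset.sum_le_sum fun j _ => hps j _ _ _ _ _ (h₂ j)))
  | @judge _ _ _ _ _ _ _ _ _ w h₁ h₂ hw h₃ =>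
    rw [memr] at h₁
    simp only [mems] at h₂
    rw [congrFun memr] at hw
    rw [judgeMem_update_initMem] at h₃
    obtain ⟨_, _, _, h₁⟩ := h₁
    refine add_le_add (add_le_add (hpr _ _ _ _ _ h₁) (Finset.sum_le_sum fun j _ => ?_)) ?_
    · obtain ⟨_, _, _, h₂⟩ := h₂ j
      exact hps j _ _ _ _ _ h₂
    · obtain ⟨_, h₃, -⟩ := h₃
      refine (hpj _ _ _ _ _ _ _ h₃).trans (pj.eval_mono_nat ?_)
      have := hpr _ _ _ _ _ h₁
      have := E.rules.length_initMem_le κ E.rules.out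
      have := hpa κ
      omega

end Tester
end PseudoNash

/-! ### Networks driven by one coin per step. -/

namespace PseudoNash

namespace Party

/-- The result of one step with coin `b`. -/
def stepWith (b : Bool) : (p : Party) → p.State → (Side → List Bool) →
    p.State × (Side → List Bool) × Signal Side
  | dummy, s, T => (s, T, .done)
  | machine M, s, T => M.stepWith b s T

theorem step_eq_map (p : Party) (s : p.State) (T : Side → List Bool) :
    p.step s T = (PMF.uniformOfFintype Bool).map fun b => p.stepWith b s T := by
  cases p with
  | dummy => exact (PMF.map_const_uniform _).symm
  | machine M => exact M.step_eq_map s T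

end Party

namespace Net

variable {n : ℕ} {top : ITM (Fin n)} {parties : Fin n → Party} {bot : ITM (Fin n)}

/-- The configuration after one step with coin `b`. -/
def stepWith (b : Bool) (c : Net top parties bot) : Net top parties bot :=
  match c.active with
  | none => c
  | some .top => c.afterTop (top.stepWith b c.topS c.upT)
  | some (.party i) => c.afterParty i ((parties i).stepWith b (c.partyS i) (c.partyTapes i))
  | some .bot => c.afterBot (bot.stepWith b c.botS c.botTapes)

theorem step_eq_map (c : Net top parties bot) :
    c.step = (PMF.uniformOfFintype Bool).map fun b => c.stepWith b := by
  unfold step stepWith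
  rcases c.active with _ | _ | i | _
  · exact (PMF.map_const_uniform _).symm
  · simp only [ITM.step_eq_map, PMF.map_comp]; rfl
  · simp only [Party.step_eq_map, PMF.map_comp]; rfl
  · simp only [ITM.step_eq_map, PMF.map_comp]; rfl

theorem partyTapes_eq (c : Net top parties bot) (i : Fin n) :
    c.partyTapes i = Side.tapes (c.upT i) (c.downT i) := by
  funext s; cases s <;> rfl

end Net

/-! ## Splitting a player into an absorbed strategy and the party below it -/

/-- The player that follows `σ` above the party `P` if `a` is true, and the party `P` otherwise. -/
def Party.combine (σ : ITM Side) : Bool → Party → Party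
  | false, P => P
  | true, .dummy => .machine σ
  | true, .machine π => .machine (σ.plug π)

/-- A player, split into the strategy and the party below it, with the tape `link` above the
strategy, the tape `port` between them and the tape `below` the party. A player that is not split
has only the tapes `port` and `below`. -/
structure Split (σ : ITM Side) (P : Party) where
  outer : σ.Local
  link : List Bool
  inner : P.State
  port : List Bool
  below : List Bool

namespace Split

variable {σ : ITM Side}

/-- The split of a player with tapes `u` and `d`; `idle` is the configuration of an unused
strategy. -/
def ofPlayer (idle : σ.Local) :
    (a : Bool) → (P : Party) → (Party.combine σ a P).State → List Bool → List Bool → Split σ P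
  | false, _, s, u, d => ⟨idle, [], s, u, d⟩
  -- Below an absorbed strategy, a dummy contributes a single tape, which is the lower tape of the
  -- strategy; the second tape of a dummy is never used and stays empty.
  | true, .dummy, s, u, d => ⟨s, u, (), d, []⟩
  | true, .machine _, s, u, d =>
    ⟨ITM.plugOuter s, u, ITM.plugInner s, ITM.plugLink s, d⟩

/-- Whether the strategy is the part of the player that runs when the player is active. -/
def OuterRuns : (a : Bool) → (P : Party) → (Party.combine σ a P).State → Bool
  | false, _, _ => false
  | true, .dummy, _ => true
  | true, .machine _, s => decide (ITM.plugSide s = .up)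

variable {idle : σ.Local} {a : Bool} {P : Party} {s : (Party.combine σ a P).State}
  {u d : List Bool}

theorem isDummy_combine : (Party.combine σ a P).IsDummy = (!a && P.IsDummy) := by
  cases a <;> cases P <;> rfl

theorem recv_combine_machine_up {π : ITM Side} (x : Side) (q : σ.Q) (r : π.Q)
    (mem : (σ.plug π).K → List Bool) :
    (Party.combine σ true (.machine π)).recv .up ⟨(x, q, r), mem⟩ =
      (σ.recv (some .up) q).map fun q' => ⟨(.up, q', r), mem⟩ :=
  Option.map_map _ _ _

theorem recv_combine_machine_down {π : ITM Side} (x : Side) (q : σ.Q) (r : π.Q)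
    (mem : (σ.plug π).K → List Bool) :
    (Party.combine σ true (.machine π)).recv .down ⟨(x, q, r), mem⟩ =
      (π.recv (some .down) r).map fun r' => ⟨(.down, q, r'), mem⟩ :=
  Option.map_map _ _ _

/-- Activation of the strategy. -/
theorem recv_outer (ha : a = true) {D : Side} (hD : D = .up ∨ P.IsDummy = true) :
    match σ.recv (some D) (ofPlayer idle a P s u d).outer.state with
    | none => (Party.combine σ a P).recv D s = none
    | some q => ∃ s', (Party.combine σ a P).recv D s = some s' ∧ OuterRuns a P s' = true ∧
        ofPlayer idle a P s' u d = { ofPlayer idle a P s u d with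
          outer := ⟨q, (ofPlayer idle a P s u d).outer.mem⟩ } := by
  subst ha
  cases P with
  | dummy =>
    rcases h : σ.recv (some D) (ofPlayer idle true .dummy s u d).outer.state with _ | q
    · change Option.map _ (σ.recv (some D) (ofPlayer idle true .dummy s u d).outer.state) = none
      rw [h]; rfl
    · refine ⟨⟨q, (ofPlayer idle true .dummy s u d).outer.mem⟩, ?_, rfl, rfl⟩
      change Option.map _ (σ.recv (some D) (ofPlayer idle true .dummy s u d).outer.state) = _
      rw [h]; rfl
  | machine π =>
    obtain rfl : D = .up := by simpa [Party.IsDummy] using hD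
    obtain ⟨⟨x, q₀, r₀⟩, mem⟩ := s
    have hr := recv_combine_machine_up (σ := σ) (π := π) x q₀ r₀ mem
    rcases h : σ.recv (some .up) q₀ with _ | q
    · simp only [ofPlayer, ITM.plugOuter, h]
      rw [hr, h]; rfl
    · simp only [ofPlayer, ITM.plugOuter, h]
      exact ⟨⟨(.up, q, r₀), mem⟩, by rw [hr, h]; rfl, rfl, rfl⟩

/-- Activation of the party below the strategy. -/
theorem recv_inner {D : Side} (hD : a = false ∨ D = .down ∧ P.IsDummy = false) :
    match P.recv D (ofPlayer idle a P s u d).inner with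
    | none => (Party.combine σ a P).recv D s = none
    | some r => ∃ s', (Party.combine σ a P).recv D s = some s' ∧ OuterRuns a P s' = false ∧
        ofPlayer idle a P s' u d = { ofPlayer idle a P s u d with inner := r } := by
  cases a with
  | false =>
    rcases h : P.recv D s with _ | r
    · simp only [ofPlayer, h]; exact h
    · simp only [ofPlayer, h]; exact ⟨r, h, rfl, rfl⟩
  | true =>
    obtain ⟨rfl, hP⟩ : D = .down ∧ P.IsDummy = false := by simpa using hD
    cases P with
    | dummy => cases hP
    | machine π =>
      obtain ⟨⟨x, q₀, r₀⟩, mem⟩ := s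
      have hr := recv_combine_machine_down (σ := σ) (π := π) x q₀ r₀ mem
      have hP : (Party.machine π).recv .down (ofPlayer idle true (.machine π)
          ⟨(x, q₀, r₀), mem⟩ u d).inner =
          (π.recv (some .down) r₀).map fun r => ⟨r, fun k => mem (.inl (.inr k))⟩ := rfl
      rw [hP]
      rcases h : π.recv (some .down) r₀ with _ | r
      · change (Party.combine σ true (.machine π)).recv .down _ = none
        rw [hr, h]; rfl
      · exact ⟨⟨(.down, q₀, r), mem⟩, by rw [hr, h]; rfl, rfl, rfl⟩

/-- The effect of the bottom machine. -/
theorem ofPlayer_botTape :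
    (if P.IsDummy then (ofPlayer idle a P s u d).port else (ofPlayer idle a P s u d).below) =
      if (Party.combine σ a P).IsDummy then u else d := by
  cases a <;> cases P <;> rfl

theorem ofPlayer_afterBot (w : List Bool) :
    ofPlayer idle a P s (if (Party.combine σ a P).IsDummy then w else u)
        (if (Party.combine σ a P).IsDummy then d else w) =
      { ofPlayer idle a P s u d with
        port := if P.IsDummy then w else (ofPlayer idle a P s u d).port
        below := if P.IsDummy then (ofPlayer idle a P s u d).below else w } := by
  cases a <;> cases P <;> rfl

/-- The effect of the top machine. -/
theorem ofPlayer_topTape :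
    (if a then (ofPlayer idle a P s u d).link else (ofPlayer idle a P s u d).port) = u := by
  cases a <;> cases P <;> rfl

theorem ofPlayer_afterTop (w : List Bool) :
    ofPlayer idle a P s w d = { ofPlayer idle a P s u d with
      link := if a then w else (ofPlayer idle a P s u d).link
      port := if a then (ofPlayer idle a P s u d).port else w } := by
  cases a <;> cases P <;> rfl

/-- The step of the strategy `σ` in the split `v`. -/
def outerExec (b : Bool) (v : Split σ P) : σ.Q × (σ.K ⊕ Side → List Bool) × Signal Side :=
  (σ.code v.outer.state).exec b (Sum.elim v.outer.mem (Side.tapes v.link v.port))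

/-- The split after the strategy has changed its state only. -/
def setState (v : Split σ P) (q : σ.Q) : Split σ P := { v with outer := ⟨q, v.outer.mem⟩ }

/-- Inside the player and inside the split, the strategy sees the same tapes, so one execution of
its instruction describes both steps. -/
theorem step_outer_run (hs : OuterRuns a P s = true) {b : Bool} {q : σ.Q}
    {C : σ.K ⊕ Side → List Bool} (h : outerExec b (ofPlayer idle a P s u d) = (q, C, .run)) :
    ∃ s' T', (Party.combine σ a P).stepWith b s (Side.tapes u d) = (s', T', .run) ∧
      OuterRuns a P s' = true ∧
      ofPlayer idle a P s' (T' .up) (T' .down) = { ofPlayer idle a P s u d with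
        outer := ⟨q, C ∘ Sum.inl⟩
        link := C (.inr .up)
        port := C (.inr .down) } := by
  cases a with
  | false => cases hs
  | true =>
    cases P with
    | dummy => exact ⟨_, _, ITM.stepWith_of_exec _ h, rfl, rfl⟩
    | machine π =>
      obtain ⟨⟨x, q₀, r₀⟩, mem⟩ := s
      obtain rfl : x = .up := of_decide_eq_true hs
      have he := ITM.plug_exec_outer_run (π := π) (q := q₀) (r := r₀) (mem := mem)
        (T := Side.tapes u d) h
      rw [ITM.extend_plugOuterTape] at he
      exact ⟨_, _, ITM.stepWith_of_exec (σ.plug π) (l := ⟨(.up, q₀, r₀), mem⟩) he, rfl, rfl⟩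

theorem step_outer_send_up (hs : OuterRuns a P s = true) {b : Bool} {q : σ.Q}
    {C : σ.K ⊕ Side → List Bool}
    (h : outerExec b (ofPlayer idle a P s u d) = (q, C, .send .up)) :
    ∃ s', (Party.combine σ a P).stepWith b s (Side.tapes u d) =
        (s', Side.tapes u d, .send .up) ∧
      ofPlayer idle a P s' u d = (ofPlayer idle a P s u d).setState q := by
  obtain rfl := Instr.exec_tapes_of_not_run h rfl
  cases a with
  | false => cases hs
  | true =>
    cases P with
    | dummy => exact ⟨_, ITM.stepWith_of_exec _ h, rfl⟩
    | machine π =>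
      obtain ⟨⟨x, q₀, r₀⟩, mem⟩ := s
      obtain rfl : x = .up := of_decide_eq_true hs
      refine ⟨⟨(.up, q, r₀), mem⟩, ITM.stepWith_of_exec (σ.plug π) (l := ⟨(.up, q₀, r₀), mem⟩)
        (C := Sum.elim mem (Side.tapes u d)) ?_, rfl⟩
      have hc := (ITM.plug_code_up (π := π) q₀ r₀).trans (Instr.lift_of_exec_send h)
      simp only [hc, Instr.exec]

theorem step_outer_done (hs : OuterRuns a P s = true) {b : Bool} {q : σ.Q}
    {C : σ.K ⊕ Side → List Bool}
    (h : outerExec b (ofPlayer idle a P s u d) = (q, C, .done)) :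
    ∃ s', (Party.combine σ a P).stepWith b s (Side.tapes u d) = (s', Side.tapes u d, .done) ∧
      ofPlayer idle a P s' u d = (ofPlayer idle a P s u d).setState q := by
  obtain rfl := Instr.exec_tapes_of_not_run h rfl
  cases a with
  | false => cases hs
  | true =>
    cases P with
    | dummy => exact ⟨_, ITM.stepWith_of_exec _ h, rfl⟩
    | machine π =>
      obtain ⟨⟨x, q₀, r₀⟩, mem⟩ := s
      obtain rfl : x = .up := of_decide_eq_true hs
      refine ⟨⟨(.up, q, r₀), mem⟩, ITM.stepWith_of_exec (σ.plug π) (l := ⟨(.up, q₀, r₀), mem⟩)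
        (C := Sum.elim mem (Side.tapes u d)) ?_, rfl⟩
      have hc := (ITM.plug_code_up (π := π) q₀ r₀).trans (Instr.lift_of_exec_done h)
      simp only [hc, Instr.exec]

theorem step_outer_send_dummy (hs : OuterRuns a P s = true) (hP : P.IsDummy = true) {b : Bool}
    {q : σ.Q} {C : σ.K ⊕ Side → List Bool}
    (h : outerExec b (ofPlayer idle a P s u d) = (q, C, .send .down)) :
    ∃ s', (Party.combine σ a P).stepWith b s (Side.tapes u d) =
        (s', Side.tapes u d, .send .down) ∧
      ofPlayer idle a P s' u d = (ofPlayer idle a P s u d).setState q := by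
  obtain rfl := Instr.exec_tapes_of_not_run h rfl
  cases a with
  | false => cases hs
  | true =>
    cases P with
    | dummy => exact ⟨_, ITM.stepWith_of_exec _ h, rfl⟩
    | machine π => cases hP

/-- Above a protocol machine, sending down stays inside the player. If the machine ignores the
activation, the player ends with `done`, which wakes the rules by default, exactly as an ignored
activation does in a network. -/
theorem step_outer_send_machine (hs : OuterRuns a P s = true) (hP : P.IsDummy = false)
    {b : Bool} {q : σ.Q} {C : σ.K ⊕ Side → List Bool}
    (h : outerExec b (ofPlayer idle a P s u d) = (q, C, .send .down)) :
    match P.recv .up (ofPlayer idle a P s u d).inner with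
    | none => ∃ s', (Party.combine σ a P).stepWith b s (Side.tapes u d) =
        (s', Side.tapes u d, .done) ∧
      ofPlayer idle a P s' u d = (ofPlayer idle a P s u d).setState q
    | some r => ∃ s', (Party.combine σ a P).stepWith b s (Side.tapes u d) =
        (s', Side.tapes u d, .run) ∧ OuterRuns a P s' = false ∧
      ofPlayer idle a P s' u d =
        { (ofPlayer idle a P s u d).setState q with inner := r } := by
  obtain rfl := Instr.exec_tapes_of_not_run h rfl
  cases a with
  | false => cases hs
  | true =>
    cases P with
    | dummy => cases hP
    | machine π =>
      obtain ⟨⟨x, q₀, r₀⟩, mem⟩ := s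
      obtain rfl : x = .up := of_decide_eq_true hs
      have hc := (ITM.plug_code_up (π := π) q₀ r₀).trans (Instr.lift_of_exec_send h)
      have hP : (Party.machine π).recv .up (ofPlayer idle true (.machine π)
          ⟨(.up, q₀, r₀), mem⟩ u d).inner =
          (π.recv (some .up) r₀).map fun r => ⟨r, fun k => mem (.inl (.inr k))⟩ := rfl
      rw [hP]
      rcases hr : π.recv (some .up) r₀ with _ | r
      · refine ⟨⟨(.up, q, r₀), mem⟩, ITM.stepWith_of_exec (σ.plug π) (l := ⟨(.up, q₀, r₀), mem⟩)
          (C := Sum.elim mem (Side.tapes u d)) ?_, rfl⟩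
        simp only [hc, hr, Instr.exec]
      · refine ⟨⟨(.down, q, r), mem⟩, ITM.stepWith_of_exec (σ.plug π)
          (l := ⟨(.up, q₀, r₀), mem⟩) (C := Sum.elim mem (Side.tapes u d)) ?_, rfl, rfl⟩
        simp only [hc, hr, Instr.exec]

/-- The step of the party below the strategy in the split `v`. -/
def innerStep (b : Bool) (v : Split σ P) : P.State × (Side → List Bool) × Signal Side :=
  P.stepWith b v.inner (Side.tapes v.port v.below)

/-- The split after the party has changed its state and its tapes. -/
def setInner (v : Split σ P) (p : P.State) (T : Side → List Bool) : Split σ P :=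
  { v with inner := p, port := T .up, below := T .down }

/-- A step of the party below an absorbed strategy is a step of the player, except that passing the
activation upwards is handled by the strategy. -/
theorem step_inner (hs : OuterRuns a P s = false) {b : Bool} {p : P.State}
    {T : Side → List Bool} {sig : Signal Side}
    (h : innerStep b (ofPlayer idle a P s u d) = (p, T, sig))
    (hsig : a = false ∨ sig ≠ .send .up) :
    ∃ s' T', (Party.combine σ a P).stepWith b s (Side.tapes u d) = (s', T', sig) ∧
      OuterRuns a P s' = false ∧
      ofPlayer idle a P s' (T' .up) (T' .down) = (ofPlayer idle a P s u d).setInner p T := by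
  cases a with
  | false => exact ⟨p, T, h, rfl, rfl⟩
  | true =>
    cases P with
    | dummy => cases hs
    | machine π =>
      obtain ⟨⟨x, q₀, r₀⟩, mem⟩ := s
      obtain rfl : x = .down := by cases x <;> first | rfl | cases hs
      rcases hx : (π.code r₀).exec b (Sum.elim (ITM.plugInner (σ := σ) ⟨(.down, q₀, r₀), mem⟩).mem
        (Side.tapes (ITM.plugLink (π := π) ⟨(.down, q₀, r₀), mem⟩) d))
        with ⟨r, C, sg⟩
      have e := h.symm.trans (ITM.stepWith_of_exec π hx)
      cases e
      have hc : ∀ i, (σ.plug π).code (.down, q₀, r₀) = i → _ := fun i hi =>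
        ITM.stepWith_of_exec (σ.plug π) (b := b) (l := ⟨(.down, q₀, r₀), mem⟩)
          (T := Side.tapes u d) (by rw [hi])
      cases sig with
      | run =>
        have he := ITM.plug_exec_inner_run (σ := σ) (q := q₀) (T := Side.tapes u d) hx
        rw [ITM.extend_plugInnerTape] at he
        exact ⟨_, _, ITM.stepWith_of_exec (σ.plug π) (l := ⟨(.down, q₀, r₀), mem⟩) he, rfl, rfl⟩
      | send D =>
        obtain rfl := Instr.exec_tapes_of_not_run hx rfl
        cases D with
        | up => simp at hsig
        | down =>
          exact ⟨_, _, hc _ ((ITM.plug_code_down (σ := σ) q₀ r₀).trans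
            (Instr.lift_of_exec_send hx)), rfl, rfl⟩
      | done =>
        obtain rfl := Instr.exec_tapes_of_not_run hx rfl
        exact ⟨_, _, hc _ ((ITM.plug_code_down (σ := σ) q₀ r₀).trans
          (Instr.lift_of_exec_done hx)), rfl, rfl⟩

/-- Within the player this is an internal handover, whereas in the network of the tester it is a
message that reaches the top machine. The two cases match the answer of the strategy there: being
ignored leads to a default activation, for which the player uses `done`. -/
theorem step_inner_send_up (ha : a = true) (hs : OuterRuns a P s = false) {b : Bool}
    {p : P.State} {T : Side → List Bool}
    (h : innerStep b (ofPlayer idle a P s u d) = (p, T, .send .up)) :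
    match σ.recv (some .down) (ofPlayer idle a P s u d).outer.state with
    | none => ∃ s' T', (Party.combine σ a P).stepWith b s (Side.tapes u d) = (s', T', .done) ∧
      ofPlayer idle a P s' (T' .up) (T' .down) = (ofPlayer idle a P s u d).setInner p T
    | some q => ∃ s' T', (Party.combine σ a P).stepWith b s (Side.tapes u d) = (s', T', .run) ∧
      OuterRuns a P s' = true ∧
      ofPlayer idle a P s' (T' .up) (T' .down) =
        ((ofPlayer idle a P s u d).setInner p T).setState q := by
  subst ha
  cases P with
  | dummy => cases hs
  | machine π =>
    obtain ⟨⟨x, q₀, r₀⟩, mem⟩ := s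
    obtain rfl : x = .down := by cases x <;> first | rfl | cases hs
    rcases hx : (π.code r₀).exec b (Sum.elim (ITM.plugInner (σ := σ) ⟨(.down, q₀, r₀), mem⟩).mem
      (Side.tapes (ITM.plugLink (π := π) ⟨(.down, q₀, r₀), mem⟩) d))
      with ⟨r, C, sg⟩
    have e := h.symm.trans (ITM.stepWith_of_exec π hx)
    cases e
    obtain rfl := Instr.exec_tapes_of_not_run hx rfl
    have hi := (ITM.plug_code_down (σ := σ) q₀ r₀).trans (Instr.lift_of_exec_send hx)
    simp only [ofPlayer, ITM.plugOuter]
    rcases hr : σ.recv (some .down) q₀ with _ | q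
    · simp only [hr] at hi
      exact ⟨_, _, ITM.stepWith_of_exec (σ.plug π) (b := b) (l := ⟨(.down, q₀, r₀), mem⟩)
          (T := Side.tapes u d) (by rw [hi]; rfl), rfl⟩
    · simp only [hr] at hi
      exact ⟨_, _, ITM.stepWith_of_exec (σ.plug π) (b := b) (l := ⟨(.down, q₀, r₀), mem⟩)
          (T := Side.tapes u d) (by rw [hi]; rfl), rfl, rfl⟩

end Split
end PseudoNash

/-! ### Routing of activations, and assembled configurations of the tester. -/

namespace PseudoNash

namespace Net

variable {n : ℕ} {top : ITM (Fin n)} {parties : Fin n → Party} {bot : ITM (Fin n)}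

theorem stepWith_top {c : Net top parties bot} (hc : c.active = some .top) {b : Bool} {q : top.Q}
    {C : top.K ⊕ Fin n → List Bool} {sig : Signal (Fin n)}
    (h : (top.code c.topS.state).exec b (Sum.elim c.topS.mem c.upT) = (q, C, sig)) :
    c.stepWith b = c.afterTop (⟨q, C ∘ Sum.inl⟩, C ∘ Sum.inr, sig) := by
  simp only [stepWith, hc, top.stepWith_of_exec h]

theorem stepWith_top_goto {c : Net top parties bot} (hc : c.active = some .top) {b : Bool}
    {q : top.Q} (h : top.code c.topS.state = .goto q) :
    c.stepWith b = { c with topS := ⟨q, c.topS.mem⟩ } :=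
  stepWith_top hc (C := Sum.elim c.topS.mem c.upT) (by rw [h]; rfl)

theorem stepWith_top_send {c : Net top parties bot} (hc : c.active = some .top) {b : Bool}
    {q : top.Q} {j : Fin n} (h : top.code c.topS.state = .send j q) :
    c.stepWith b = if (parties j).IsDummy then toBot j { c with topS := ⟨q, c.topS.mem⟩ }
      else toParty j .up { c with topS := ⟨q, c.topS.mem⟩ } :=
  stepWith_top hc (C := Sum.elim c.topS.mem c.upT) (by rw [h]; rfl)

theorem wakeTop_of_some {c : Net top parties bot} {q : top.Q}
    (h : top.recv none c.topS.state = some q) :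
    c.wakeTop = { c with active := some .top, topS := ⟨q, c.topS.mem⟩ } := by
  simp only [wakeTop, h]

theorem wakeTop_of_none {c : Net top parties bot} (h : top.recv none c.topS.state = none) :
    c.wakeTop = { c with active := none } := by
  simp only [wakeTop, h]

theorem toTop_of_some {c : Net top parties bot} {i : Fin n} {q : top.Q}
    (h : top.recv (some i) c.topS.state = some q) :
    c.toTop i = { c with active := some .top, topS := ⟨q, c.topS.mem⟩ } := by
  simp only [toTop, h]

theorem toTop_of_none {c : Net top parties bot} {i : Fin n}
    (h : top.recv (some i) c.topS.state = none) : c.toTop i = c.wakeTop := by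
  simp only [toTop, h]

theorem toBot_of_some {c : Net top parties bot} {i : Fin n} {q : bot.Q}
    (h : bot.recv (some i) c.botS.state = some q) :
    c.toBot i = { c with active := some .bot, botS := ⟨q, c.botS.mem⟩ } := by
  simp only [toBot, h]

theorem toBot_of_none {c : Net top parties bot} {i : Fin n}
    (h : bot.recv (some i) c.botS.state = none) : c.toBot i = c.wakeTop := by
  simp only [toBot, h]

theorem toParty_of_some {c : Net top parties bot} {i : Fin n} {D : Side} {s : (parties i).State}
    (h : (parties i).recv D (c.partyS i) = some s) :
    c.toParty i D = { c with
      active := some (.party i), partyS := Function.update c.partyS i s } := by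
  simp only [toParty, h]

theorem toParty_of_none {c : Net top parties bot} {i : Fin n} {D : Side}
    (h : (parties i).recv D (c.partyS i) = none) : c.toParty i D = c.wakeTop := by
  simp only [toParty, h]

end Net

namespace Tester

variable {n : ℕ} {E : Tester n} {P : Fin n → Party} {bot : ITM (Fin n)}
  (jm : E.judge.K → List Bool)

/-! ## Lockstep simulation -/

/-- The configuration of the network of the tester that is made of the given configurations of the
simulated machines. -/
def assemble (c : E.Ctl) (act : Option (Node n)) (l : E.rules.Local) (lb : bot.Local)
    (v : ∀ j, Split (E.strat j) (P j)) : Net E.machine P bot where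
  active := act
  topS := ⟨(c, l.state, fun j => (v j).outer.state), fun
    | .rules k => l.mem k
    | .strat j k => (v j).outer.mem k
    | .link j => (v j).link
    | .judge k _ => jm k⟩
  partyS j := (v j).inner
  botS := lb
  upT j := (v j).port
  downT j := (v j).below

/-- The configuration after the rules have been activated by default. -/
def assembleWake (l : E.rules.Local) (lb : bot.Local) (v : ∀ j, Split (E.strat j) (P j)) :
    Net E.machine P bot :=
  match E.rules.recv none l.state with
  | some q => assemble jm .rules (some .top) ⟨q, l.mem⟩ lb v
  | none => assemble jm (.judge E.judgeStart) (some .top) l lb v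

section Assemble

variable (c : E.Ctl) (act : Option (Node n)) (l : E.rules.Local) (lb : bot.Local)
  (v : ∀ j, Split (E.strat j) (P j)) (j : Fin n)

theorem wakeTop_assemble : (assemble jm .rules act l lb v).wakeTop = assembleWake jm l lb v := by
  simp only [Net.wakeTop, assemble, assembleWake, wake]
  cases E.rules.recv none l.state <;> rfl

/-- The tester wakes its own rules by a `goto`, without giving up control; the configuration is the
same as after a default activation from outside. -/
theorem assemble_wake :
    { assemble jm c (some .top) l lb v with
      topS := ⟨E.wake l.state fun j => (v j).outer.state,
        (assemble jm c (some .top) l lb v).topS.mem⟩ } = assembleWake jm l lb v := by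
  simp only [assemble, assembleWake, wake]
  cases E.rules.recv none l.state <;> rfl

/-- The state of a strategy enters only the finite control of the tester, so a `goto` of the tester
can be read as an update of the split. -/
theorem assemble_setState (s : (E.strat j).Q) :
    assemble jm c act l lb (Function.update v j ((v j).setState s)) =
      { assemble jm c act l lb v with
        topS := ⟨(c, l.state, Function.update (fun j => (v j).outer.state) j s),
          (assemble jm c act l lb v).topS.mem⟩ } := by
  have e : ∀ {β : Fin n → Type} (f : ∀ i, Split (E.strat i) (P i) → β i)
      (_ : f j ((v j).setState s) = f j (v j)) (i : Fin n),
      f i (Function.update v j ((v j).setState s) i) = f i (v i) := by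
    intro β f hf i
    by_cases hi : i = j
    · subst hi; rw [Function.update_self, hf]
    · rw [Function.update_of_ne hi]
  have e' : (fun i => (Function.update v j ((v j).setState s) i).outer.state) =
      Function.update (fun i => (v i).outer.state) j s := by
    funext i
    by_cases hi : i = j
    · subst hi; simp [Split.setState]
    · simp [hi]
  simp only [assemble, e', Net.mk.injEq, true_and, ITM.Local.mk.injEq]
  refine ⟨?_, funext (e (fun i w => w.inner) rfl), funext (e (fun i w => w.port) rfl),
    funext (e (fun i w => w.below) rfl)⟩
  funext k
  rcases k with k | ⟨i, k⟩ | i | ⟨k, hk⟩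
  · rfl
  · exact congrFun (e (β := fun i => (E.strat i).K → List Bool) (fun i w => w.outer.mem) rfl i) k
  · exact e (fun i w => w.link) rfl i
  · rfl

theorem assemble_setInner (p : (P j).State) (T : Side → List Bool) :
    assemble jm c act l lb (Function.update v j ((v j).setInner p T)) =
      { assemble jm c act l lb v with
        partyS := Function.update (fun j => (v j).inner) j p
        upT := Function.update (fun j => (v j).port) j (T .up)
        downT := Function.update (fun j => (v j).below) j (T .down) } := by
  have e : ∀ {β : Fin n → Type} (f : ∀ i, Split (E.strat i) (P i) → β i)
      (_ : f j ((v j).setInner p T) = f j (v j)) (i : Fin n),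
      f i (Function.update v j ((v j).setInner p T) i) = f i (v i) := by
    intro β f hf i
    by_cases hi : i = j
    · subst hi; rw [Function.update_self, hf]
    · rw [Function.update_of_ne hi]
  have e' : ∀ {β : Fin n → Type} (f : ∀ i, Split (E.strat i) (P i) → β i),
      (fun i => f i (Function.update v j ((v j).setInner p T) i)) =
      Function.update (fun i => f i (v i)) j (f j ((v j).setInner p T)) := by
    intro β f
    funext i
    by_cases hi : i = j
    · subst hi; simp
    · simp [hi]
  simp only [assemble, Net.mk.injEq, true_and, ITM.Local.mk.injEq, Prod.mk.injEq]
  refine ⟨⟨funext (e (β := fun i => (E.strat i).Q) (fun i w => w.outer.state) rfl), ?_⟩,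
    e' (fun i w => w.inner), e' (fun i w => w.port), e' (fun i w => w.below)⟩
  funext k
  rcases k with k | ⟨i, k⟩ | i | ⟨k, hk⟩
  · rfl
  · exact congrFun (e (β := fun i => (E.strat i).K → List Bool) (fun i w => w.outer.mem) rfl i) k
  · exact e (fun i w => w.link) rfl i
  · rfl

/-- What arrives at the port of an absorbed player comes from below its strategy; hence it wakes the
strategy through the port `down`, and not the rules. -/
theorem toTop_assemble_of_absorbs (hj : E.absorbs j = true) :
    (assemble jm .rules act l lb v).toTop j =
      match (E.strat j).recv (some .down) (v j).outer.state with
      | some s => assemble jm (.strat j) (some .top) l lb (Function.update v j ((v j).setState s))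
      | none => assembleWake jm l lb v := by
  have h : E.machine.recv (some j) (.rules, l.state, fun j => (v j).outer.state) =
      ((E.strat j).recv (some .down) (v j).outer.state).map fun s =>
        (.strat j, l.state, Function.update (fun j => (v j).outer.state) j s) := by
    simp only [hj, if_true]
  cases hr : (E.strat j).recv (some .down) (v j).outer.state with
  | none =>
    rw [hr] at h
    exact (Net.toTop_of_none h).trans (wakeTop_assemble ..)
  | some s =>
    rw [hr] at h
    exact (Net.toTop_of_some h).trans (assemble_setState jm (.strat j) (some .top) l lb v j s).symm

theorem toTop_assemble (hj : E.absorbs j = false) :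
    (assemble jm .rules act l lb v).toTop j =
      match E.rules.recv (some j) l.state with
      | some q => assemble jm .rules (some .top) ⟨q, l.mem⟩ lb v
      | none => assembleWake jm l lb v := by
  have h : E.machine.recv (some j) (.rules, l.state, fun j => (v j).outer.state) =
      (E.rules.recv (some j) l.state).map fun q => (.rules, q, fun j => (v j).outer.state) := by
    simp [hj]
  cases hr : E.rules.recv (some j) l.state with
  | none =>
    rw [hr] at h
    exact (Net.toTop_of_none h).trans (wakeTop_assemble ..)
  | some s =>
    rw [hr] at h
    exact Net.toTop_of_some h

theorem toBot_assemble :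
    (assemble jm .rules act l lb v).toBot j =
      match bot.recv (some j) lb.state with
      | some q => assemble jm .rules (some .bot) l ⟨q, lb.mem⟩ v
      | none => assembleWake jm l lb v := by
  cases hr : bot.recv (some j) lb.state with
  | none => exact (Net.toBot_of_none hr).trans (wakeTop_assemble ..)
  | some s => exact Net.toBot_of_some hr

theorem toParty_assemble (D : Side) :
    (assemble jm .rules act l lb v).toParty j D =
      match (P j).recv D (v j).inner with
      | some p => assemble jm .rules (some (.party j)) l lb
          (Function.update v j { v j with inner := p })
      | none => assembleWake jm l lb v := by
  cases hr : (P j).recv D (v j).inner with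
  | none => exact (Net.toParty_of_none hr).trans (wakeTop_assemble ..)
  | some p =>
    refine (Net.toParty_of_some hr).trans (Eq.trans ?_ (assemble_setInner jm .rules
      (some (.party j)) l lb v j p (Side.tapes (v j).port (v j).below)).symm)
    simp [assemble, Side.tapes]

end Assemble

end Tester
end PseudoNash

/-! ### Steps of assembled configurations. -/

namespace PseudoNash
namespace Tester

variable {n : ℕ} {E : Tester n} {P : Fin n → Party} {bot : ITM (Fin n)}
  (jm : E.judge.K → List Bool)

section Step

variable (l : E.rules.Local) (lb : bot.Local) (v : ∀ j, Split (E.strat j) (P j)) {b : Bool}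

/-- A step of the rules with the given configurations of all machines. -/
def rulesExec (b : Bool) (l : E.rules.Local) (v : ∀ j, Split (E.strat j) (P j)) :
    E.rules.Q × (E.rules.K ⊕ Fin n → List Bool) × Signal (Fin n) :=
  (E.rules.code l.state).exec b
    (Sum.elim l.mem fun j => if E.absorbs j then (v j).link else (v j).port)

theorem stepWith_rules_run {q : E.rules.Q} {C : E.rules.K ⊕ Fin n → List Bool}
    (h : rulesExec b l v = (q, C, .run)) :
    (assemble jm .rules (some .top) l lb v).stepWith b =
      assemble jm .rules (some .top) ⟨q, C ∘ Sum.inl⟩ lb fun j => { v j with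
        link := if E.absorbs j then C (.inr j) else (v j).link
        port := if E.absorbs j then (v j).port else C (.inr j) } := by
  have he := exec_rules_run (r := fun j => (v j).outer.state)
    (mem := (assemble jm .rules (some .top) l lb v).topS.mem)
    (T := (assemble jm .rules (some .top) l lb v).upT) h
  rw [extend_rulesTape] at he
  refine (Net.stepWith_top (c := assemble jm .rules (some .top) l lb v) rfl he).trans ?_
  simp only [assemble, Net.afterTop, Net.mk.injEq, true_and, and_true, ITM.Local.mk.injEq]
  refine ⟨?_, rfl⟩
  funext k
  rcases k with k | ⟨i, k⟩ | i | ⟨k, hk⟩ <;> rfl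

theorem stepWith_rules_send_of_absorbs {q : E.rules.Q} {C : E.rules.K ⊕ Fin n → List Bool}
    {j : Fin n} (hj : E.absorbs j = true) (h : rulesExec b l v = (q, C, .send j)) :
    (assemble jm .rules (some .top) l lb v).stepWith b =
      match (E.strat j).recv (some .up) (v j).outer.state with
      | some s => assemble jm (.strat j) (some .top) ⟨q, l.mem⟩ lb
          (Function.update v j ((v j).setState s))
      | none => assembleWake jm ⟨q, l.mem⟩ lb v := by
  have hc := code_rules_send (r := fun j => (v j).outer.state) (C' := C) h
  rw [if_pos hj] at hc
  cases hr : (E.strat j).recv (some .up) (v j).outer.state with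
  | some s =>
    rw [hr] at hc
    exact (Net.stepWith_top_goto (c := assemble jm .rules (some .top) l lb v) rfl hc).trans
      (assemble_setState jm (.strat j) (some .top) ⟨q, l.mem⟩ lb v j s).symm
  | none =>
    rw [hr] at hc
    exact (Net.stepWith_top_goto (c := assemble jm .rules (some .top) l lb v) rfl hc).trans
      (assemble_wake jm .rules ⟨q, l.mem⟩ lb v)

theorem stepWith_rules_send {q : E.rules.Q} {C : E.rules.K ⊕ Fin n → List Bool}
    {j : Fin n} (hj : E.absorbs j = false) (h : rulesExec b l v = (q, C, .send j)) :
    (assemble jm .rules (some .top) l lb v).stepWith b =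
      if (P j).IsDummy then (assemble jm .rules (some .top) ⟨q, l.mem⟩ lb v).toBot j
      else (assemble jm .rules (some .top) ⟨q, l.mem⟩ lb v).toParty j .up := by
  have hc := code_rules_send (r := fun j => (v j).outer.state) (C' := C) h
  rw [if_neg (by simp [hj])] at hc
  exact Net.stepWith_top_send (c := assemble jm .rules (some .top) l lb v) rfl hc

theorem stepWith_rules_done {q : E.rules.Q} {C : E.rules.K ⊕ Fin n → List Bool}
    (h : rulesExec b l v = (q, C, .done)) :
    (assemble jm .rules (some .top) l lb v).stepWith b =
      assemble jm (.judge E.judgeStart) (some .top) ⟨q, l.mem⟩ lb v :=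
  Net.stepWith_top_goto (c := assemble jm .rules (some .top) l lb v) rfl
    (code_rules_done (r := fun j => (v j).outer.state) (C' := C) h)

variable {j : Fin n} {s : (E.strat j).Q} {C : (E.strat j).K ⊕ Side → List Bool}

theorem stepWith_strat_run (h : (v j).outerExec b = (s, C, .run)) :
    (assemble jm (.strat j) (some .top) l lb v).stepWith b =
      assemble jm (.strat j) (some .top) l lb (Function.update v j { v j with
        outer := ⟨s, C ∘ Sum.inl⟩
        link := C (.inr .up)
        port := C (.inr .down) }) := by
  have he := exec_strat_run (q := l.state) (r := fun j => (v j).outer.state)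
    (mem := (assemble jm (.strat j) (some .top) l lb v).topS.mem)
    (T := (assemble jm (.strat j) (some .top) l lb v).upT) h
  refine (Net.stepWith_top (c := assemble jm (.strat j) (some .top) l lb v) rfl he).trans ?_
  simp only [assemble, Net.afterTop, Net.mk.injEq, true_and, ITM.Local.mk.injEq,
    Prod.mk.injEq]
  refine ⟨⟨?_, ?_⟩, ?_, ?_, ?_⟩
  · funext i
    by_cases hi : i = j
    · subst hi; simp
    · simp [hi]
  · funext k
    rcases k with k | ⟨i, k⟩ | i | ⟨k, hk⟩
    · exact extend_stratTape_rules _ C k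
    · by_cases hi : i = j
      · subst hi
        dsimp only
        rw [Function.update_self]
        exact extend_stratTape_strat _ C k
      · dsimp only
        rw [Function.update_of_ne hi]
        exact extend_stratTape_strat_of_ne _ C hi k
    · by_cases hi : i = j
      · subst hi
        dsimp only
        rw [Function.update_self]
        exact extend_stratTape_link _ C
      · dsimp only
        rw [Function.update_of_ne hi]
        exact extend_stratTape_link_of_ne _ C hi
    · exact extend_stratTape_judge _ C k hk
  · funext i
    by_cases hi : i = j
    · subst hi; simp
    · simp [hi]
  · funext i
    by_cases hi : i = j
    · subst hi
      rw [Function.update_self]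
      exact extend_stratTape_port _ C
    · rw [Function.update_of_ne hi]
      exact extend_stratTape_port_of_ne _ C hi
  · funext i
    by_cases hi : i = j
    · subst hi; simp
    · simp [hi]

theorem outer_state_update :
    (fun i => (Function.update v j ((v j).setState s) i).outer.state) =
      Function.update (fun i => (v i).outer.state) j s := by
  funext i
  by_cases hi : i = j
  · subst hi; simp [Split.setState]
  · simp [hi]

theorem goto_wake_setState (c : E.Ctl) :
    { assemble jm c (some .top) l lb v with
      topS := ⟨E.wake l.state (Function.update (fun i => (v i).outer.state) j s),
        (assemble jm c (some .top) l lb v).topS.mem⟩ } =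
      assembleWake jm l lb (Function.update v j ((v j).setState s)) := by
  rw [← assemble_wake jm c, assemble_setState, outer_state_update]

theorem stepWith_strat_send_up (h : (v j).outerExec b = (s, C, .send .up)) :
    (assemble jm (.strat j) (some .top) l lb v).stepWith b =
      match E.rules.recv (some j) l.state with
      | some q => assemble jm .rules (some .top) ⟨q, l.mem⟩ lb
          (Function.update v j ((v j).setState s))
      | none => assembleWake jm l lb (Function.update v j ((v j).setState s)) := by
  have hc := code_strat_send_up (q := l.state) (r := fun j => (v j).outer.state) (C' := C) h
  cases hr : E.rules.recv (some j) l.state with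
  | some q =>
    rw [hr] at hc
    exact (Net.stepWith_top_goto (c := assemble jm (.strat j) (some .top) l lb v) rfl hc).trans
      (assemble_setState jm .rules (some .top) ⟨q, l.mem⟩ lb v j s).symm
  | none =>
    rw [hr] at hc
    exact (Net.stepWith_top_goto (c := assemble jm (.strat j) (some .top) l lb v) rfl hc).trans
      (goto_wake_setState jm l lb v (.strat j))

theorem stepWith_strat_done (h : (v j).outerExec b = (s, C, .done)) :
    (assemble jm (.strat j) (some .top) l lb v).stepWith b =
      assembleWake jm l lb (Function.update v j ((v j).setState s)) :=
  (Net.stepWith_top_goto (c := assemble jm (.strat j) (some .top) l lb v) rfl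
    (code_strat_done (q := l.state) (r := fun j => (v j).outer.state) (C' := C) h)).trans
      (goto_wake_setState jm l lb v (.strat j))

theorem stepWith_strat_send_down (h : (v j).outerExec b = (s, C, .send .down)) :
    (assemble jm (.strat j) (some .top) l lb v).stepWith b =
      if (P j).IsDummy then
        (assemble jm .rules (some .top) l lb (Function.update v j ((v j).setState s))).toBot j
      else
        (assemble jm .rules (some .top) l lb
          (Function.update v j ((v j).setState s))).toParty j .up := by
  rw [assemble_setState]
  exact Net.stepWith_top_send (c := assemble jm (.strat j) (some .top) l lb v) rfl
    (code_strat_send_down (q := l.state) (r := fun j => (v j).outer.state) (C' := C) h)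

theorem stepWith_party {p : (P j).State} {T : Side → List Bool} {sig : Signal Side}
    (h : (v j).innerStep b = (p, T, sig)) :
    (assemble jm .rules (some (.party j)) l lb v).stepWith b =
      let c := assemble jm .rules (some (.party j)) l lb
        (Function.update v j ((v j).setInner p T))
      match sig with
      | .run => c
      | .send .up => c.toTop j
      | .send .down => c.toBot j
      | .done => c.wakeTop := by
  rw [assemble_setInner]
  have h' : (P j).stepWith b (v j).inner
      ((assemble jm .rules (some (.party j)) l lb v).partyTapes j) = (p, T, sig) := by
    rw [Net.partyTapes_eq]
    exact h
  simp only [Net.stepWith]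
  change Net.afterParty _ j ((P j).stepWith b (v j).inner _) = _
  rw [h']
  rcases sig with _ | ⟨_ | _⟩ | _ <;> rfl

end Step

end Tester
end PseudoNash

/-! ### Step-by-step correspondence of the game and the network of the tester. -/

namespace PseudoNash
namespace Tester

variable {n : ℕ} (E : Tester n) (P : Fin n → Party)

/-- The parties of the game that a tester linked to the parties `P` simulates. -/
abbrev players (j : Fin n) : Party := Party.combine (E.strat j) (E.absorbs j) (P j)

variable {E P} {bot : ITM (Fin n)} (jm : E.judge.K → List Bool) (idle : ∀ j, (E.strat j).Local)

/-- The players of a game, split into strategies and parties. -/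
def splits (c : Net E.rules (E.players P) bot) (j : Fin n) : Split (E.strat j) (P j) :=
  Split.ofPlayer (idle j) (E.absorbs j) (P j) (c.partyS j) (c.upT j) (c.downT j)

/-- Whether the part of player `j` that runs when `j` is active is an absorbed strategy. -/
def outerRuns (c : Net E.rules (E.players P) bot) (j : Fin n) : Bool :=
  Split.OuterRuns (E.absorbs j) (P j) (c.partyS j)

/-- The configuration of the network of the tester that corresponds to a configuration of the
simulated game. -/
def view (c : Net E.rules (E.players P) bot) : Net E.machine P bot :=
  match c.active with
  -- The end of the game is not the end for the tester, which is about to run the judge.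
  | none => assemble jm (.judge E.judgeStart) (some .top) c.topS c.botS (splits idle c)
  | some .top => assemble jm .rules (some .top) c.topS c.botS (splits idle c)
  | some (.party j) =>
    -- An absorbed strategy is a component of the top machine, so the active node is the top one
    -- while the strategy runs.
    if outerRuns c j then assemble jm (.strat j) (some .top) c.topS c.botS (splits idle c)
    else assemble jm .rules (some (.party j)) c.topS c.botS (splits idle c)
  | some .bot => assemble jm .rules (some .bot) c.topS c.botS (splits idle c)

variable (c : Net E.rules (E.players P) bot)

theorem splits_setParty (j : Fin n) (act : Option (Node n)) (s : (E.players P j).State)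
    (T : Side → List Bool) :
    splits idle { c with
      active := act
      partyS := Function.update c.partyS j s
      upT := Function.update c.upT j (T .up)
      downT := Function.update c.downT j (T .down) } =
    Function.update (splits idle c) j
      (Split.ofPlayer (idle j) (E.absorbs j) (P j) s (T .up) (T .down)) := by
  funext i
  by_cases hi : i = j
  · subst hi; simp [splits]
  · simp [splits, hi]

theorem splits_setPartyState (j : Fin n) (act : Option (Node n)) (s : (E.players P j).State) :
    splits idle { c with active := act, partyS := Function.update c.partyS j s } =
    Function.update (splits idle c) j
      (Split.ofPlayer (idle j) (E.absorbs j) (P j) s (c.upT j) (c.downT j)) := by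
  have h := splits_setParty idle c j act s (Side.tapes (c.upT j) (c.downT j))
  simpa only [Side.tapes, Function.update_eq_self] using h

theorem view_wakeTop : view jm idle c.wakeTop = assembleWake jm c.topS c.botS (splits idle c) := by
  cases hr : E.rules.recv none c.topS.state with
  | none => rw [Net.wakeTop_of_none hr, assembleWake, hr]; rfl
  | some q => rw [Net.wakeTop_of_some hr, assembleWake, hr]; rfl

theorem view_toTop (j : Fin n) : view jm idle (c.toTop j) =
    match E.rules.recv (some j) c.topS.state with
    | some q => assemble jm .rules (some .top) ⟨q, c.topS.mem⟩ c.botS (splits idle c)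
    | none => assembleWake jm c.topS c.botS (splits idle c) := by
  cases hr : E.rules.recv (some j) c.topS.state with
  | none => rw [Net.toTop_of_none hr, view_wakeTop]
  | some q => rw [Net.toTop_of_some hr]; rfl

/-- The node `act` is arbitrary, because the new activation overwrites it. -/
theorem view_toBot (j : Fin n) (act : Option (Node n)) : view jm idle (c.toBot j) =
    (assemble jm .rules act c.topS c.botS (splits idle c)).toBot j := by
  rw [toBot_assemble]
  cases hr : bot.recv (some j) c.botS.state with
  | none => rw [Net.toBot_of_none hr, view_wakeTop]
  | some q => rw [Net.toBot_of_some hr]; rfl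

theorem view_toParty_inner {j : Fin n} {D : Side} (act : Option (Node n))
    (h : E.absorbs j = false ∨ D = .down ∧ (P j).IsDummy = false) :
    view jm idle (c.toParty j D) =
      (assemble jm .rules act c.topS c.botS (splits idle c)).toParty j D := by
  rw [toParty_assemble]
  have h₁ := Split.recv_inner (idle := idle j) (s := c.partyS j) (u := c.upT j) (d := c.downT j) h
  cases hr : (P j).recv D (splits idle c j).inner with
  | none =>
    rw [show (P j).recv D (Split.ofPlayer (idle j) (E.absorbs j) (P j) (c.partyS j) (c.upT j)
      (c.downT j)).inner = none from hr] at h₁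
    rw [Net.toParty_of_none h₁, view_wakeTop]
  | some r =>
    rw [show (P j).recv D (Split.ofPlayer (idle j) (E.absorbs j) (P j) (c.partyS j) (c.upT j)
      (c.downT j)).inner = some r from hr] at h₁
    obtain ⟨s, hs, ho, he⟩ := h₁
    rw [Net.toParty_of_some hs]
    have ho' : outerRuns { c with
        active := some (.party j), partyS := Function.update c.partyS j s } j = false := by
      simpa [outerRuns] using ho
    simp only [view, ho']
    rw [splits_setPartyState, he]
    rfl

/-- A strategy is reached from above, and also from below if only a dummy is in between. Together
with `view_toParty_inner` this covers every activation of a player. -/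
theorem view_toParty_outer {j : Fin n} {D : Side} (hj : E.absorbs j = true)
    (h : D = .up ∨ (P j).IsDummy = true) :
    view jm idle (c.toParty j D) =
      match (E.strat j).recv (some D) (splits idle c j).outer.state with
      | some s => assemble jm (.strat j) (some .top) c.topS c.botS
          (Function.update (splits idle c) j ((splits idle c j).setState s))
      | none => assembleWake jm c.topS c.botS (splits idle c) := by
  have h₁ := Split.recv_outer (idle := idle j) (s := c.partyS j) (u := c.upT j) (d := c.downT j)
    hj h
  cases hr : (E.strat j).recv (some D) (splits idle c j).outer.state with
  | none =>
    rw [show (E.strat j).recv (some D) (Split.ofPlayer (idle j) (E.absorbs j) (P j) (c.partyS j)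
      (c.upT j) (c.downT j)).outer.state = none from hr] at h₁
    rw [Net.toParty_of_none h₁, view_wakeTop]
  | some r =>
    rw [show (E.strat j).recv (some D) (Split.ofPlayer (idle j) (E.absorbs j) (P j) (c.partyS j)
      (c.upT j) (c.downT j)).outer.state = some r from hr] at h₁
    obtain ⟨s, hs, ho, he⟩ := h₁
    rw [Net.toParty_of_some hs]
    have ho' : outerRuns { c with
        active := some (.party j), partyS := Function.update c.partyS j s } j = true := by
      simpa [outerRuns] using ho
    simp only [view, ho']
    rw [splits_setPartyState, he]
    rfl

theorem stepWith_view_top (hc : c.active = some .top) (b : Bool) :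
    (view jm idle c).stepWith b = view jm idle (c.stepWith b) := by
  have hv : view jm idle c = assemble jm .rules (some .top) c.topS c.botS (splits idle c) := by
    simp only [view, hc]
  -- The rules read the same contents in both networks: a private tape `link` towards an absorbed
  -- strategy, and a communication tape otherwise.
  have htapes : (fun j => if E.absorbs j then (splits idle c j).link else
      (splits idle c j).port) = c.upT := funext fun j => Split.ofPlayer_topTape
  rw [hv]
  rcases hx : rulesExec b c.topS (splits idle c) with ⟨q, C, sig⟩
  have hx' := hx
  rw [rulesExec, htapes] at hx'
  rw [Net.stepWith_top hc hx']
  cases sig with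
  | run =>
    rw [stepWith_rules_run jm _ _ _ hx]
    simp only [Net.afterTop, view, hc]
    congr 1
    funext j
    exact (Split.ofPlayer_afterTop _).symm
  | send j =>
    obtain rfl := Instr.exec_tapes_of_not_run hx' rfl
    have hd := Split.isDummy_combine (σ := E.strat j) (a := E.absorbs j) (P := P j)
    change (E.players P j).IsDummy = _ at hd
    simp only [Net.afterTop, hd, Sum.elim_comp_inl, Sum.elim_comp_inr]
    cases hj : E.absorbs j with
    | true =>
      rw [stepWith_rules_send_of_absorbs jm _ _ _ hj hx]
      exact (view_toParty_outer jm idle { c with topS := ⟨q, c.topS.mem⟩ } hj (.inl rfl)).symm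
    | false =>
      rw [stepWith_rules_send jm _ _ _ hj hx]
      cases hP : (P j).IsDummy with
      | true => exact (view_toBot jm idle { c with topS := ⟨q, c.topS.mem⟩ } j _).symm
      | false =>
        exact (view_toParty_inner jm idle { c with topS := ⟨q, c.topS.mem⟩ } _ (.inl hj)).symm
  | done =>
    obtain rfl := Instr.exec_tapes_of_not_run hx' rfl
    rw [stepWith_rules_done jm _ _ _ hx]
    rfl

theorem stepWith_view_bot (hc : c.active = some .bot) (b : Bool) :
    (view jm idle c).stepWith b = view jm idle (c.stepWith b) := by
  have hv : view jm idle c = assemble jm .rules (some .bot) c.topS c.botS (splits idle c) := by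
    simp only [view, hc]
  have htapes : (assemble jm .rules (some .bot) c.topS c.botS (splits idle c)).botTapes =
      c.botTapes := funext fun j => Split.ofPlayer_botTape
  rw [hv]
  have h₁ : c.stepWith b = c.afterBot (bot.stepWith b c.botS c.botTapes) := by
    simp only [Net.stepWith, hc]
  have h₂ : (assemble jm .rules (some .bot) c.topS c.botS (splits idle c)).stepWith b =
      (assemble jm .rules (some .bot) c.topS c.botS (splits idle c)).afterBot
        (bot.stepWith b c.botS c.botTapes) := by
    rw [← htapes]; rfl
  rw [h₁, h₂]
  rcases bot.stepWith b c.botS c.botTapes with ⟨l', T', sig⟩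
  let c' : Net E.rules (E.players P) bot := { c with
    botS := l'
    upT := fun i => if (E.players P i).IsDummy then T' i else c.upT i
    downT := fun i => if (E.players P i).IsDummy then c.downT i else T' i }
  have hsplit : splits idle c' = fun j => { splits idle c j with
      port := if (P j).IsDummy then T' j else (splits idle c j).port
      below := if (P j).IsDummy then (splits idle c j).below else T' j } :=
    funext fun j => Split.ofPlayer_afterBot _
  have hA : ({ assemble jm .rules (some .bot) c.topS c.botS (splits idle c) with
      botS := l'
      upT := fun i => if (P i).IsDummy then T' i else (splits idle c i).port
      downT := fun i => if (P i).IsDummy then (splits idle c i).below else T' i } :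
      Net E.machine P bot) = assemble jm .rules (some .bot) c'.topS c'.botS (splits idle c') := by
    rw [hsplit]; rfl
  cases sig with
  | run =>
    have : view jm idle c' = assemble jm .rules (some .bot) c'.topS c'.botS (splits idle c') := by
      have : c'.active = some .bot := hc
      simp only [view, this]
    exact hA.trans this.symm
  | done =>
    exact (congrArg Net.wakeTop hA).trans
      ((wakeTop_assemble ..).trans (view_wakeTop jm idle c').symm)
  | send j =>
    have hd := Split.isDummy_combine (σ := E.strat j) (a := E.absorbs j) (P := P j)
    change (E.players P j).IsDummy = _ at hd
    change (if (P j).IsDummy then Net.toTop j _ else Net.toParty j .down _) =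
      view jm idle (if (E.players P j).IsDummy then c'.toTop j else c'.toParty j .down)
    rw [hd]
    refine (congrArg (fun x : Net E.machine P bot =>
      if (P j).IsDummy then x.toTop j else x.toParty j .down) hA).trans ?_
    -- A message from the bottom goes to the party below the strategy if that party is a machine.
    -- Past a dummy it goes to the rules, or to the strategy if this is absorbed.
    cases hj : E.absorbs j <;> cases hP : (P j).IsDummy
    · exact (view_toParty_inner jm idle c' _ (.inl hj)).symm
    · exact (toTop_assemble _ _ _ _ _ _ hj).trans (view_toTop jm idle c' j).symm
    · exact (view_toParty_inner jm idle c' _ (.inr ⟨rfl, hP⟩)).symm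
    · exact (toTop_assemble_of_absorbs _ _ _ _ _ _ hj).trans
        (view_toParty_outer jm idle c' hj (.inr hP)).symm

theorem stepWith_party_eq {j : Fin n} (hc : c.active = some (.party j)) {b : Bool}
    {x : (E.players P j).State × (Side → List Bool) × Signal Side}
    (h : (Party.combine (E.strat j) (E.absorbs j) (P j)).stepWith b (c.partyS j)
      (Side.tapes (c.upT j) (c.downT j)) = x) : c.stepWith b = c.afterParty j x := by
  subst h
  simp only [Net.stepWith, hc, Net.partyTapes_eq]

/-- The configuration of the game after a step of player `j`. -/
def setParty (j : Fin n) (s : (E.players P j).State) (T : Side → List Bool) :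
    Net E.rules (E.players P) bot :=
  { c with
    partyS := Function.update c.partyS j s
    upT := Function.update c.upT j (T .up)
    downT := Function.update c.downT j (T .down) }

theorem splits_setParty' (j : Fin n) (s : (E.players P j).State) (T : Side → List Bool) :
    splits idle (setParty c j s T) = Function.update (splits idle c) j
      (Split.ofPlayer (idle j) (E.absorbs j) (P j) s (T .up) (T .down)) :=
  splits_setParty idle c j c.active s T

theorem view_setParty {j : Fin n} (hc : c.active = some (.party j)) (s : (E.players P j).State)
    (T : Side → List Bool) : view jm idle (setParty c j s T) =
      if Split.OuterRuns (E.absorbs j) (P j) s then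
        assemble jm (.strat j) (some .top) c.topS c.botS (splits idle (setParty c j s T))
      else assemble jm .rules (some (.party j)) c.topS c.botS (splits idle (setParty c j s T)) := by
  have h₁ : (setParty c j s T).active = some (.party j) := hc
  have h₂ : outerRuns (setParty c j s T) j = Split.OuterRuns (E.absorbs j) (P j) s := by
    simp [outerRuns, setParty]
  simp only [view, h₁, h₂]
  rfl

theorem stepWith_view_strat {j : Fin n} (hc : c.active = some (.party j))
    (ho : outerRuns c j = true) (b : Bool) :
    (view jm idle c).stepWith b = view jm idle (c.stepWith b) := by
  have hv : view jm idle c = assemble jm (.strat j) (some .top) c.topS c.botS (splits idle c) := by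
    simp only [view, hc, ho, if_true]
  have hj : E.absorbs j = true := by
    by_contra hj
    simp only [Bool.not_eq_true] at hj
    unfold outerRuns at ho
    revert ho
    -- The type of this state mentions `E.absorbs j`, so the state is generalized before that
    -- Boolean is rewritten.
    generalize c.partyS j = s
    revert s
    unfold players
    rw [hj]
    intro s ho
    cases ho
  rw [hv]
  rcases hx : (splits idle c j).outerExec b with ⟨q, C, _ | ⟨_ | _⟩ | _⟩
  · rw [stepWith_strat_run jm _ _ _ hx]
    obtain ⟨s, T, hs, ho', he⟩ := Split.step_outer_run ho hx
    rw [stepWith_party_eq c hc hs]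
    refine Eq.trans ?_ (view_setParty jm idle c hc s T).symm
    rw [if_pos ho', splits_setParty', he]
    rfl
  · rw [stepWith_strat_send_up jm _ _ _ hx]
    obtain ⟨s, hs, he⟩ := Split.step_outer_send_up ho hx
    rw [stepWith_party_eq c hc hs]
    refine Eq.trans ?_ (view_toTop jm idle (setParty c j s _) j).symm
    rw [splits_setParty', Side.tapes, Side.tapes, he]
    rfl
  · rw [stepWith_strat_send_down jm _ _ _ hx]
    cases hP : (P j).IsDummy with
    | true =>
      obtain ⟨s, hs, he⟩ := Split.step_outer_send_dummy ho hP hx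
      rw [stepWith_party_eq c hc hs]
      refine Eq.trans ?_ (view_toBot jm idle (setParty c j s _) j (some .top)).symm
      rw [splits_setParty', Side.tapes, Side.tapes, he]
      rfl
    | false =>
      rw [if_neg (by simp), toParty_assemble]
      have h₁ := Split.step_outer_send_machine ho hP hx
      have hi : (Function.update (splits idle c) j ((splits idle c j).setState q) j).inner =
          (splits idle c j).inner := by simp [Split.setState]
      rw [hi]
      cases hr : (P j).recv .up (splits idle c j).inner with
      | none =>
        rw [show (P j).recv .up (Split.ofPlayer (idle j) (E.absorbs j) (P j) (c.partyS j)
          (c.upT j) (c.downT j)).inner = none from hr] at h₁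
        obtain ⟨s, hs, he⟩ := h₁
        rw [stepWith_party_eq c hc hs]
        refine Eq.trans ?_ (view_wakeTop jm idle (setParty c j s _)).symm
        rw [splits_setParty', Side.tapes, Side.tapes, he]
        rfl
      | some r =>
        rw [show (P j).recv .up (Split.ofPlayer (idle j) (E.absorbs j) (P j) (c.partyS j)
          (c.upT j) (c.downT j)).inner = some r from hr] at h₁
        obtain ⟨s, hs, ho', he⟩ := h₁
        rw [stepWith_party_eq c hc hs]
        refine Eq.trans ?_ (view_setParty jm idle c hc s _).symm
        rw [ho', splits_setParty', Side.tapes, Side.tapes, he]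
        simp only [Function.update_self, Function.update_idem]
        rfl
  · rw [stepWith_strat_done jm _ _ _ hx]
    obtain ⟨s, hs, he⟩ := Split.step_outer_done ho hx
    rw [stepWith_party_eq c hc hs]
    refine Eq.trans ?_ (view_wakeTop jm idle (setParty c j s _)).symm
    rw [splits_setParty', Side.tapes, Side.tapes, he]
    rfl

theorem stepWith_view_party {j : Fin n} (hc : c.active = some (.party j))
    (ho : outerRuns c j = false) (b : Bool) :
    (view jm idle c).stepWith b = view jm idle (c.stepWith b) := by
  have hv : view jm idle c =
      assemble jm .rules (some (.party j)) c.topS c.botS (splits idle c) := by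
    simp [view, hc, ho]
  rw [hv]
  rcases hx : (splits idle c j).innerStep b with ⟨p, T, sig⟩
  rw [stepWith_party jm _ _ _ hx]
  -- The only signal of the inner party that the player does not pass on is the one sent up to its
  -- own absorbed strategy.
  by_cases hsig : E.absorbs j = false ∨ sig ≠ .send .up
  · obtain ⟨s, T', hs, ho', he⟩ := Split.step_inner ho hx hsig
    rw [stepWith_party_eq c hc hs]
    have hsp : splits idle (setParty c j s T') =
        Function.update (splits idle c) j ((splits idle c j).setInner p T) := by
      rw [splits_setParty', he]; rfl
    rcases sig with _ | ⟨_ | _⟩ | _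
    · refine Eq.trans ?_ (view_setParty jm idle c hc s T').symm
      rw [ho', hsp]
      rfl
    · refine Eq.trans ?_ (view_toTop jm idle (setParty c j s T') j).symm
      rw [hsp]
      exact toTop_assemble _ _ _ _ _ _ (by simpa using hsig)
    · refine Eq.trans ?_ (view_toBot jm idle (setParty c j s T') j (some (.party j))).symm
      rw [hsp]
      rfl
    · refine Eq.trans ?_ (view_wakeTop jm idle (setParty c j s T')).symm
      rw [hsp]
      exact wakeTop_assemble ..
  · simp only [not_or, Bool.not_eq_false, not_not] at hsig
    obtain ⟨hj, rfl⟩ := hsig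
    have h₁ := Split.step_inner_send_up hj ho hx
    refine (toTop_assemble_of_absorbs _ _ _ _ _ _ hj).trans ?_
    have hst : (Function.update (splits idle c) j
        ((splits idle c j).setInner p T) j).outer.state = (splits idle c j).outer.state := by
      simp [Split.setInner]
    rw [hst]
    cases hr : (E.strat j).recv (some .down) (splits idle c j).outer.state with
    | none =>
      rw [show (E.strat j).recv (some .down) (Split.ofPlayer (idle j) (E.absorbs j) (P j)
        (c.partyS j) (c.upT j) (c.downT j)).outer.state = none from hr] at h₁
      obtain ⟨s, T', hs, he⟩ := h₁
      rw [stepWith_party_eq c hc hs]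
      refine Eq.trans ?_ (view_wakeTop jm idle (setParty c j s T')).symm
      rw [splits_setParty', he]
      rfl
    | some q =>
      rw [show (E.strat j).recv (some .down) (Split.ofPlayer (idle j) (E.absorbs j) (P j)
        (c.partyS j) (c.upT j) (c.downT j)).outer.state = some q from hr] at h₁
      obtain ⟨s, T', hs, ho', he⟩ := h₁
      rw [stepWith_party_eq c hc hs]
      refine Eq.trans ?_ (view_setParty jm idle c hc s T').symm
      rw [if_pos ho', splits_setParty', he]
      simp only [Function.update_self, Function.update_idem]
      rfl

/-- As long as the game is not over, the network of the tester makes the same steps. -/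
theorem stepWith_view (hc : c.active ≠ none) (b : Bool) :
    (view jm idle c).stepWith b = view jm idle (c.stepWith b) := by
  rcases h : c.active with _ | _ | j | _
  · exact absurd h hc
  · exact stepWith_view_top jm idle c h b
  · cases ho : outerRuns c j with
    | true => exact stepWith_view_strat jm idle c h ho b
    | false => exact stepWith_view_party jm idle c h ho b
  · exact stepWith_view_bot jm idle c h b

end Tester
end PseudoNash

namespace PseudoNash

/-! ## Termination of networks -/

namespace Party

/-- The analogue of `ITM.At` for a party. -/
def At (κ : ℕ) : (p : Party) → ℕ → Bool → p.State → (Side → List Bool) → Prop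
  -- A dummy ignores all activations, so it never becomes active and never makes a step.
  | dummy, t, a, _, _ => t = 0 ∧ a = false
  | machine M, t, a, s, T => M.At (M.initMem κ) t a s T

/-- Dummies and PPT machines. -/
def IsPPT : Party → Prop
  | dummy => True
  | machine M => M.IsPPT

variable {κ : ℕ} {p : Party} {t : ℕ} {a : Bool} {s : p.State} {T : Side → List Bool}

theorem At.init (κ : ℕ) (p : Party) (T : Side → List Bool) : p.At κ 0 false (p.init κ) T := by
  cases p with
  | dummy => exact ⟨rfl, rfl⟩
  | machine M => exact ITM.At.init T

theorem At.idle (h : p.At κ t false s T) (T' : Side → List Bool) : p.At κ t false s T' := by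
  cases p with
  | dummy => exact h
  | machine M => exact ITM.At.idle h T'

theorem At.activate (h : p.At κ t false s T) {D : Side} {s' : p.State} (hr : p.recv D s = some s')
    (T' : Side → List Bool) : p.At κ t true s' T' := by
  cases p with
  | dummy => cases hr
  | machine M =>
    obtain ⟨q, hq, rfl⟩ := Option.map_eq_some_iff.1 hr
    exact ITM.At.activate h hq T'

theorem At.step (h : p.At κ t true s T) {b : Bool} {s' : p.State} {T' : Side → List Bool}
    {sig : Signal Side} (he : p.stepWith b s T = (s', T', sig)) :
    p.At κ (t + 1) sig.isRun s' T' := by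
  cases p with
  | dummy => cases h.2
  | machine M =>
    cases he
    exact ITM.At.step h rfl

theorem IsPPT.exists_bound (h : p.IsPPT) (κ : ℕ) : ∃ B, ∀ t a s T, p.At κ t a s T → t ≤ B := by
  cases p with
  | dummy => exact ⟨0, fun t a s T h => h.1.le⟩
  | machine M =>
    obtain ⟨q, hq⟩ := ITM.IsPPT.exists_bound h
    exact ⟨q.eval κ, hq κ⟩

end Party

namespace Node

variable {n : ℕ}

def onTop : Option (Node n) → Bool
  | some .top => true
  | _ => false

def onParty (j : Fin n) : Option (Node n) → Bool
  | some (.party i) => decide (j = i)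
  | _ => false

def onBot : Option (Node n) → Bool
  | some .bot => true
  | _ => false

end Node

namespace Net

variable {n : ℕ} {top : ITM (Fin n)} {parties : Fin n → Party} {bot : ITM (Fin n)}
  (mem : top.K → List Bool) (κ : ℕ)

/-- The machines of the network have made `t` steps altogether, and `x` is active. -/
def AllAt (x : Option (Node n)) (c : Net top parties bot) (t : ℕ) : Prop :=
  ∃ (t₀ : ℕ) (t' : Fin n → ℕ) (t₁ : ℕ), t = t₀ + ∑ j, t' j + t₁ ∧
    top.At mem t₀ (Node.onTop x) c.topS c.upT ∧
    (∀ j, (parties j).At κ (t' j) (Node.onParty j x) (c.partyS j) (c.partyTapes j)) ∧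
    bot.At (bot.initMem κ) t₁ (Node.onBot x) c.botS c.botTapes

variable {mem κ} {c : Net top parties bot} {t : ℕ}

/-- The active node of `AllAt` is independent of `c.active`. The value `none` stands for the moment
between two activations, when the field in `c` may still hold the previous node. -/
theorem AllAt.wakeTop (h : AllAt mem κ none c t) : AllAt mem κ c.wakeTop.active c.wakeTop t := by
  obtain ⟨t₀, t', t₁, rfl, h₀, h', h₁⟩ := h
  cases hr : top.recv none c.topS.state with
  | none =>
    rw [wakeTop_of_none hr]
    exact ⟨t₀, t', t₁, rfl, h₀, h', h₁⟩
  | some q =>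
    rw [wakeTop_of_some hr]
    exact ⟨t₀, t', t₁, rfl, h₀.activate hr _, h', h₁⟩

theorem AllAt.toTop (h : AllAt mem κ none c t) (j : Fin n) :
    AllAt mem κ (c.toTop j).active (c.toTop j) t := by
  cases hr : top.recv (some j) c.topS.state with
  | none =>
    rw [toTop_of_none hr]
    exact h.wakeTop
  | some q =>
    obtain ⟨t₀, t', t₁, rfl, h₀, h', h₁⟩ := h
    rw [toTop_of_some hr]
    exact ⟨t₀, t', t₁, rfl, h₀.activate hr _, h', h₁⟩

theorem AllAt.toBot (h : AllAt mem κ none c t) (j : Fin n) :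
    AllAt mem κ (c.toBot j).active (c.toBot j) t := by
  cases hr : bot.recv (some j) c.botS.state with
  | none =>
    rw [toBot_of_none hr]
    exact h.wakeTop
  | some q =>
    obtain ⟨t₀, t', t₁, rfl, h₀, h', h₁⟩ := h
    rw [toBot_of_some hr]
    exact ⟨t₀, t', t₁, rfl, h₀, h', h₁.activate hr _⟩

theorem AllAt.toParty (h : AllAt mem κ none c t) (j : Fin n) (D : Side) :
    AllAt mem κ (c.toParty j D).active (c.toParty j D) t := by
  cases hr : (parties j).recv D (c.partyS j) with
  | none =>
    rw [toParty_of_none hr]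
    exact h.wakeTop
  | some s =>
    obtain ⟨t₀, t', t₁, rfl, h₀, h', h₁⟩ := h
    rw [toParty_of_some hr]
    refine ⟨t₀, t', t₁, rfl, h₀, fun i => ?_, h₁⟩
    by_cases hi : i = j
    · subst hi
      simpa [Node.onParty] using (h' i).activate hr _
    · simp only [Node.onParty, hi, decide_false, ne_eq, not_false_eq_true, Function.update_of_ne]
      exact h' i

/-- Exactly one machine is active, and the step is charged to it; all others are idle, so they
tolerate any change of their communication tapes. -/
theorem AllAt.stepWith (h : AllAt mem κ c.active c t) (hc : c.active ≠ none) (b : Bool) :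
    AllAt mem κ (c.stepWith b).active (c.stepWith b) (t + 1) := by
  obtain ⟨t₀, t', t₁, rfl, h₀, h', h₁⟩ := h
  rcases hx : c.active with _ | _ | j | _
  · exact absurd hx hc
  · rw [hx] at h₀ h' h₁
    rcases he : (top.code c.topS.state).exec b (Sum.elim c.topS.mem c.upT) with ⟨q, C, sig⟩
    rw [stepWith_top hx he]
    have hs := ITM.At.step h₀ he
    have hA : ∀ a, AllAt mem κ (if sig.isRun then some .top else none)
        { c with active := a, topS := ⟨q, C ∘ Sum.inl⟩, upT := C ∘ Sum.inr }
        (t₀ + ∑ j, t' j + t₁ + 1) := fun a =>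
      ⟨t₀ + 1, t', t₁, by omega, by cases sig <;> exact hs,
        fun j => by cases sig <;> exact (h' j).idle _, by cases sig <;> exact h₁.idle _⟩
    cases sig with
    | run => simpa only [afterTop, hx, Signal.isRun, if_true] using hA c.active
    | done => exact hA none
    | send j =>
      simp only [afterTop]
      split
      · exact AllAt.toBot (hA c.active) j
      · exact AllAt.toParty (hA c.active) j .up
  · rw [hx] at h₀ h' h₁
    rcases he : (parties j).stepWith b (c.partyS j) (c.partyTapes j) with ⟨s, T, sig⟩
    have hst : c.stepWith b = c.afterParty j (s, T, sig) := by
      simp only [Net.stepWith, hx, he]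
    rw [hst]
    have hj := h' j
    rw [show Node.onParty j (some (.party j)) = true from decide_eq_true rfl] at hj
    have hs := hj.step he
    have hA : AllAt mem κ (if sig.isRun then some (.party j) else none)
        { c with
          partyS := Function.update c.partyS j s
          upT := Function.update c.upT j (T .up)
          downT := Function.update c.downT j (T .down) }
        (t₀ + ∑ j, t' j + t₁ + 1) := by
      refine ⟨t₀, Function.update t' j (t' j + 1), t₁, ?_, by cases sig <;> exact h₀.idle _,
        fun i => ?_, by cases sig <;> exact h₁.idle _⟩
      · rw [Finset.sum_update_of_mem (Finset.mem_univ j),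
          ← Finset.add_sum_erase _ _ (Finset.mem_univ j), Finset.sdiff_singleton_eq_erase]
        omega
      · rw [partyTapes_eq]
        by_cases hi : i = j
        · subst hi
          simp only [Function.update_self, Side.tapes_eta]
          cases sig
          · change (parties i).At κ (t' i + 1) (decide (i = i)) s T
            rw [decide_eq_true rfl]
            exact hs
          · exact hs
          · exact hs
        · have h'' := h' i
          rw [show Node.onParty i (some (.party j)) = false from decide_eq_false hi] at h''
          simp only [Function.update_of_ne hi]
          cases sig
          · change (parties i).At κ (t' i) (decide (i = j)) _ _
            rw [decide_eq_false hi]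
            exact h''.idle _
          · exact h''.idle _
          · exact h''.idle _
    rcases sig with _ | ⟨_ | _⟩ | _
    · simpa only [afterParty, hx, Signal.isRun, if_true] using hA
    · exact AllAt.toTop hA j
    · exact AllAt.toBot hA j
    · exact AllAt.wakeTop hA
  · rw [hx] at h₀ h' h₁
    rcases he : (bot.code c.botS.state).exec b (Sum.elim c.botS.mem c.botTapes) with ⟨q, C, sig⟩
    have hst : c.stepWith b = c.afterBot (⟨q, C ∘ Sum.inl⟩, C ∘ Sum.inr, sig) := by
      simp only [Net.stepWith, hx, bot.stepWith_of_exec he]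
    rw [hst]
    have hs := ITM.At.step h₁ he
    have hA : AllAt mem κ (if sig.isRun then some .bot else none)
        { c with
          botS := ⟨q, C ∘ Sum.inl⟩
          upT := fun i => if (parties i).IsDummy then (C ∘ Sum.inr) i else c.upT i
          downT := fun i => if (parties i).IsDummy then c.downT i else (C ∘ Sum.inr) i }
        (t₀ + ∑ j, t' j + t₁ + 1) := by
      refine ⟨t₀, t', t₁ + 1, by omega, by cases sig <;> exact h₀.idle _,
        fun j => by cases sig <;> exact (h' j).idle _, ?_⟩
      convert hs using 1
      · cases sig <;> rfl
      · funext i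
        by_cases hi : (parties i).IsDummy <;> simp [botTapes, hi]
    cases sig with
    | run => simpa only [afterBot, hx, Signal.isRun, if_true] using hA
    | done => exact AllAt.wakeTop hA
    | send j =>
      simp only [afterBot]
      split
      · exact AllAt.toTop hA j
      · exact AllAt.toParty hA j .down

end Net

/-! ### Termination and output of executions. -/

section Execution

variable {n : ℕ} {top : ITM (Fin n)} {mem : top.K → List Bool} {parties : Fin n → Party}
  {bot : ITM (Fin n)} {κ : ℕ}

theorem netAfter_succ (t : ℕ) : netAfter top mem parties bot κ (t + 1) =
    (netAfter top mem parties bot κ t).bind fun c =>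
      (PMF.uniformOfFintype Bool).map fun b => c.stepWith b := by
  simp only [netAfter]
  congr 1
  funext c
  exact c.step_eq_map

/-- After its end the execution stands still, so the machines account for the full time `t` only
while one of them is active. -/
theorem allAt_of_mem_support {t : ℕ} : ∀ c ∈ (netAfter top mem parties bot κ t).support,
    ∃ t', (c.active ≠ none → t' = t) ∧ Net.AllAt mem κ c.active c t' := by
  induction t with
  | zero =>
    intro c hc
    simp only [netAfter, PMF.support_pure, Set.mem_singleton_iff] at hc
    subst hc
    exact ⟨0, fun _ => rfl, Net.AllAt.wakeTop ⟨0, fun _ => 0, 0, by simp, .init _,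
      fun j => .init _ _ _, .init _⟩⟩
  | succ t ih =>
    intro c hc
    rw [netAfter_succ, PMF.mem_support_bind_iff] at hc
    obtain ⟨c₀, hc₀, hc⟩ := hc
    rw [PMF.mem_support_map_iff] at hc
    obtain ⟨b, -, rfl⟩ := hc
    obtain ⟨t', ht', h⟩ := ih c₀ hc₀
    by_cases ha : c₀.active = none
    · have : c₀.stepWith b = c₀ := by simp only [Net.stepWith, ha]
      rw [this]
      exact ⟨t', fun h => absurd ha h, h⟩
    · obtain rfl := ht' ha
      exact ⟨t' + 1, fun _ => rfl, h.stepWith ha b⟩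

/-- The execution of a network of PPT machines terminates. -/
theorem exists_forall_active_eq_none (htop : ∃ B, ∀ t a l T, top.At mem t a l T → t ≤ B)
    (hparties : ∀ j, (parties j).IsPPT) (hbot : bot.IsPPT) :
    ∃ B, ∀ t ≥ B, ∀ c ∈ (netAfter top mem parties bot κ t).support, c.active = none := by
  obtain ⟨B₀, hB₀⟩ := htop
  choose B' hB' using fun j => (hparties j).exists_bound κ
  obtain ⟨p, hp⟩ := hbot.exists_bound
  -- One more than the number of steps that all machines together can make.
  refine ⟨B₀ + ∑ j, B' j + p.eval κ + 1, fun t ht c hc => ?_⟩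
  by_contra ha
  obtain ⟨_, ht', t₀, t', t₁, rfl, h₀, h', h₁⟩ := allAt_of_mem_support c hc
  have e := ht' ha
  have := hB₀ _ _ _ _ h₀
  have := hp _ _ _ _ _ h₁
  have : ∑ j, t' j ≤ ∑ j, B' j := Finset.sum_le_sum fun j _ => hB' j _ _ _ _ (h' j)
  omega

theorem netAfter_add_of_active_eq_none {t : ℕ}
    (h : ∀ c ∈ (netAfter top mem parties bot κ t).support, c.active = none) (s : ℕ) :
    netAfter top mem parties bot κ (t + s) = netAfter top mem parties bot κ t := by
  induction s with
  | zero => rfl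
  | succ s ih =>
    rw [← add_assoc, netAfter, ih]
    conv_rhs => rw [← PMF.bind_pure (netAfter top mem parties bot κ t)]
    ext x
    simp only [PMF.bind_apply]
    refine tsum_congr fun c => ?_
    by_cases hc : c ∈ (netAfter top mem parties bot κ t).support
    · simp only [Net.step, h c hc]
    · rw [PMF.mem_support_iff, not_not] at hc
      rw [hc, zero_mul, zero_mul]

/-- Any sufficiently late time yields the output. Thus a game and its tester can be compared at a
common time, although their running times differ. -/
theorem outputLaw_eq {t : ℕ}
    (h : ∀ c ∈ (netAfter top mem parties bot κ t).support, c.active = none) :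
    outputLaw top mem parties bot κ =
      (netAfter top mem parties bot κ t).map fun c => c.topS.mem top.out := by
  have h₁ : runtime top mem parties bot κ ∈
    {t | ∀ c ∈ (netAfter top mem parties bot κ t).support, c.active = none} := Nat.sInf_mem ⟨t, h⟩
  have h₂ : runtime top mem parties bot κ ≤ t := Nat.sInf_le h
  obtain ⟨s, rfl⟩ := Nat.exists_eq_add_of_le h₂
  rw [outputLaw, netAfter_add_of_active_eq_none h₁]

/-- The output is not longer than `1^κ` and the number of steps of the top machine. -/
theorem length_le_of_mem_support_outputLaw {B : ℕ} (htop : ∀ t a l T, top.At mem t a l T → t ≤ B) :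
    ∀ w ∈ (outputLaw top mem parties bot κ).support, w.length ≤ (mem top.out).length + B := by
  intro w hw
  rw [outputLaw, PMF.mem_support_map_iff] at hw
  obtain ⟨c, hc, rfl⟩ := hw
  obtain ⟨_, -, _, _, _, -, h₀, -⟩ := allAt_of_mem_support c hc
  exact (h₀.length_le _).trans (Nat.add_le_add_left (htop _ _ _ _ h₀) _)

end Execution
end PseudoNash

namespace PseudoNash
namespace Tester

variable {n : ℕ} {E : Tester n} {P : Fin n → Party} {bot : ITM (Fin n)}
  {jm : E.judge.K → List Bool} {idle : ∀ j, (E.strat j).Local}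

/-! ## The verdict of the judge -/

/-- The judge is running on the outcome `w`, or it has finished. -/
inductive Judging (jm : E.judge.K → List Bool) (w : List Bool) :
    Net E.machine P bot → Prop
  | run {d : Net E.machine P bot} {m : E.judge.Q} {q : E.rules.Q} {r : ∀ j, (E.strat j).Q}
      {mem : E.K → List Bool} {t : ℕ} (hd : d.active = some .top)
      (hs : d.topS = ⟨(.judge m, q, r), mem⟩)
      (h : E.judge.At (Function.update jm E.right w) t true
        ⟨m, fun k => mem (E.judgeK k)⟩ Empty.elim) : Judging jm w d
  | halted {d : Net E.machine P bot} {m : E.judge.Q} {t : ℕ} (hd : d.active = none) (ht : 0 < t)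
      (h : E.judge.At (Function.update jm E.right w) t false
        ⟨m, fun k => d.topS.mem (E.judgeK k)⟩ Empty.elim) : Judging jm w d

/-- By the sharing of tapes the judge finds the outcome on its tape `right` without any further
step. -/
theorem judging_view (hJ : E.judge.recv none E.judge.start = some E.judgeStart)
    {c : Net E.rules (E.players P) bot} (hc : c.active = none) :
    Judging jm (c.topS.mem E.rules.out) (view jm idle c) := by
  have hv : view jm idle c =
      assemble jm (.judge E.judgeStart) (some .top) c.topS c.botS (splits idle c) := by
    simp only [view, hc]
  rw [hv]
  refine .run (t := 0) rfl rfl ?_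
  have e : (fun k => (assemble jm (.judge E.judgeStart) (some .top) c.topS c.botS
      (splits idle c)).topS.mem (E.judgeK k)) =
      Function.update jm E.right (c.topS.mem E.rules.out) := by
    refine (mem_judgeK _).trans (funext fun k => ?_)
    unfold judgeMem
    by_cases hk : k = E.right
    · subst hk; simp [assemble]
    · simp [hk, assemble]
  exact e ▸ (ITM.At.init Empty.elim).activate hJ _

theorem Judging.stepWith {w : List Bool} {d : Net E.machine P bot} (h : Judging jm w d)
    (b : Bool) : Judging jm w (d.stepWith b) := by
  cases h with
  | halted hd ht h =>
    rw [show d.stepWith b = d by simp only [Net.stepWith, hd]]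
    exact .halted hd ht h
  | @run m q r mem t hd hs h =>
    rcases hm : (E.judge.code m).exec b (Sum.elim (fun k => mem (E.judgeK k)) Empty.elim)
      with ⟨m', C, _ | ⟨⟨⟩⟩ | _⟩
    · have hx := exec_judge_run (q := q) (r := r) (T := d.upT) hm
      rw [Net.stepWith_top hd (q := (.judge m', q, r)) (sig := .run)
        (C := Function.extend E.judgeTape C (Sum.elim mem d.upT)) (by rw [hs]; exact hx)]
      have h₁ := h.step hm
      rw [show C ∘ Sum.inr = Empty.elim from funext fun e => e.elim] at h₁
      refine .run (t := t + 1) hd rfl ?_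
      convert h₁ using 2
      · rfl
      · funext k
        exact extend_judgeTape _ C k
    · have hx := code_judge_done (q := q) (r := r) hm
      rw [Net.stepWith_top hd (C := Sum.elim mem d.upT) (q := (.judge m', q, r)) (sig := .done)
        (by rw [hs, hx]; rfl)]
      -- A positive number of steps is recorded because the promise of the decider excludes the idle
      -- configuration before its first step.
      exact .halted (t := t + 1) rfl t.succ_pos (h.halt hm rfl _)

/-- Corresponding configurations of the game and of the network of the tester. -/
def Coupled (jm : E.judge.K → List Bool) (idle : ∀ j, (E.strat j).Local)
    (c : Net E.rules (E.players P) bot) (d : Net E.machine P bot) : Prop :=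
  c.active ≠ none ∧ d = view jm idle c ∨
    c.active = none ∧ Judging jm (c.topS.mem E.rules.out) d

theorem coupled_view (hJ : E.judge.recv none E.judge.start = some E.judgeStart)
    (c : Net E.rules (E.players P) bot) : Coupled jm idle c (view jm idle c) := by
  by_cases hc : c.active = none
  · exact .inr ⟨hc, judging_view hJ hc⟩
  · exact .inl ⟨hc, rfl⟩

theorem Coupled.stepWith (hJ : E.judge.recv none E.judge.start = some E.judgeStart)
    {c : Net E.rules (E.players P) bot} {d : Net E.machine P bot} (h : Coupled jm idle c d)
    (b : Bool) : Coupled jm idle (c.stepWith b) (d.stepWith b) := by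
  obtain ⟨hc, rfl⟩ | ⟨hc, h⟩ := h
  · rw [stepWith_view _ _ _ hc]
    exact coupled_view hJ _
  · rw [show c.stepWith b = c by simp only [Net.stepWith, hc]]
    exact .inr ⟨hc, h.stepWith b⟩

variable (E P bot) in
/-- The initial configuration of the tester corresponds to the one of the game. -/
theorem initNet_eq_view {left : E.judge.K} (hl : left ≠ E.right) (κ : ℕ) (x : List Bool) :
    initNet E.machine (Function.update (E.machine.initMem κ) (.judge left hl) x) P bot κ =
      view (Function.update (E.judge.initMem κ) left x)
        (fun j => ⟨(E.strat j).start, (E.strat j).initMem κ⟩)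
        (initNet E.rules (E.rules.initMem κ) (E.players P) bot κ) := by
  refine Eq.trans ?_ (view_wakeTop _ _ _).symm
  rw [← wakeTop_assemble _ none]
  refine congrArg Net.wakeTop ?_
  have hsp : splits (fun j => ⟨(E.strat j).start, (E.strat j).initMem κ⟩)
      { active := none
        topS := ⟨E.rules.start, E.rules.initMem κ⟩
        partyS := fun i => (E.players P i).init κ
        botS := ⟨bot.start, bot.initMem κ⟩
        upT := fun _ => []
        downT := fun _ => [] } = fun j =>
      (⟨⟨(E.strat j).start, (E.strat j).initMem κ⟩, [], (P j).init κ, [], []⟩ :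
        Split (E.strat j) (P j)) := by
    funext j
    have : ∀ a p, Split.ofPlayer ⟨(E.strat j).start, (E.strat j).initMem κ⟩ a p
        ((Party.combine (E.strat j) a p).init κ) [] [] =
        ⟨⟨(E.strat j).start, (E.strat j).initMem κ⟩, [], p.init κ, [], []⟩ := by
      intro a p
      cases a <;> cases p <;> rfl
    exact this _ _
  rw [hsp]
  simp only [assemble, Net.mk.injEq, true_and, and_true, ITM.Local.mk.injEq]
  funext k
  rcases k with k | ⟨i, k⟩ | i | ⟨k, hk⟩
  · exact Function.update_of_ne (by rintro ⟨⟩) _ _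
  · exact Function.update_of_ne (by rintro ⟨⟩) _ _
  · exact Function.update_of_ne (by rintro ⟨⟩) _ _
  · by_cases h : k = left
    · subst h; simp
    · simp only [Function.update_of_ne h]
      refine Function.update_of_ne ?_ _ _
      rintro ⟨⟩
      exact h rfl

/-- Both networks use the same coin in each step. Since a step is a deterministic function of the
coin, the correspondence at the start persists. -/
theorem exists_coupling (hJ : E.judge.recv none E.judge.start = some E.judgeStart)
    {left : E.judge.K} (hl : left ≠ E.right) (κ : ℕ) (x : List Bool) (t : ℕ) :
    ∃ μ : PMF (Net E.rules (E.players P) bot × Net E.machine P bot),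
      μ.map Prod.fst = netAfter E.rules (E.rules.initMem κ) (E.players P) bot κ t ∧
      μ.map Prod.snd = netAfter E.machine
        (Function.update (E.machine.initMem κ) (.judge left hl) x) P bot κ t ∧
      ∀ p ∈ μ.support, Coupled (Function.update (E.judge.initMem κ) left x)
        (fun j => ⟨(E.strat j).start, (E.strat j).initMem κ⟩) p.1 p.2 := by
  induction t with
  | zero =>
    refine ⟨PMF.pure (_, _), PMF.pure_map _ _, PMF.pure_map _ _, fun p hp => ?_⟩
    obtain rfl := (PMF.mem_support_pure_iff _ _).1 hp
    change Coupled _ _ (initNet E.rules _ (E.players P) bot κ) (initNet E.machine _ P bot κ)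
    rw [initNet_eq_view]
    exact coupled_view hJ _
  | succ t ih =>
    obtain ⟨μ, h₁, h₂, h₃⟩ := ih
    refine ⟨μ.bind fun p => (PMF.uniformOfFintype Bool).map fun b =>
      (p.1.stepWith b, p.2.stepWith b), ?_, ?_, fun p hp => ?_⟩
    · rw [netAfter_succ, ← h₁, PMF.map_bind, PMF.bind_map]
      simp only [PMF.map_comp, Function.comp_def]
    · rw [netAfter_succ, ← h₂, PMF.map_bind, PMF.bind_map]
      simp only [PMF.map_comp, Function.comp_def]
    · obtain ⟨p₀, hp₀, hp⟩ := (PMF.mem_support_bind_iff _ _ _).1 hp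
      obtain ⟨b, -, rfl⟩ := (PMF.mem_support_map_iff _ _ _).1 hp
      exact (h₃ p₀ hp₀).stepWith hJ b

/-- The tester accepts with the probability that the judge accepts the outcome of the game. -/
theorem outputLaw_accepts (hJ : E.judge.recv none E.judge.start = some E.judgeStart)
    {left : E.judge.K} (hl : left ≠ E.right) (κ : ℕ) (x : List Bool)
    (hE : ∃ B, ∀ t a l T, E.machine.At
      (Function.update (E.machine.initMem κ) (.judge left hl) x) t a l T → t ≤ B)
    (hrules : E.rules.IsPPT) (hP : ∀ j, (P j).IsPPT) (hplayers : ∀ j, (E.players P j).IsPPT)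
    (hbot : bot.IsPPT) {R : List Bool → Prop}
    (hR : ∀ w t l T, E.judge.Trace
      (Function.update (Function.update (E.judge.initMem κ) left x) E.right w) t false l T →
        0 < t → (Accepts (l.mem E.judge.out) ↔ R w)) :
    (outputLaw E.machine (Function.update (E.machine.initMem κ) (.judge left hl) x) P bot
      κ).toOuterMeasure {w | Accepts w} =
    (outputLaw E.rules (E.rules.initMem κ) (E.players P) bot κ).toOuterMeasure {w | R w} := by
  obtain ⟨p, hp⟩ := hrules.exists_bound
  obtain ⟨B₁, h₁⟩ := exists_forall_active_eq_none (parties := E.players P) ⟨p.eval κ, hp κ⟩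
    hplayers hbot
  obtain ⟨B₂, h₂⟩ := exists_forall_active_eq_none hE hP hbot
  -- At this common time both executions are over, so under the coupling the judge has halted on the
  -- outcome of the coupled game.
  have h₁ := h₁ (max B₁ B₂) (le_max_left _ _)
  have h₂ := h₂ (max B₁ B₂) (le_max_right _ _)
  rw [outputLaw_eq h₁, outputLaw_eq h₂]
  obtain ⟨μ, e₁, e₂, hμ⟩ := exists_coupling (P := P) (bot := bot) hJ hl κ x (max B₁ B₂)
  rw [← e₁] at h₁ ⊢
  rw [← e₂] at h₂ ⊢
  simp only [PMF.toOuterMeasure_map_apply]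
  refine PMF.toOuterMeasure_apply_eq_of_inter_support_eq _ ?_
  ext ⟨c, d⟩
  simp only [Set.mem_inter_iff, Set.mem_preimage, Set.mem_ofPred_eq, and_congr_left_iff]
  intro hcd
  have hc : c.active = none := h₁ c ((PMF.mem_support_map_iff _ _ _).2 ⟨(c, d), hcd, rfl⟩)
  have hd : d.active = none := h₂ d ((PMF.mem_support_map_iff _ _ _).2 ⟨(c, d), hcd, rfl⟩)
  obtain ⟨h, -⟩ | ⟨-, h⟩ := hμ _ hcd
  · exact absurd hc h
  · cases h with
    | run hd' => simp [hd] at hd'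
    | halted _ ht h =>
      obtain ⟨T, h, -⟩ := h
      exact hR _ _ _ _ h ht

end Tester
end PseudoNash

namespace PseudoNash

open MeasureTheory

/-! ## Empirical means of close distributions -/

section Means

/-- The probabilities of all upper sets differ by at most `δ`. -/
def UpperClose (δ : ℝ) (μ ν : Measure ℝ) : Prop :=
  ∀ U : Set ℝ, IsUpperSet U → |μ.real U - ν.real U| ≤ δ

theorem measureReal_prod_eq_integral {μ ν : Measure ℝ} [IsProbabilityMeasure ν]
    {s : Set (ℝ × ℝ)} (hs : MeasurableSet s) :
    (μ.prod ν).real s = ∫ x, ν.real (Prod.mk x ⁻¹' s) ∂μ := by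
  rw [measureReal_def, Measure.prod_apply hs, integral_eq_lintegral_of_nonneg_ae]
  · congr 1
    refine lintegral_congr fun x => ?_
    simp [measureReal_def]
  · exact Filter.Eventually.of_forall fun x => measureReal_nonneg
  · exact (measurable_measure_prodMk_left hs).ennreal_toReal.aestronglyMeasurable

variable {μ μ' ν ν' ρ : Measure ℝ} [IsProbabilityMeasure μ] [IsProbabilityMeasure μ']
  [IsProbabilityMeasure ν] [IsProbabilityMeasure ν'] [IsProbabilityMeasure ρ] {δ ε : ℝ}

theorem _root_.IsUpperSet.measurableSet_real {U : Set ℝ} (hU : IsUpperSet U) : MeasurableSet U :=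
  hU.ordConnected.measurableSet

/-- Fubini: sets all of whose sections have close measures have close measures. -/
theorem abs_measureReal_prod_sub_le {s : Set (ℝ × ℝ)} (hs : MeasurableSet s)
    (h : ∀ x, |ν.real (Prod.mk x ⁻¹' s) - ν'.real (Prod.mk x ⁻¹' s)| ≤ δ) :
    |(μ.prod ν).real s - (μ.prod ν').real s| ≤ δ := by
  have hi : ∀ ρ : Measure ℝ, IsProbabilityMeasure ρ →
      Integrable (fun x => ρ.real (Prod.mk x ⁻¹' s)) μ := fun ρ _ =>
    Integrable.of_bound
      (measurable_measure_prodMk_left hs).ennreal_toReal.aestronglyMeasurable 1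
      (Filter.Eventually.of_forall fun x => by
        rw [Real.norm_eq_abs, abs_of_nonneg measureReal_nonneg]
        exact measureReal_le_one)
  rw [measureReal_prod_eq_integral hs, measureReal_prod_eq_integral hs,
    ← integral_sub (hi ν inferInstance) (hi ν' inferInstance)]
  refine (abs_integral_le_integral_abs).trans ?_
  refine (integral_mono ((hi ν inferInstance).sub (hi ν' inferInstance)).abs
    (integrable_const δ) h).trans ?_
  simp

/-- The sections of `{(x, y) | x + y ∈ U}` are translates of `U`, hence upper sets again. -/
theorem UpperClose.conv_left (h : UpperClose δ ν ν') : UpperClose δ (μ ∗ ν) (μ ∗ ν') := by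
  intro U hU
  have hm := measurable_add (M := ℝ) hU.measurableSet_real
  have e : ∀ ρ : Measure ℝ, (μ ∗ ρ).real U =
      (μ.prod ρ).real ((fun p : ℝ × ℝ => p.1 + p.2) ⁻¹' U) := fun ρ => by
    rw [measureReal_def, Measure.conv, Measure.map_apply measurable_add hU.measurableSet_real]
    rfl
  rw [e, e]
  exact abs_measureReal_prod_sub_le hm fun x => h _ fun a b hab ha =>
    hU (by simpa using hab) ha

theorem UpperClose.conv (h₁ : UpperClose δ μ μ') (h₂ : UpperClose ε ν ν') :
    UpperClose (δ + ε) (μ ∗ ν) (μ' ∗ ν') := by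
  intro U hU
  have e₁ := h₁.conv_left (μ := ν) U hU
  have e₂ := h₂.conv_left (μ := μ') U hU
  rw [Measure.conv_comm, Measure.conv_comm ν μ'] at e₁
  calc _ ≤ _ := abs_sub_le _ ((μ' ∗ ν).real U) _
    _ ≤ _ := add_le_add e₁ e₂

/-- The law of the sum of `m` independent samples. -/
noncomputable def sumLaw (m : ℕ) (μ : Measure ℝ) : Measure ℝ :=
  (Measure.pi fun _ : Fin m => μ).map fun x => ∑ j, x j

theorem measurable_sum_coord (m : ℕ) : Measurable fun x : Fin m → ℝ => ∑ j, x j :=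
  Finset.measurable_sum _ fun j _ => measurable_pi_apply j

instance (m : ℕ) : IsProbabilityMeasure (sumLaw m μ) :=
  Measure.isProbabilityMeasure_map (measurable_sum_coord m).aemeasurable

theorem sumLaw_succ (m : ℕ) : sumLaw (m + 1) μ = μ ∗ sumLaw m μ := by
  have h := (measurePreserving_piFinSuccAbove (fun _ : Fin (m + 1) => μ) 0).symm
  rw [sumLaw, ← h.map_eq, Measure.map_map (measurable_sum_coord _) h.measurable, Measure.conv,
    sumLaw]
  have e : (μ.prod ((Measure.pi fun _ : Fin m => μ).map fun x => ∑ j, x j)) =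
      (μ.prod (Measure.pi fun _ : Fin m => μ)).map (Prod.map id fun x => ∑ j, x j) := by
    rw [← Measure.map_prod_map _ _ measurable_id (measurable_sum_coord m), Measure.map_id]
  rw [e, Measure.map_map measurable_add (measurable_id.prodMap (measurable_sum_coord m))]
  congr 1
  funext p
  simp [Fin.sum_univ_succ]

/-- The samples are replaced one at a time, each at cost `δ`. -/
theorem UpperClose.sumLaw (h : UpperClose δ μ μ') (m : ℕ) :
    UpperClose (m * δ) (sumLaw m μ) (sumLaw m μ') := by
  induction m with
  | zero =>
    intro U hU
    have : PseudoNash.sumLaw 0 μ = PseudoNash.sumLaw 0 μ' := by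
      simp [PseudoNash.sumLaw]
    simp [this]
  | succ m ih =>
    rw [sumLaw_succ, sumLaw_succ, Nat.cast_succ, add_mul, one_mul, add_comm]
    exact h.conv ih

theorem probMeanGE_eq {m : ℕ} (hm : 0 < m) :
    probMeanGE m μ ν = ((sumLaw m μ).prod (sumLaw m ν)).real {p | p.2 ≤ p.1} := by
  have hm' : (0 : ℝ) < m := Nat.cast_pos.2 hm
  have hs : MeasurableSet {p : ℝ × ℝ | p.2 ≤ p.1} :=
    measurableSet_le measurable_snd measurable_fst
  rw [probMeanGE, sumLaw, sumLaw, Measure.map_prod_map _ _ (measurable_sum_coord m)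
    (measurable_sum_coord m), measureReal_def, measureReal_def,
    Measure.map_apply ((measurable_sum_coord m).prodMap (measurable_sum_coord m)) hs]
  congr 2
  ext p
  simp only [Set.mem_ofPred_eq, Set.mem_preimage, Prod.map]
  exact div_le_div_iff_of_pos_right hm'

theorem abs_probMeanGE_sub_le (h₁ : UpperClose δ μ μ') (h₂ : UpperClose ε ν ν') {m : ℕ}
    (hm : 0 < m) : |probMeanGE m μ ν - probMeanGE m μ' ν'| ≤ m * (δ + ε) := by
  rw [probMeanGE_eq hm, probMeanGE_eq hm]
  have hs : MeasurableSet {p : ℝ × ℝ | p.2 ≤ p.1} :=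
    measurableSet_le measurable_snd measurable_fst
  have e₂ : |((sumLaw m μ).prod (sumLaw m ν)).real {p | p.2 ≤ p.1} -
      ((sumLaw m μ).prod (sumLaw m ν')).real {p | p.2 ≤ p.1}| ≤ m * ε := by
    refine abs_measureReal_prod_sub_le hs fun x => ?_
    -- Sections in the second variable are lower sets; they are handled through their complements,
    -- the open upper rays.
    have hx : (Prod.mk x ⁻¹' {p : ℝ × ℝ | p.2 ≤ p.1}) = (Set.Ioi x)ᶜ := by ext; simp
    rw [hx, probReal_compl_eq_one_sub measurableSet_Ioi,
      probReal_compl_eq_one_sub measurableSet_Ioi, sub_sub_sub_cancel_left, abs_sub_comm]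
    exact h₂.sumLaw m _ (isUpperSet_Ioi x)
  have e₁ : |((sumLaw m μ).prod (sumLaw m ν')).real {p | p.2 ≤ p.1} -
      ((sumLaw m μ').prod (sumLaw m ν')).real {p | p.2 ≤ p.1}| ≤ m * δ := by
    -- After exchanging the factors, the sections belong to the law that is replaced, and they are
    -- closed upper rays.
    have hsw : ∀ ρ : Measure ℝ, IsProbabilityMeasure ρ →
        ((sumLaw m ρ).prod (sumLaw m ν')).real {p | p.2 ≤ p.1} =
        ((sumLaw m ν').prod (sumLaw m ρ)).real {p | p.1 ≤ p.2} := fun ρ _ => by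
      rw [← Measure.prod_swap, measureReal_def, measureReal_def,
        Measure.map_apply measurable_swap hs]
      rfl
    rw [hsw μ inferInstance, hsw μ' inferInstance]
    exact abs_measureReal_prod_sub_le (measurableSet_le measurable_fst measurable_snd)
      fun x => h₁.sumLaw m _ (isUpperSet_Ici x)
  calc _ ≤ _ := abs_sub_le _ (((sumLaw m μ).prod (sumLaw m ν')).real {p | p.2 ≤ p.1}) _
    _ ≤ _ := add_le_add e₂ e₁
    _ = _ := by ring

end Means

/-- Computational mean dominance is preserved under negligible changes of the probabilities of
upper sets. -/
theorem MeanDominates.of_upperClose {X X' Y Y' : ℕ → Measure ℝ} {δ ε : ℕ → ℝ}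
    (hX : ∀ κ, IsProbabilityMeasure (X κ)) (hX' : ∀ κ, IsProbabilityMeasure (X' κ))
    (hY : ∀ κ, IsProbabilityMeasure (Y κ)) (hY' : ∀ κ, IsProbabilityMeasure (Y' κ))
    (hδ : Negligible δ) (hε : Negligible ε) (hXX' : ∀ κ, UpperClose (δ κ) (X κ) (X' κ))
    (hYY' : ∀ κ, UpperClose (ε κ) (Y κ) (Y' κ)) (h : MeanDominates X' Y') :
    MeanDominates X Y := by
  intro c hc
  -- Dominance is used with exponent `c + 1`. Its bound and the two errors of size `2 / κ ^ (c + 1)`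
  -- add up to `5 / κ ^ (c + 1)`, which is at most `1 / κ ^ c` for `κ ≥ 5`. The extra `c'` in the
  -- exponents for `δ` and `ε` pays for the number `κ ^ c'` of samples.
  obtain ⟨c', hc', κ₀, hκ₀, h⟩ := h (c + 1) (by omega)
  obtain ⟨κ₁, h₁⟩ := hδ (c' + (c + 1))
  obtain ⟨κ₂, h₂⟩ := hε (c' + (c + 1))
  refine ⟨c', by omega, max (max κ₀ 5) (max κ₁ κ₂), by positivity, fun κ hκ => ?_⟩
  simp only [ge_iff_le, max_le_iff] at hκ
  obtain ⟨⟨hκ0, hκ5⟩, hκ1, hκ2⟩ := hκ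
  have hpos : 0 < κ ^ c' := by positivity
  have hκ5' : (5 : ℝ) ≤ κ := by exact_mod_cast hκ5
  have hκpos : (0 : ℝ) < κ := by linarith
  have e₀ := h κ hκ0
  have e₁ := abs_le.1 (abs_probMeanGE_sub_le (hXX' κ) (hYY' κ) hpos)
  have e₂ := abs_le.1 (abs_probMeanGE_sub_le (hYY' κ) (hXX' κ) hpos)
  have e₃ : ((κ ^ c' : ℕ) : ℝ) * (δ κ + ε κ) ≤ 2 * (1 / (κ : ℝ) ^ (c + 1)) := by
    have a₁ := h₁ κ hκ1
    have a₂ := h₂ κ hκ2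
    have : (κ : ℝ) ^ c' * (1 / (κ : ℝ) ^ (c' + (c + 1))) = 1 / (κ : ℝ) ^ (c + 1) := by
      rw [pow_add]
      field_simp
    rw [Nat.cast_pow, ← this, mul_left_comm]
    exact mul_le_mul_of_nonneg_left (by linarith) (by positivity)
  have e₄ : 5 * (1 / (κ : ℝ) ^ (c + 1)) ≤ 1 / (κ : ℝ) ^ c := by
    rw [pow_succ, mul_one_div, div_le_div_iff₀ (by positivity) (by positivity), one_mul, mul_comm]
    exact mul_le_mul_of_nonneg_left hκ5' (by positivity)
  rw [add_comm (ε κ)] at e₂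
  linarith [e₁.1, e₂.2]

end PseudoNash

namespace PseudoNash

/-! ## Indistinguishable games -/

theorem Party.IsPPT.combine {σ : ITM Side} {P : Party} (hσ : σ.IsPPT) (hP : P.IsPPT) (a : Bool) :
    (Party.combine σ a P).IsPPT := by
  cases a with
  | false => exact hP
  | true =>
    cases P with
    | dummy => exact hσ
    | machine π => exact ITM.IsPPT.plug hσ hP

/-- The probability that a distributed string has utility in `U`. -/
theorem real_map_toMeasure (L : PMF (List Bool)) (u : List Bool → ℝ) {U : Set ℝ}
    (hU : MeasurableSet U) :
    (L.map u).toMeasure.real U = (L.toOuterMeasure {w | u w ∈ U}).toReal := by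
  rw [MeasureTheory.measureReal_def, PMF.toMeasure_apply_eq_toOuterMeasure_apply _ hU,
    PMF.toOuterMeasure_map_apply]
  rfl

/-- If two laws of outcomes are supported in a finite set, then it suffices to compare the
probabilities of the upper sets that are generated by one outcome of this set. -/
theorem upperClose_of_finite {L L' : PMF (List Bool)} {u : List Bool → ℝ} {S : Set (List Bool)}
    (hS : S.Finite) (hL : L.support ⊆ S) (hL' : L'.support ⊆ S) {δ : ℝ} (hδ : 0 ≤ δ)
    (h : ∀ x ∈ S, |(L.toOuterMeasure {w | u x ≤ u w}).toReal -
      (L'.toOuterMeasure {w | u x ≤ u w}).toReal| ≤ δ) :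
    UpperClose δ (L.map u).toMeasure (L'.map u).toMeasure := by
  intro U hU
  rw [real_map_toMeasure _ _ hU.measurableSet_real, real_map_toMeasure _ _ hU.measurableSet_real]
  by_cases hne : (S ∩ {w | u w ∈ U}).Nonempty
  · obtain ⟨x, ⟨hxS, hxU⟩, hx⟩ :=
      Set.exists_min_image (S ∩ {w | u w ∈ U}) u (hS.inter_of_left _) hne
    have key : ∀ M : PMF (List Bool), M.support ⊆ S →
        M.toOuterMeasure {w | u w ∈ U} = M.toOuterMeasure {w | u x ≤ u w} := fun M hM => by
      refine PMF.toOuterMeasure_apply_eq_of_inter_support_eq _ ?_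
      ext w
      exact and_congr_left fun hw => ⟨fun hwU => hx w ⟨hM hw, hwU⟩, fun hxw => hU hxw hxU⟩
    rw [key L hL, key L' hL']
    exact h x hxS
  · have key : ∀ M : PMF (List Bool), M.support ⊆ S →
        M.toOuterMeasure {w | u w ∈ U} = 0 := fun M hM => by
      rw [PMF.toOuterMeasure_apply_eq_zero_iff, Set.disjoint_left]
      exact fun w hw hwU => hne ⟨w, hM hw, hwU⟩
    rw [key L hL, key L' hL']
    simpa using hδ

/-- If two systems are indistinguishable, then a game that is played on top of them has utilities
with close distributions. -/
theorem Game.exists_negligible_upperClose {n : ℕ} (G : Game n) (i : Fin n) {σ : Fin n → ITM Side}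
    (hσ : ∀ j, (σ j).IsPPT) (J : Fin n → Bool) {P P' : Fin n → Party} {bot bot' : ITM (Fin n)}
    (hP : ∀ j, (P j).IsPPT) (hP' : ∀ j, (P' j).IsPPT) (hbot : bot.IsPPT) (hbot' : bot'.IsPPT)
    (h : Indistinguishable P bot P' bot') :
    ∃ δ : ℕ → ℝ, Negligible δ ∧ ∀ κ, UpperClose (δ κ)
      ((outputLaw G.rules (G.rules.initMem κ) (fun j => Party.combine (σ j) (J j) (P j)) bot κ).map
        (G.utility i κ)).toMeasure
      ((outputLaw G.rules (G.rules.initMem κ) (fun j => Party.combine (σ j) (J j) (P' j)) bot'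
        κ).map (G.utility i κ)).toMeasure := by
  obtain ⟨M, left, right, hl, hrecv, hM, hR⟩ := G.utility_ppt i
  obtain ⟨q₀, hJ⟩ := Option.isSome_iff_exists.1 hrecv
  -- The judge decides the comparison of utilities: the advice is on its tape `left`, the outcome of
  -- the game on `right`.
  let E : Tester n := ⟨G.rules, J, σ, M, right, q₀⟩
  obtain ⟨p, hp⟩ := G.rules_ppt.exists_bound
  let L : ℕ → PMF (List Bool) := fun κ =>
    outputLaw G.rules (G.rules.initMem κ) (E.players P) bot κ
  let L' : ℕ → PMF (List Bool) := fun κ =>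
    outputLaw G.rules (G.rules.initMem κ) (E.players P') bot' κ
  let S : ℕ → Set (List Bool) := fun κ => {w | w.length ≤ κ + p.eval κ}
  have hS : ∀ κ, (S κ).Finite := fun κ => List.finite_length_le Bool _
  have hsupp : ∀ κ (Q : Fin n → Party) (b : ITM (Fin n)),
      (outputLaw G.rules (G.rules.initMem κ) Q b κ).support ⊆ S κ := fun κ Q b w hw =>
    (length_le_of_mem_support_outputLaw (hp κ) w hw).trans
      (Nat.add_le_add_right (G.rules.length_initMem_le κ _) _)
  let f : ℕ → List Bool → ℝ := fun κ x =>
    |((L κ).toOuterMeasure {w | G.utility i κ x ≤ G.utility i κ w}).toReal -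
      ((L' κ).toOuterMeasure {w | G.utility i κ x ≤ G.utility i κ w}).toReal|
  -- The best threshold for each `κ` is not computed but supplied as advice; here the non-uniformity
  -- of distinguishers is essential. Thus a single distinguisher controls all thresholds in `S κ` at
  -- once.
  have hmax : ∀ κ, ∃ x ∈ S κ, ∀ y ∈ S κ, f κ y ≤ f κ x := fun κ =>
    Set.exists_max_image (S κ) (f κ) (hS κ) ⟨[], Nat.zero_le _⟩
  choose adv hadvS hadv using hmax
  have hbound := E.exists_bound hJ G.rules_ppt hσ hl hM (adv := adv)
    ⟨.X + p, fun κ => by rw [Polynomial.eval_add, Polynomial.eval_X]; exact hadvS κ⟩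
  let D : Distinguisher n := ⟨E.machine, .judge left hl, adv, hbound⟩
  have hprob : ∀ κ (Q : Fin n → Party) (b : ITM (Fin n)), (∀ j, (Q j).IsPPT) → b.IsPPT →
      D.prob Q b κ = ((outputLaw G.rules (G.rules.initMem κ) (E.players Q) b κ).toOuterMeasure
        {w | G.utility i κ (adv κ) ≤ G.utility i κ w}).toReal := fun κ Q b hQ hb => by
    refine congrArg ENNReal.toReal (E.outputLaw_accepts hJ hl κ (adv κ) ?_ G.rules_ppt hQ
      (fun j => (hQ j).combine (hσ j) _) hb (hR κ (adv κ)))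
    obtain ⟨p', hp'⟩ := hbound
    exact ⟨p'.eval κ, fun t a l T ⟨T', h, _⟩ => (hp' κ).2 t a l T' h⟩
  refine ⟨fun κ => f κ (adv κ), fun c => ?_, fun κ => ?_⟩
  · obtain ⟨κ₀, h₀⟩ := h D c
    refine ⟨κ₀, fun κ hκ => ?_⟩
    have hD : |D.prob P bot κ - D.prob P' bot' κ| < 1 / (κ : ℝ) ^ c := h₀ κ hκ
    rw [hprob κ P bot hP hbot, hprob κ P' bot' hP' hbot'] at hD
    exact hD
  · exact upperClose_of_finite (hS κ) (hsupp κ _ _) (hsupp κ _ _) (abs_nonneg _) (hadv κ)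

end PseudoNash

theorem mainTheorem1 {n : ℕ} (F : PseudoNash.ITM (Fin n)) (prot : PseudoNash.Protocol n)
    (hprot : prot.SecurelyRealizes F) (G : PseudoNash.Game n) (hG : G.HasAccess F)
    (σ : Fin n → PseudoNash.ITM PseudoNash.Side) (hσ : G.IsPseudoEquilibrium σ) :
    (G.implement prot).IsPseudoEquilibrium (prot.correspond σ) := by
  classical
  obtain rfl : G.link = F := hG
  obtain ⟨hσ, heq⟩ := hσ
  refine ⟨fun i => (hσ i).plug (prot.party_ppt i), fun i s' hs' => ?_⟩
  obtain ⟨S, hS, hind⟩ := hprot.2 i s' hs'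
  -- Honest play: with every strategy absorbed, combining with protocol machines yields the
  -- corresponding profile, and combining with dummies yields `σ`.
  obtain ⟨δ, hδ, hX⟩ := G.exists_negligible_upperClose i hσ (fun _ => true)
    (P := fun j => .machine (prot.party j)) (P' := fun _ => .dummy)
    (fun j => prot.party_ppt j) (fun _ => trivial) prot.channel_ppt G.link_ppt hprot.1
  have hupd : ∀ (Q : Fin n → PseudoNash.Party) (A : PseudoNash.ITM PseudoNash.Side),
      (∀ j, (Q j).IsPPT) → A.IsPPT → ∀ j, (Function.update Q i (.machine A) j).IsPPT := fun Q A hQ hA j => by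
    by_cases hj : j = i
    · subst hj; rw [Function.update_self]; exact hA
    · rw [Function.update_of_ne hj]; exact hQ j
  -- Deviation: the strategy of player `i` is not absorbed, so this player is `s'` over the protocol
  -- and `S` over the functionality.
  obtain ⟨ε, hε, hY⟩ := G.exists_negligible_upperClose i hσ (fun j => decide (j ≠ i))
    (hupd (fun j => .machine (prot.party j)) s' (fun j => prot.party_ppt j) hs')
    (hupd (fun _ => .dummy) S (fun _ => trivial) hS)
    prot.channel_ppt G.link_ppt hind
  have hcomb : ∀ (Q : Fin n → PseudoNash.Party) (τ : Fin n → PseudoNash.ITM PseudoNash.Side)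
      (A : PseudoNash.ITM PseudoNash.Side),
      (∀ j, PseudoNash.Party.combine (σ j) true (Q j) = .machine (τ j)) →
      (fun j => PseudoNash.Party.combine (σ j) (decide (j ≠ i)) (Function.update Q i (.machine A) j)) =
        fun j => .machine (Function.update τ i A j) := fun Q τ A h => by
    funext j
    by_cases hj : j = i
    · subst hj; simp [PseudoNash.Party.combine]
    · simp [hj, h]
  rw [hcomb _ (prot.correspond σ) s' fun j => rfl, hcomb _ σ S fun j => rfl] at hY
  -- The simulated machine `S` is an admissible deviation from `σ`, and its dominance is carried
  -- over to the game with the protocol.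
  exact (heq i S hS).of_upperClose (fun κ => PMF.toMeasure.isProbabilityMeasure _)
    (fun κ => PMF.toMeasure.isProbabilityMeasure _)
    (fun κ => PMF.toMeasure.isProbabilityMeasure _)
    (fun κ => PMF.toMeasure.isProbabilityMeasure _) hδ hε hX hY
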